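/- Use parabolic coordinates $x_1=\tfrac12(\xi^2-\eta^2)$, $x_2=\xi\eta$ on a domain $I\times J$ ($I,J\subseteq\mathbb R$ nonempty open, $(0,0)\notin I\times J$), and potentials $$V=\frac{W_1(\xi)+W_2(\eta)}{\xi^2+\eta^2}$$ with $W_1\in C^\infty(I)$, $W_2\in C^\infty(J)$ real. For real constants $A_{jk\ell}$ ($j+k+\ell=3$) put $L_3=x_1p_2-x_2p_1$ and define polynomials $F_1,\dots,F_4$ in $\xi,\eta$ by $$\sum_{j+k+\ell=3}A_{jk\ell}L_3^jp_1^kp_2^\ell=\frac{F_1p_\xi^3+F_2p_\xi^2p_\eta+F_3p_\xi p_\eta^2+F_4p_\eta^3}{(\xi^2+\eta^2)^3},\qquad p_1=\frac{\xi p_\xi-\eta p_\eta}{\xi^2+\eta^2},\quad p_2=\frac{\eta p_\xi+\xi p_\eta}{\xi^2+\eta^2}.$$ The linear compatibility condition $\mathrm{(LC)}$ with coefficients $A$ is the following equation on $I\times J$ (subscripts $\xi,\eta$ are partial derivatives, $\rho=\xi^2+\eta^2$): $$\begin{aligned}0={}&F_3V_{\xi\xi\xi}+(3F_4-2F_2)V_{\xi\xi\eta}+(3F_1-2F_3)V_{\xi\eta\eta}+F_2V_{\eta\eta\eta}\\&+\Big(2(F_{3,\xi}-F_{2,\eta})-\tfrac{3\xi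 F_1-6\eta F_2+7\xi F_3}{\rho}\Big)V_{\xi\xi}+\Big(2(F_{2,\eta}-F_{3,\xi})-\tfrac{3\eta F_4-6\xi F_3+7\eta F_2}{\rho}\Big)V_{\eta\eta}\\&+\Big(2(3F_{1,\eta}-F_{2,\xi}-F_{3,\eta}+3F_{4,\xi})-\tfrac{21\eta F_1-5\eta F_3-5\xi F_2+21\xi F_4}{\rho}\Big)V_{\xi\eta}+\mathcal A\,V_\eta+\mathcal B\,V_\xi,\end{aligned}$$ $$\begin{aligned}\mathcal A={}&F_{2,\eta\eta}-2F_{3,\xi\eta}+3F_{4,\xi\xi}+\tfrac{-7\eta F_{2,\eta}-\xi F_{2,\xi}+6\xi F_{3,\eta}+6\eta F_{3,\xi}-3\eta F_{4,\eta}-21\xi F_{4,\xi}}{\rho}\\&+2\,\tfrac{21\xi^2F_4+\xi^2F_2+7\eta^2F_2-12\xi\eta F_3+3\eta^2F_4}{\rho^2},\\ \mathcal B={}&3F_{1,\eta\eta}-2F_{2,\xi\eta}+F_{3,\xi\xi}-\tfrac{21\eta F_{1,\eta}+3\xi F_{1,\xi}-6\xi F_{2,\eta}-6\eta F_{2,\xi}+\eta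 F_{3,\eta}+7\xi F_{3,\xi}}{\rho}\\&+2\,\tfrac{\eta^2F_3+3\xi^2F_1+21\eta^2F_1-12\xi\eta F_2+7\xi^2F_3}{\rho^2}.\end{aligned}$$ A third-order integral with leading coefficients $A$ is $$X=\sum_{j+k+\ell=3}A_{jk\ell}\{L_3^j,p_1^kp_2^\ell\}+\{g_1,p_1\}+\{g_2,p_2\},\qquad g_1,g_2\in C^\infty(I\times J)\ \text{real},$$ ($\{B,C\}=BC+CB$) that commutes with $H=\tfrac12(p_1^2+p_2^2)+V$: either classically (its Poisson bracket with $H$ vanishes), or quantum mechanically for some $\hbar>0$ ($p_a=-i\hbar\,\partial/\partial x_a$ and $[H,X]=0$ on smooth functions). It is genuine if some $A_{jk\ell}\neq0$. **(1)** For every domain $I\times J$ and every $A$: $\mathrm{(LC)}$ holds identically, i.e. for all smooth $W_1,W_2$, if and only if all $A_{jk\ell}$ vanish. **(2)** Let $A\ne0$. There are two nontrivial systems $S_1,S_2$, depending only on $A$, each of at most 14 homogeneous linear ODEs of order at most 17 with real polynomial coefficients, such that for every domain $I\times J$ and all smooth $W_1,W_2$: * if $H$ admits a (classical or quantum) third-order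 integral with leading coefficients $A$ on $I\times J$, then $\mathrm{(LC)}$ holds for $V$; * if $\mathrm{(LC)}$ holds for $V$ (hence whenever there is such an integral), then $W_1$ satisfies $S_1$ on $I$ and $W_2$ satisfies $S_2$ on $J$, and neither depends on elliptic functions or on Painlevé transcendents in the following sense, where $W$ is $W_1$ or $W_2$ and $K$ is any nonempty open subset of $I$ or $J$ respectively: * (elliptic) if $r(x)W(x)=\sum_{k=0}^{n-1}e_k(x)x^k$ on $K$ with a nonzero complex polynomial $r$ and elliptic functions $e_k$ with a common period lattice, then all $e_k$ are constant; in particular $W|_K$ is not a nonconstant elliptic function; * (Painlevé) if $W(x)=R\big(x,w(ax+b),w'(ax+b)\big)$ on $K$ with $a\in\mathbb C\setminus\{0\}$, $b\in\mathbb C$, a complex rational function $R$ of three variables (with denominator nonvanishing along $K$) and a Painlevé transcendent $w$ on a domain of $\mathbb C$ containing $aK+b$, then $R$ is a rational function of its first variable alone. Here a Painlevé transcendent on a domain $U\subseteq\mathbb C$ is a holomorphic solution on $U$ of one of the equations $P_{I},\dots,P_{VI}$ (with $U$ avoiding the fixed singular points and $w$ the singular values of the equation) that is irreducible in the sense of Painlevé: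 on no subdomain can it be obtained from constants and the identity function by finitely many field operations, derivations, and solutions of linear ODEs or of algebraic ODEs of order at most one with previously obtained coefficients. -/

import Mathlib

open scoped Polynomial ContDiff

noncomputable section

/-! ### Functions of the parabolic coordinates `(ξ, η)`, `x₁ = (ξ² - η²)/2`, `x₂ = ξ η` -/

/-- Partial derivative `∂f/∂ξ` of a function of `(ξ, η)`. -/
def pdXi {E : Type*} [NormedAddCommGroup E] [NormedSpace ℝ E] (f : ℝ → ℝ → E) : ℝ → ℝ → E :=
  fun ξ η => deriv (fun t => f t η) ξ

/-- Partial derivative `∂f/∂η` of a function of `(ξ, η)`. -/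
def pdEta {E : Type*} [NormedAddCommGroup E] [NormedSpace ℝ E] (f : ℝ → ℝ → E) : ℝ → ℝ → E :=
  fun ξ η => deriv (fun t => f ξ t) η

/-- `f` is a smooth function of `(ξ, η) ∈ I × J`. -/
def SmoothOnRect {E : Type*} [NormedAddCommGroup E] [NormedSpace ℝ E]
    (I J : Set ℝ) (f : ℝ → ℝ → E) : Prop :=
  ContDiffOn ℝ ∞ (Function.uncurry f) (I ×ˢ J)

/-- Admissible coordinate domain `I × J`: the factors are open and nonempty and the product does not
contain the origin, where parabolic coordinates are singular. -/
def IsParabolicDomain (I J : Set ℝ) : Prop :=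
  IsOpen I ∧ I.Nonempty ∧ IsOpen J ∧ J.Nonempty ∧ ∀ ξ ∈ I, ∀ η ∈ J, ξ ^ 2 + η ^ 2 ≠ 0

/-- The potential `V = (W₁(ξ) + W₂(η)) / (ξ² + η²)` that separates in parabolic coordinates. -/
def sepPotential (W₁ W₂ : ℝ → ℝ) : ℝ → ℝ → ℝ :=
  fun ξ η => (W₁ ξ + W₂ η) / (ξ ^ 2 + η ^ 2)

/-! ### The quantum third-order integral -/

/-- `p₁ = -iħ ∂/∂x₁` in parabolic coordinates. -/
def opP1 (ħ : ℝ) (ψ : ℝ → ℝ → ℂ) : ℝ → ℝ → ℂ :=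
  fun ξ η => -Complex.I * ħ / ((ξ : ℂ) ^ 2 + (η : ℂ) ^ 2) * (ξ * pdXi ψ ξ η - η * pdEta ψ ξ η)

/-- `p₂ = -iħ ∂/∂x₂` in parabolic coordinates. -/
def opP2 (ħ : ℝ) (ψ : ℝ → ℝ → ℂ) : ℝ → ℝ → ℂ :=
  fun ξ η => -Complex.I * ħ / ((ξ : ℂ) ^ 2 + (η : ℂ) ^ 2) * (η * pdXi ψ ξ η + ξ * pdEta ψ ξ η)

/-- `L₃ = x₁ p₂ - x₂ p₁` in parabolic coordinates. -/
def opL3 (ħ : ℝ) (ψ : ℝ → ℝ → ℂ) : ℝ → ℝ → ℂ :=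
  fun ξ η => -Complex.I * ħ / 2 * (ξ * pdEta ψ ξ η - η * pdXi ψ ξ η)

/-- Multiplication by a real function. -/
def opMul (g : ℝ → ℝ → ℝ) (ψ : ℝ → ℝ → ℂ) : ℝ → ℝ → ℂ :=
  fun ξ η => (g ξ η : ℂ) * ψ ξ η

/-- The anticommutator `{B, C} = B C + C B`, applied to `ψ`. -/
def antiComm (B C : (ℝ → ℝ → ℂ) → (ℝ → ℝ → ℂ)) (ψ : ℝ → ℝ → ℂ) : ℝ → ℝ → ℂ :=
  B (C ψ) + C (B ψ)

/-- The quantum Hamiltonian `H = (p₁² + p₂²)/2 + V`. -/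
def opH (ħ : ℝ) (V : ℝ → ℝ → ℝ) (ψ : ℝ → ℝ → ℂ) : ℝ → ℝ → ℂ :=
  (1 / 2 : ℂ) • (opP1 ħ (opP1 ħ ψ) + opP2 ħ (opP2 ħ ψ)) + opMul V ψ

/-- The operator
`X = ∑_{j+k+l=3} A_{jkl} {L₃^j, p₁^k p₂^l} + {g₁, p₁} + {g₂, p₂}`. -/
def opX (ħ : ℝ) (A : ℕ → ℕ → ℕ → ℝ) (g₁ g₂ : ℝ → ℝ → ℝ) (ψ : ℝ → ℝ → ℂ) : ℝ → ℝ → ℂ :=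
  (∑ t ∈ Finset.Nat.antidiagonalTuple 3 3, ((A (t 0) (t 1) (t 2) : ℝ) : ℂ) •
      antiComm ((opL3 ħ)^[t 0]) (fun φ => ((opP1 ħ)^[t 1]) (((opP2 ħ)^[t 2]) φ)) ψ)
    + antiComm (opMul g₁) (opP1 ħ) ψ + antiComm (opMul g₂) (opP2 ħ) ψ

/-- `[H, X] = 0` on smooth functions on `I × J`. -/
def QuantumIntegral (ħ : ℝ) (I J : Set ℝ) (V : ℝ → ℝ → ℝ) (A : ℕ → ℕ → ℕ → ℝ)
    (g₁ g₂ : ℝ → ℝ → ℝ) : Prop :=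
  ∀ ψ : ℝ → ℝ → ℂ, SmoothOnRect I J ψ → ∀ ξ ∈ I, ∀ η ∈ J,
    opH ħ V (opX ħ A g₁ g₂ ψ) ξ η = opX ħ A g₁ g₂ (opH ħ V ψ) ξ η

/-! ### The classical third-order integral

Functions on phase space are functions of `(ξ, η, p_ξ, p_η)`. -/

/-- The Poisson bracket in the canonical coordinates `(ξ, η, p_ξ, p_η)`. -/
def poissonBracket (f g : ℝ → ℝ → ℝ → ℝ → ℝ) : ℝ → ℝ → ℝ → ℝ → ℝ :=
  fun ξ η p q =>
    deriv (fun t => f t η p q) ξ * deriv (fun t => g ξ η t q) p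
      - deriv (fun t => f ξ η t q) p * deriv (fun t => g t η p q) ξ
      + deriv (fun t => f ξ t p q) η * deriv (fun t => g ξ η p t) q
      - deriv (fun t => f ξ η p t) q * deriv (fun t => g ξ t p q) η

/-- The Cartesian momentum `p₁` in terms of `(ξ, η, p_ξ, p_η)`. -/
def clP1 : ℝ → ℝ → ℝ → ℝ → ℝ := fun ξ η p q => (ξ * p - η * q) / (ξ ^ 2 + η ^ 2)

/-- The Cartesian momentum `p₂` in terms of `(ξ, η, p_ξ, p_η)`. -/
def clP2 : ℝ → ℝ → ℝ → ℝ → ℝ := fun ξ η p q => (η * p + ξ * q) / (ξ ^ 2 + η ^ 2)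

/-- The angular momentum `L₃ = x₁ p₂ - x₂ p₁` in terms of `(ξ, η, p_ξ, p_η)`. -/
def clL3 : ℝ → ℝ → ℝ → ℝ → ℝ := fun ξ η p q => (ξ * q - η * p) / 2

/-- The classical Hamiltonian `H = (p₁² + p₂²)/2 + V`. -/
def clH (V : ℝ → ℝ → ℝ) : ℝ → ℝ → ℝ → ℝ → ℝ :=
  fun ξ η p q => (clP1 ξ η p q ^ 2 + clP2 ξ η p q ^ 2) / 2 + V ξ η

/-- The classical counterpart of `opX`; the anticommutator is twice the product. -/
def clX (A : ℕ → ℕ → ℕ → ℝ) (g₁ g₂ : ℝ → ℝ → ℝ) : ℝ → ℝ → ℝ → ℝ → ℝ :=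
  fun ξ η p q =>
    (∑ t ∈ Finset.Nat.antidiagonalTuple 3 3, A (t 0) (t 1) (t 2) *
        (2 * clL3 ξ η p q ^ t 0 * clP1 ξ η p q ^ t 1 * clP2 ξ η p q ^ t 2))
      + 2 * g₁ ξ η * clP1 ξ η p q + 2 * g₂ ξ η * clP2 ξ η p q

/-- `{H, X} = 0` on the phase space over `I × J`. -/
def ClassicalIntegral (I J : Set ℝ) (V : ℝ → ℝ → ℝ) (A : ℕ → ℕ → ℕ → ℝ)
    (g₁ g₂ : ℝ → ℝ → ℝ) : Prop :=
  ∀ ξ ∈ I, ∀ η ∈ J, ∀ p q : ℝ, poissonBracket (clH V) (clX A g₁ g₂) ξ η p q = 0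

/-- The Hamiltonian with potential `V` admits on `I × J` a third-order integral of motion with
leading coefficients `A`, in classical mechanics or in quantum mechanics. -/
def AdmitsThirdOrderIntegral (I J : Set ℝ) (V : ℝ → ℝ → ℝ) (A : ℕ → ℕ → ℕ → ℝ) : Prop :=
  ∃ g₁ g₂ : ℝ → ℝ → ℝ, SmoothOnRect I J g₁ ∧ SmoothOnRect I J g₂ ∧
    (ClassicalIntegral I J V A g₁ g₂ ∨ ∃ ħ : ℝ, 0 < ħ ∧ QuantumIntegral ħ I J V A g₁ g₂)

/-! ### The linear compatibility condition -/

/-- The polynomial `F₁`. -/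
def polyF1 (A : ℕ → ℕ → ℕ → ℝ) : ℝ → ℝ → ℝ := fun ξ η =>
  η ^ 3 * A 0 0 3 + ξ * η ^ 2 * A 0 1 2 + ξ ^ 3 * A 0 3 0
    - 1 / 2 * η ^ 3 * (ξ ^ 2 + η ^ 2) * A 1 0 2
    - 1 / 2 * ξ * η ^ 2 * (ξ ^ 2 + η ^ 2) * A 1 1 1
    - 1 / 2 * η * ξ ^ 2 * (ξ ^ 2 + η ^ 2) * A 1 2 0
    + 1 / 4 * η ^ 3 * (ξ ^ 2 + η ^ 2) ^ 2 * A 2 0 1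
    + 1 / 4 * ξ * η ^ 2 * (ξ ^ 2 + η ^ 2) ^ 2 * A 2 1 0
    - 1 / 8 * η ^ 3 * (ξ ^ 2 + η ^ 2) ^ 3 * A 3 0 0
    + ξ ^ 2 * η * A 0 2 1

/-- The polynomial `F₂`. -/
def polyF2 (A : ℕ → ℕ → ℕ → ℝ) : ℝ → ℝ → ℝ := fun ξ η =>
  3 * ξ * η ^ 2 * A 0 0 3 - η * (η ^ 2 - 2 * ξ ^ 2) * A 0 1 2 - 3 * ξ ^ 2 * η * A 0 3 0
    - 1 / 2 * ξ * η ^ 2 * (ξ ^ 2 + η ^ 2) * A 1 0 2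
    + 1 / 2 * η ^ 3 * (ξ ^ 2 + η ^ 2) * A 1 1 1
    + 1 / 2 * ξ * (ξ ^ 2 + 2 * η ^ 2) * (ξ ^ 2 + η ^ 2) * A 1 2 0
    - 1 / 4 * ξ * η ^ 2 * (ξ ^ 2 + η ^ 2) ^ 2 * A 2 0 1
    - 1 / 4 * η * (η ^ 2 + 2 * ξ ^ 2) * (ξ ^ 2 + η ^ 2) ^ 2 * A 2 1 0
    + 3 / 8 * ξ * η ^ 2 * (ξ ^ 2 + η ^ 2) ^ 3 * A 3 0 0
    - A 0 2 1 * ξ * (2 * η ^ 2 - ξ ^ 2)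

/-- The polynomial `F₃`. -/
def polyF3 (A : ℕ → ℕ → ℕ → ℝ) : ℝ → ℝ → ℝ := fun ξ η =>
  3 * ξ ^ 2 * η * A 0 0 3 - ξ * (2 * η ^ 2 - ξ ^ 2) * A 0 1 2 + 3 * ξ * η ^ 2 * A 0 3 0
    + 1 / 2 * η * ξ ^ 2 * (ξ ^ 2 + η ^ 2) * A 1 0 2
    + 1 / 2 * ξ ^ 3 * (ξ ^ 2 + η ^ 2) * A 1 1 1
    - 1 / 2 * η * (η ^ 2 + 2 * ξ ^ 2) * (ξ ^ 2 + η ^ 2) * A 1 2 0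
    - 1 / 4 * η * ξ ^ 2 * (ξ ^ 2 + η ^ 2) ^ 2 * A 2 0 1
    + 1 / 4 * ξ * (ξ ^ 2 + 2 * η ^ 2) * (ξ ^ 2 + η ^ 2) ^ 2 * A 2 1 0
    - 3 / 8 * η * ξ ^ 2 * (ξ ^ 2 + η ^ 2) ^ 3 * A 3 0 0
    + η * A 0 2 1 * (η ^ 2 - 2 * ξ ^ 2)

/-- The polynomial `F₄`. -/
def polyF4 (A : ℕ → ℕ → ℕ → ℝ) : ℝ → ℝ → ℝ := fun ξ η =>
  ξ ^ 3 * A 0 0 3 - ξ ^ 2 * η * A 0 1 2 - η ^ 3 * A 0 3 0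
    + 1 / 2 * ξ ^ 3 * (ξ ^ 2 + η ^ 2) * A 1 0 2
    - 1 / 2 * η * ξ ^ 2 * (ξ ^ 2 + η ^ 2) * A 1 1 1
    + 1 / 2 * ξ * η ^ 2 * (ξ ^ 2 + η ^ 2) * A 1 2 0
    + 1 / 4 * ξ ^ 3 * (ξ ^ 2 + η ^ 2) ^ 2 * A 2 0 1
    - 1 / 4 * η * ξ ^ 2 * (ξ ^ 2 + η ^ 2) ^ 2 * A 2 1 0
    + 1 / 8 * ξ ^ 3 * (ξ ^ 2 + η ^ 2) ^ 3 * A 3 0 0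
    + ξ * η ^ 2 * A 0 2 1

/-- The coefficient of `V_η` in the linear compatibility condition. -/
def coeffVEta (A : ℕ → ℕ → ℕ → ℝ) (ξ η : ℝ) : ℝ :=
  pdEta (pdEta (polyF2 A)) ξ η - 2 * pdXi (pdEta (polyF3 A)) ξ η
    + 3 * pdXi (pdXi (polyF4 A)) ξ η
    + (-7 * η * pdEta (polyF2 A) ξ η - ξ * pdXi (polyF2 A) ξ η + 6 * ξ * pdEta (polyF3 A) ξ η
        + 6 * η * pdXi (polyF3 A) ξ η - 3 * η * pdEta (polyF4 A) ξ η
        - 21 * ξ * pdXi (polyF4 A) ξ η) / (ξ ^ 2 + η ^ 2)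
    + 2 * (21 * ξ ^ 2 * polyF4 A ξ η + ξ ^ 2 * polyF2 A ξ η + 7 * η ^ 2 * polyF2 A ξ η
        - 12 * ξ * η * polyF3 A ξ η + 3 * η ^ 2 * polyF4 A ξ η) / (ξ ^ 2 + η ^ 2) ^ 2

/-- The coefficient of `V_ξ` in the linear compatibility condition. -/
def coeffVXi (A : ℕ → ℕ → ℕ → ℝ) (ξ η : ℝ) : ℝ :=
  3 * pdEta (pdEta (polyF1 A)) ξ η - 2 * pdXi (pdEta (polyF2 A)) ξ η
    + pdXi (pdXi (polyF3 A)) ξ η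
    - (21 * η * pdEta (polyF1 A) ξ η + 3 * ξ * pdXi (polyF1 A) ξ η - 6 * ξ * pdEta (polyF2 A) ξ η
        - 6 * η * pdXi (polyF2 A) ξ η + η * pdEta (polyF3 A) ξ η
        + 7 * ξ * pdXi (polyF3 A) ξ η) / (ξ ^ 2 + η ^ 2)
    + 2 * (η ^ 2 * polyF3 A ξ η + 3 * ξ ^ 2 * polyF1 A ξ η + 21 * η ^ 2 * polyF1 A ξ η
        - 12 * ξ * η * polyF2 A ξ η + 7 * ξ ^ 2 * polyF3 A ξ η) / (ξ ^ 2 + η ^ 2) ^ 2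

/-- The right-hand side of the linear compatibility condition `0 = …` for the potential `V`. -/
def linCompat (A : ℕ → ℕ → ℕ → ℝ) (V : ℝ → ℝ → ℝ) (ξ η : ℝ) : ℝ :=
  polyF3 A ξ η * pdXi (pdXi (pdXi V)) ξ η
    + (3 * polyF4 A ξ η - 2 * polyF2 A ξ η) * pdEta (pdXi (pdXi V)) ξ η
    + (3 * polyF1 A ξ η - 2 * polyF3 A ξ η) * pdEta (pdEta (pdXi V)) ξ η
    + polyF2 A ξ η * pdEta (pdEta (pdEta V)) ξ η
    + (2 * (pdXi (polyF3 A) ξ η - pdEta (polyF2 A) ξ η)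
        - (3 * ξ * polyF1 A ξ η - 6 * η * polyF2 A ξ η + 7 * ξ * polyF3 A ξ η)
          / (ξ ^ 2 + η ^ 2)) * pdXi (pdXi V) ξ η
    + (2 * (pdEta (polyF2 A) ξ η - pdXi (polyF3 A) ξ η)
        - (3 * η * polyF4 A ξ η - 6 * ξ * polyF3 A ξ η + 7 * η * polyF2 A ξ η)
          / (ξ ^ 2 + η ^ 2)) * pdEta (pdEta V) ξ η
    + (2 * (3 * pdEta (polyF1 A) ξ η - pdXi (polyF2 A) ξ η - pdEta (polyF3 A) ξ η
          + 3 * pdXi (polyF4 A) ξ η)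
        - (21 * η * polyF1 A ξ η - 5 * η * polyF3 A ξ η - 5 * ξ * polyF2 A ξ η
            + 21 * ξ * polyF4 A ξ η) / (ξ ^ 2 + η ^ 2)) * pdEta (pdXi V) ξ η
    + coeffVEta A ξ η * pdEta V ξ η + coeffVXi A ξ η * pdXi V ξ η

/-- The linear compatibility condition holds for `V` throughout `I × J`. -/
def LinearCompatibility (A : ℕ → ℕ → ℕ → ℝ) (I J : Set ℝ) (V : ℝ → ℝ → ℝ) : Prop :=
  ∀ ξ ∈ I, ∀ η ∈ J, linCompat A V ξ η = 0

/-! ### Linear ordinary differential equations -/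

/-- A system of 14 homogeneous linear ODEs of order at most 17 with polynomial coefficients:
`S m k` is the coefficient of the `k`-th derivative in the `m`-th equation. The system is
nontrivial if `S ≠ 0`. -/
abbrev LinearODESystem : Type := Fin 14 → Fin 18 → ℝ[X]

/-- `W` satisfies the system `S` on `I`. -/
def LinearODESystem.IsSolution (S : LinearODESystem) (I : Set ℝ) (W : ℝ → ℝ) : Prop :=
  ∀ x ∈ I, ∀ m : Fin 14, ∑ k : Fin 18, (S m k).eval x * iteratedDeriv (k : ℕ) W x = 0

/-! ### Elliptic functions -/

/-- `f` is an elliptic function for the period lattice of `L` (possibly constant): meromorphic on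
the plane and doubly periodic. -/
def IsElliptic (L : PeriodPair) (f : ℂ → ℂ) : Prop :=
  Meromorphic f ∧ ∀ l ∈ L.lattice, ∀ z, f (z + l) = f z

/-- `W` does not depend on elliptic functions: whenever, on some nonempty open `K ⊆ I`,
`r(x) W(x) = ∑_k e_k(x) x^k` with a nonzero polynomial `r` and elliptic functions `e_k` with a common
period lattice, all the `e_k` are constant (as meromorphic functions). In particular `W` agrees on
no nonempty open subset of `I` with a nonconstant elliptic function. -/
def NoEllipticDependence (I : Set ℝ) (W : ℝ → ℝ) : Prop :=
  ∀ K : Set ℝ, K ⊆ I → IsOpen K → K.Nonempty →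
    ∀ (L : PeriodPair) (n : ℕ) (e : Fin n → ℂ → ℂ) (r : ℂ[X]), (∀ k, IsElliptic L (e k)) → r ≠ 0 →
      (∀ x ∈ K, r.eval (x : ℂ) * (W x : ℂ) = ∑ k : Fin n, e k (x : ℂ) * (x : ℂ) ^ (k : ℕ)) →
      ∀ k, ∃ c : ℂ, ∀ z, AnalyticAt ℂ (e k) z → e k z = c

/-! ### Painlevé transcendents -/

/-- `w` is holomorphic on `U` and solves one of the six Painlevé equations there, for some values of
the parameters; `U` avoids the fixed singular points of the equation and `w` avoids its singular
values. -/
def SolvesPainleve (U : Set ℂ) (w : ℂ → ℂ) : Prop :=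
  DifferentiableOn ℂ w U ∧
  ((∀ z ∈ U, iteratedDeriv 2 w z = 6 * w z ^ 2 + z) ∨
   (∃ α : ℂ, ∀ z ∈ U, iteratedDeriv 2 w z = 2 * w z ^ 3 + z * w z + α) ∨
   (∃ α β γ δ : ℂ, ∀ z ∈ U, z ≠ 0 ∧ w z ≠ 0 ∧
      iteratedDeriv 2 w z = deriv w z ^ 2 / w z - deriv w z / z + (α * w z ^ 2 + β) / z
        + γ * w z ^ 3 + δ / w z) ∨
   (∃ α β : ℂ, ∀ z ∈ U, w z ≠ 0 ∧
      iteratedDeriv 2 w z = deriv w z ^ 2 / (2 * w z) + 3 / 2 * w z ^ 3 + 4 * z * w z ^ 2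
        + 2 * (z ^ 2 - α) * w z + β / w z) ∨
   (∃ α β γ δ : ℂ, ∀ z ∈ U, z ≠ 0 ∧ w z ≠ 0 ∧ w z ≠ 1 ∧
      iteratedDeriv 2 w z = (1 / (2 * w z) + 1 / (w z - 1)) * deriv w z ^ 2 - deriv w z / z
        + (w z - 1) ^ 2 / z ^ 2 * (α * w z + β / w z) + γ * w z / z
        + δ * w z * (w z + 1) / (w z - 1)) ∨
   (∃ α β γ δ : ℂ, ∀ z ∈ U, z ≠ 0 ∧ z ≠ 1 ∧ w z ≠ 0 ∧ w z ≠ 1 ∧ w z ≠ z ∧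
      iteratedDeriv 2 w z = 1 / 2 * (1 / w z + 1 / (w z - 1) + 1 / (w z - z)) * deriv w z ^ 2
        - (1 / z + 1 / (z - 1) + 1 / (w z - z)) * deriv w z
        + w z * (w z - 1) * (w z - z) / (z ^ 2 * (z - 1) ^ 2)
          * (α + β * z / w z ^ 2 + γ * (z - 1) / (w z - 1) ^ 2
              + δ * z * (z - 1) / (w z - z) ^ 2)))

/-- The functions on the domain `U` that are reducible in the sense of Painlevé: those obtained from
constants and the identity by finitely many field operations and derivations and by finitely many
times solving a linear ODE (of any order) or an algebraic ODE of order at most one (in particular an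
algebraic equation) whose coefficients have been obtained before. -/
inductive IsReducibleOn (U : Set ℂ) : (ℂ → ℂ) → Prop
  | const (c : ℂ) : IsReducibleOn U (fun _ => c)
  | ident : IsReducibleOn U (fun z => z)
  | sum (f g : ℂ → ℂ) : IsReducibleOn U f → IsReducibleOn U g →
      IsReducibleOn U (fun z => f z + g z)
  | prod (f g : ℂ → ℂ) : IsReducibleOn U f → IsReducibleOn U g →
      IsReducibleOn U (fun z => f z * g z)
  | inv (f : ℂ → ℂ) : IsReducibleOn U f → (∀ z ∈ U, f z ≠ 0) →
      IsReducibleOn U (fun z => (f z)⁻¹)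
  | derivative (f : ℂ → ℂ) : IsReducibleOn U f → IsReducibleOn U (deriv f)
  | linearODE (n : ℕ) (c : Fin n → ℂ → ℂ) (b f : ℂ → ℂ) :
      (∀ k, IsReducibleOn U (c k)) → IsReducibleOn U b →
      (∃ k, ∃ z ∈ U, c k z ≠ 0) → DifferentiableOn ℂ f U →
      (∀ z ∈ U, ∑ k : Fin n, c k z * iteratedDeriv (k : ℕ) f z = b z) → IsReducibleOn U f
  | firstOrderODE (n : ℕ) (c : Fin n → Fin n → ℂ → ℂ) (f : ℂ → ℂ) :
      (∀ i j, IsReducibleOn U (c i j)) →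
      (∃ i j, ∃ z ∈ U, c i j z ≠ 0) → DifferentiableOn ℂ f U →
      (∀ z ∈ U, ∑ i : Fin n, ∑ j : Fin n, c i j z * f z ^ (i : ℕ) * deriv f z ^ (j : ℕ) = 0) →
      IsReducibleOn U f

/-- `w` is a Painlevé transcendent on the domain `U`: it solves one of the six Painlevé equations,
and it is reducible on no subdomain. -/
def IsPainleveTranscendent (U : Set ℂ) (w : ℂ → ℂ) : Prop :=
  IsOpen U ∧ IsConnected U ∧ SolvesPainleve U w ∧
    ∀ V : Set ℂ, V ⊆ U → IsOpen V → IsConnected V → ¬ IsReducibleOn V w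

/-- `W` does not depend on Painlevé transcendents: whenever, on some nonempty open `K ⊆ I`,
`W(x) = R(x, w(a x + b), w'(a x + b))` with `a ≠ 0`, a Painlevé transcendent `w` and a rational
function `R = P / Q` of three variables, `R` is a rational function of its first variable alone. -/
def NoPainleveDependence (I : Set ℝ) (W : ℝ → ℝ) : Prop :=
  ∀ K : Set ℝ, K ⊆ I → IsOpen K → K.Nonempty →
    ∀ (U : Set ℂ) (w : ℂ → ℂ) (a b : ℂ) (P Q : MvPolynomial (Fin 3) ℂ),
      IsPainleveTranscendent U w → a ≠ 0 →
      (∀ x ∈ K, a * x + b ∈ U ∧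
        MvPolynomial.eval ![(x : ℂ), w (a * x + b), deriv w (a * x + b)] Q ≠ 0 ∧
        (W x : ℂ) = MvPolynomial.eval ![(x : ℂ), w (a * x + b), deriv w (a * x + b)] P
          / MvPolynomial.eval ![(x : ℂ), w (a * x + b), deriv w (a * x + b)] Q) →
      ∃ c d : ℂ[X], d ≠ 0 ∧
        Polynomial.aeval (MvPolynomial.X (0 : Fin 3)) d * P
          = Polynomial.aeval (MvPolynomial.X (0 : Fin 3)) c * Q

end

/-! The condition (LC) is linear in V, and W₁, W₂ enter it through one variable each. This alone
forces linear ordinary differential equations on them.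

An integral implies (LC): the part of {H, X} quadratic in the momenta, or the second-order symbol of
[H, X], prescribes the symmetrised gradient of (g₁, g₂). The resulting `DeterminingEquations` are
the same in both cases. Being three equations for two unknowns, they have an integrability
condition, the Saint-Venant equation written in parabolic coordinates, and (LC) is that condition
(`linCompat_eq_compatOp`, `compatOp_eq_zero`). In the quantum case a double commutator with
multiplication by h isolates the symbol at dh (`doubleComm_commutator`), so terms of lower order
never have to be computed.

(LC) implies differential equations: multiplied by ρ⁴, it is a sum of a W₁-part and a W₂-part with
polynomial coefficients (`linCompat_separable`). The W₂-part is a polynomial in ξ of degree at most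
13 over the functions of η, so ∂_ξ¹⁴ kills it (`evalOp_eq_zero`). There remains an operator of order
17 in ξ applied to W₁, with top coefficient ρ³F₃. It vanishes for all η in an open set, so the
coefficient of each power of η vanishes separately. As F₃ = 0 forces A = 0, some power of η yields
an equation of order exactly 17; this single equation, repeated, is S₁. Exchanging ξ and η gives S₂.
Testing the equation on the functions (t − ξ)ᵏ proves (1).

A nontrivial linear equation with polynomial coefficients excludes the transcendents. Its
meromorphic solutions have poles only at the finitely many zeros of the leading coefficient, whereas
a pole of an elliptic function recurs along the whole lattice (`noEllipticDependence`). Its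
holomorphic solutions are reducible in the sense of Painlevé; if W = R(x, w, w') really involved w,
this relation would be a first-order algebraic equation for w with reducible coefficients, and w
would be reducible (`noPainleveDependence`). -/

noncomputable section

/-! ### The differential algebra of smooth functions on an open subset of the plane -/

section SmoothAlgebra

open TopologicalSpace

variable {E : Type*}

section
variable [Zero E]
open Classical in
/-- Extension by zero of a function on an open set. -/
def extendZero {S : Opens (ℝ × ℝ)} (f : S → E) : ℝ × ℝ → E :=
  fun z => if h : z ∈ S then f ⟨z, h⟩ else 0

lemma extendZero_apply {S : Opens (ℝ × ℝ)} (f : S → E) (s : S) : extendZero f s = f s := by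
  simp [extendZero]

lemma extendZero_of_mem {S : Opens (ℝ × ℝ)} (f : S → E) {z : ℝ × ℝ} (h : z ∈ S) :
    extendZero f z = f ⟨z, h⟩ := by
  simp [extendZero, h]

end

variable [NormedCommRing E] [NormedAlgebra ℝ E]

/-- The smooth functions on `S`, as a subalgebra of all functions. -/
def smoothAlg (E : Type*) [NormedCommRing E] [NormedAlgebra ℝ E] (S : Opens (ℝ × ℝ)) :
    Subalgebra ℝ (S → E) where
  carrier := {f | ContDiffOn ℝ ∞ (extendZero f) S}
  mul_mem' {f g} hf hg :=
    (ContDiffOn.mul hf hg).congr fun z hz => by simp [extendZero_of_mem _ (show z ∈ S from hz)]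
  add_mem' {f g} hf hg :=
    (ContDiffOn.add hf hg).congr fun z hz => by simp [extendZero_of_mem _ (show z ∈ S from hz)]
  algebraMap_mem' c :=
    (contDiffOn_const (c := algebraMap ℝ E c)).congr fun z hz => by
      simp [extendZero_of_mem _ (show z ∈ S from hz)]

variable {S : Opens (ℝ × ℝ)}

lemma smoothAlg.contDiffAt (f : smoothAlg E S) (s : S) :
    ContDiffAt ℝ ∞ (extendZero f.1) s :=
  (show ContDiffOn ℝ ∞ (extendZero f.1) S from f.2).contDiffAt (S.isOpen.mem_nhds s.2)

lemma smoothAlg.differentiableAt (f : smoothAlg E S) (s : S) :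
    DifferentiableAt ℝ (extendZero f.1) s :=
  (smoothAlg.contDiffAt f s).differentiableAt (by simp)

omit [NormedAlgebra ℝ E] in
lemma extendZero_eventuallyEq {f : S → E} {F : ℝ × ℝ → E} (h : ∀ s : S, F s = f s) (s : S) :
    extendZero f =ᶠ[nhds (s : ℝ × ℝ)] F := by
  filter_upwards [S.isOpen.mem_nhds s.2] with z hz
  rw [extendZero_of_mem f hz, ← h]

/-- The smooth function on `S` given by the restriction of `F`. -/
def smoothAlg.ofContDiffOn (F : ℝ × ℝ → E) (hF : ContDiffOn ℝ ∞ F S) : smoothAlg E S :=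
  ⟨fun s => F s, hF.congr fun z hz => by simp [extendZero_of_mem _ (show z ∈ S from hz)]⟩

/-- The directional derivative as a derivation of the algebra of smooth functions. -/
def dirDeriv (E : Type*) [NormedCommRing E] [NormedAlgebra ℝ E] (S : Opens (ℝ × ℝ)) (v : ℝ × ℝ) :
    Derivation ℝ (smoothAlg E S) (smoothAlg E S) :=
  Derivation.mk'
    { toFun := fun f => ⟨fun s => fderiv ℝ (extendZero f.1) s v, by
        have h : ContDiffOn ℝ ∞ (extendZero f.1) S := f.2
        exact (((h.fderiv_of_isOpen S.isOpen (m := ∞) (by simp)).clm_apply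
          (contDiffOn_const (c := v)))).congr fun z hz => by simp [extendZero_of_mem _ (show z ∈ S from hz)]⟩
      map_add' := fun f g => by
        ext s
        have : extendZero (f + g).1 =ᶠ[nhds (s : ℝ × ℝ)] extendZero f.1 + extendZero g.1 :=
          extendZero_eventuallyEq (fun s => by simp [extendZero_apply]) s
        change fderiv ℝ (extendZero (f + g).1) s v = _
        rw [this.fderiv_eq, fderiv_add (smoothAlg.differentiableAt f s) (smoothAlg.differentiableAt g s)]
        rfl
      map_smul' := fun c f => by
        ext s
        have : extendZero (c • f).1 =ᶠ[nhds (s : ℝ × ℝ)] c • extendZero f.1 :=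
          extendZero_eventuallyEq (fun s => by simp [extendZero_apply]) s
        change fderiv ℝ (extendZero (c • f).1) s v = _
        rw [this.fderiv_eq, fderiv_const_smul (smoothAlg.differentiableAt f s)]
        rfl }
    fun f g => by
      ext s
      have : extendZero (f * g).1 =ᶠ[nhds (s : ℝ × ℝ)] extendZero f.1 * extendZero g.1 :=
        extendZero_eventuallyEq (fun s => by simp [extendZero_apply]) s
      change fderiv ℝ (extendZero (f * g).1) s v = f.1 s * fderiv ℝ (extendZero g.1) s v
        + g.1 s * fderiv ℝ (extendZero f.1) s v
      rw [this.fderiv_eq, fderiv_mul (smoothAlg.differentiableAt f s)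
        (smoothAlg.differentiableAt g s), extendZero_apply, extendZero_apply]
      simp only [add_apply, smul_apply, smul_eq_mul]

lemma dirDeriv_apply (v : ℝ × ℝ) (f : smoothAlg E S) (s : S) :
    (dirDeriv E S v f).1 s = fderiv ℝ (extendZero f.1) s v := rfl

/-- Symmetry of the second derivative. Together with the Leibniz rule it allows the later calculus
to be done as algebra in a ring with two commuting derivations. -/
lemma dirDeriv_comm (v w : ℝ × ℝ) (f : smoothAlg E S) :
    dirDeriv E S v (dirDeriv E S w f) = dirDeriv E S w (dirDeriv E S v f) := by
  ext s
  have key : ∀ a b : ℝ × ℝ, (dirDeriv E S a (dirDeriv E S b f)).1 s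
      = fderiv ℝ (fderiv ℝ (extendZero f.1)) s a b := fun a b => by
    have h : extendZero (dirDeriv E S b f).1 =ᶠ[nhds (s : ℝ × ℝ)]
        fun z => fderiv ℝ (extendZero f.1) z b :=
      extendZero_eventuallyEq (f := (dirDeriv E S b f).1) (fun s => rfl) s
    have hd : DifferentiableAt ℝ (fderiv ℝ (extendZero f.1)) s :=
      ((smoothAlg.contDiffAt f s).fderiv_right (m := ∞) (by simp)).differentiableAt (by simp)
    rw [dirDeriv_apply, h.fderiv_eq, fderiv_clm_apply hd (differentiableAt_const b)]
    simp
  rw [key, key]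
  exact ((smoothAlg.contDiffAt f s).isSymmSndFDerivAt (by simpa using ENat.LEInfty.out)) v w

/-! ### Representatives -/

/-- The function `F` on the plane restricts to the smooth function `f` on `S`. -/
def Represents (F : ℝ → ℝ → E) (f : smoothAlg E S) : Prop :=
  ∀ s : S, F s.1.1 s.1.2 = f.1 s

namespace Represents

variable {F G : ℝ → ℝ → E} {f g : smoothAlg E S}

lemma ofContDiffOn (h : ContDiffOn ℝ ∞ (Function.uncurry F) S) :
    Represents F (smoothAlg.ofContDiffOn (Function.uncurry F) h) := fun _ => rfl

/-- S is open, so F agrees with the zero extension of f near s; the values of F outside S play no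
role. -/
lemma hasFDerivAt (h : Represents F f) (s : S) :
    HasFDerivAt (Function.uncurry F) (fderiv ℝ (extendZero f.1) s) s.1 :=
  (smoothAlg.differentiableAt f s).hasFDerivAt.congr_of_eventuallyEq
    (extendZero_eventuallyEq (F := Function.uncurry F) h s).symm

lemma hasDerivAt_xi (h : Represents F f) (s : S) :
    HasDerivAt (fun t => F t s.1.2) ((dirDeriv E S (1, 0) f).1 s) s.1.1 := by
  have h2 : HasDerivAt (fun t : ℝ => (t, s.1.2)) ((1 : ℝ), (0 : ℝ)) s.1.1 :=
    (hasDerivAt_id _).prodMk (hasDerivAt_const _ _)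
  exact (h.hasFDerivAt s).comp_hasDerivAt s.1.1 h2

lemma hasDerivAt_eta (h : Represents F f) (s : S) :
    HasDerivAt (fun t => F s.1.1 t) ((dirDeriv E S (0, 1) f).1 s) s.1.2 := by
  have h2 : HasDerivAt (fun t : ℝ => (s.1.1, t)) ((0 : ℝ), (1 : ℝ)) s.1.2 :=
    (hasDerivAt_const _ _).prodMk (hasDerivAt_id _)
  exact (h.hasFDerivAt s).comp_hasDerivAt s.1.2 h2

lemma pdXi (h : Represents F f) : Represents (pdXi F) (dirDeriv E S (1, 0) f) :=
  fun s => (h.hasDerivAt_xi s).deriv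

lemma pdEta (h : Represents F f) : Represents (pdEta F) (dirDeriv E S (0, 1) f) :=
  fun s => (h.hasDerivAt_eta s).deriv

lemma ext (hf : Represents F f) (hg : Represents F g) : f = g := by
  ext s
  rw [← hf s, ← hg s]

end Represents

/-- The first coordinate. -/
def coordX (E : Type*) [NormedCommRing E] [NormedAlgebra ℝ E] (S : Opens (ℝ × ℝ)) :
    smoothAlg E S :=
  smoothAlg.ofContDiffOn (fun z => algebraMap ℝ E z.1)
    (((algebraMapCLM ℝ E).contDiff.comp contDiff_fst).contDiffOn)

/-- The second coordinate. -/
def coordY (E : Type*) [NormedCommRing E] [NormedAlgebra ℝ E] (S : Opens (ℝ × ℝ)) :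
    smoothAlg E S :=
  smoothAlg.ofContDiffOn (fun z => algebraMap ℝ E z.2)
    (((algebraMapCLM ℝ E).contDiff.comp contDiff_snd).contDiffOn)

lemma dirDeriv_coordX (v : ℝ × ℝ) : dirDeriv E S v (coordX E S) = algebraMap ℝ _ v.1 := by
  ext s
  have h : HasFDerivAt (fun z : ℝ × ℝ => algebraMap ℝ E z.1)
      ((algebraMapCLM ℝ E).comp (ContinuousLinearMap.fst ℝ ℝ ℝ)) s.1 :=
    ((algebraMapCLM ℝ E).comp (ContinuousLinearMap.fst ℝ ℝ ℝ)).hasFDerivAt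
  rw [dirDeriv_apply, (h.congr_of_eventuallyEq (extendZero_eventuallyEq
    (f := (coordX E S).1) (fun _ => rfl) s)).fderiv]
  rfl

lemma dirDeriv_coordY (v : ℝ × ℝ) : dirDeriv E S v (coordY E S) = algebraMap ℝ _ v.2 := by
  ext s
  have h : HasFDerivAt (fun z : ℝ × ℝ => algebraMap ℝ E z.2)
      ((algebraMapCLM ℝ E).comp (ContinuousLinearMap.snd ℝ ℝ ℝ)) s.1 :=
    ((algebraMapCLM ℝ E).comp (ContinuousLinearMap.snd ℝ ℝ ℝ)).hasFDerivAt
  rw [dirDeriv_apply, (h.congr_of_eventuallyEq (extendZero_eventuallyEq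
    (f := (coordY E S).1) (fun _ => rfl) s)).fderiv]
  rfl

/-- The open set `I × J`. -/
def IsParabolicDomain.opens {I J : Set ℝ} (h : IsParabolicDomain I J) : Opens (ℝ × ℝ) :=
  ⟨I ×ˢ J, h.1.prod h.2.2.1⟩

end SmoothAlgebra
end

noncomputable section

/-! ### The linear compatibility condition in a differential ring -/

lemma Derivation.map_two_eq_zero {R : Type*} [CommRing R] [Algebra ℝ R] (D : Derivation ℝ R R) :
    D 2 = 0 := by
  exact_mod_cast D.map_natCast 2

lemma Derivation.map_three_eq_zero {R : Type*} [CommRing R] [Algebra ℝ R] (D : Derivation ℝ R R) :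
    D 3 = 0 := by
  exact_mod_cast D.map_natCast 3

/-- A commutative ring with two commuting derivations `D = ∂/∂x`, `E = ∂/∂y` and with an inverse `r`
of `x² + y²`. -/
structure PlaneDiffRing (R : Type*) [CommRing R] [Algebra ℝ R] where
  D : Derivation ℝ R R
  E : Derivation ℝ R R
  x : R
  y : R
  r : R
  comm : ∀ f, D (E f) = E (D f)
  D_x : D x = 1
  D_y : D y = 0
  E_x : E x = 0
  E_y : E y = 1
  r_mul : r * (x ^ 2 + y ^ 2) = 1

namespace PlaneDiffRing

variable {R : Type*} [CommRing R] [Algebra ℝ R] (p : PlaneDiffRing R)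

lemma D_r : p.D p.r = -2 * p.x * p.r ^ 2 := by
  have h := congrArg p.D p.r_mul
  simp only [Derivation.leibniz, Derivation.leibniz_pow, map_add, p.D_x, p.D_y, smul_eq_mul,
    Derivation.map_one_eq_zero, nsmul_eq_mul] at h
  push_cast at h
  linear_combination p.r * h - p.D p.r * p.r_mul

lemma E_r : p.E p.r = -2 * p.y * p.r ^ 2 := by
  have h := congrArg p.E p.r_mul
  simp only [Derivation.leibniz, Derivation.leibniz_pow, map_add, p.E_x, p.E_y, smul_eq_mul,
    Derivation.map_one_eq_zero, nsmul_eq_mul] at h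
  push_cast at h
  linear_combination p.r * h - p.E p.r * p.r_mul

/-- The linear compatibility expression. -/
def linCompat (F₁ F₂ F₃ F₄ V : R) : R :=
  let D := p.D; let E := p.E; let x := p.x; let y := p.y; let r := p.r
  F₃ * D (D (D V)) + (3 * F₄ - 2 * F₂) * E (D (D V)) + (3 * F₁ - 2 * F₃) * E (E (D V))
    + F₂ * E (E (E V))
    + (2 * (D F₃ - E F₂) - (3 * x * F₁ - 6 * y * F₂ + 7 * x * F₃) * r) * D (D V)
    + (2 * (E F₂ - D F₃) - (3 * y * F₄ - 6 * x * F₃ + 7 * y * F₂) * r) * E (E V)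
    + (2 * (3 * E F₁ - D F₂ - E F₃ + 3 * D F₄)
        - (21 * y * F₁ - 5 * y * F₃ - 5 * x * F₂ + 21 * x * F₄) * r) * E (D V)
    + (E (E F₂) - 2 * D (E F₃) + 3 * D (D F₄)
        + (-7 * y * E F₂ - x * D F₂ + 6 * x * E F₃ + 6 * y * D F₃ - 3 * y * E F₄
            - 21 * x * D F₄) * r
        + 2 * (21 * x ^ 2 * F₄ + x ^ 2 * F₂ + 7 * y ^ 2 * F₂ - 12 * x * y * F₃
            + 3 * y ^ 2 * F₄) * r ^ 2) * E V
    + (3 * E (E F₁) - 2 * D (E F₂) + D (D F₃)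
        - (21 * y * E F₁ + 3 * x * D F₁ - 6 * x * E F₂ - 6 * y * D F₂ + y * E F₃ + 7 * x * D F₃) * r
        + 2 * (y ^ 2 * F₃ + 3 * x ^ 2 * F₁ + 21 * y ^ 2 * F₁ - 12 * x * y * F₂
            + 7 * x ^ 2 * F₃) * r ^ 2) * D V

/-- The compatibility operator of the three first-order equations with right-hand sides
`a`, `b`, `c`. -/
def compatOp (a b c : R) : R :=
  let D := p.D; let E := p.E; let x := p.x; let y := p.y; let r := p.r
  E (E a) + D (D b) - E (D c) - r * (7 * y * E a + x * D a + y * E b + 7 * x * D b)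
    + 3 * r * (x * E c + y * D c)
    + 2 * r ^ 2 * ((x ^ 2 + 7 * y ^ 2) * a + (7 * x ^ 2 + y ^ 2) * b - 6 * x * y * c)

/-- The long expression is the integrability operator applied to the right-hand sides of the
determining equations. Both the necessity of (LC) and its separation into two parts are proved in
this form. -/
lemma linCompat_eq_compatOp (F₁ F₂ F₃ F₄ V : R) :
    p.linCompat F₁ F₂ F₃ F₄ V = p.compatOp (3 * F₁ * p.D V + F₂ * p.E V)
      (F₃ * p.D V + 3 * F₄ * p.E V) (2 * (F₂ * p.D V + F₃ * p.E V)) := by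
  simp only [linCompat, compatOp, map_add, Derivation.leibniz, smul_eq_mul,
    Derivation.map_two_eq_zero, Derivation.map_three_eq_zero, p.comm, mul_zero, add_zero]
  ring

/-- If the first-order equations have a solution `(g₁, g₂)`, then their right-hand sides satisfy the
compatibility condition. -/
lemma compatOp_eq_zero (g₁ g₂ a b c : R)
    (ha : p.x * p.D g₁ + p.y * p.D g₂ = p.r * a)
    (hb : p.x * p.E g₂ - p.y * p.E g₁ = p.r * b)
    (hc : p.x * p.D g₂ - p.y * p.D g₁ + p.x * p.E g₁ + p.y * p.E g₂ = p.r * c) :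
    p.compatOp a b c = 0 := by
  have key : ∀ a b c : R, p.compatOp ((p.x ^ 2 + p.y ^ 2) * a) ((p.x ^ 2 + p.y ^ 2) * b)
      ((p.x ^ 2 + p.y ^ 2) * c)
      = (p.x ^ 2 + p.y ^ 2) * (p.E (p.E a) + p.D (p.D b) - p.E (p.D c))
        - 3 * p.y * p.E a - p.x * p.D a + 2 * a - 3 * p.x * p.D b - p.y * p.E b + 2 * b
        + p.x * p.E c + p.y * p.D c := by
    intro a b c
    simp only [compatOp, map_add, Derivation.leibniz, Derivation.leibniz_pow, smul_eq_mul,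
      Derivation.map_two_eq_zero, mul_zero, add_zero, zero_add, p.D_x, p.D_y, p.E_x,
      p.E_y, nsmul_eq_mul, Nat.cast_ofNat, pow_one, mul_one, Nat.add_one_sub_one]
    linear_combination (-(7 * p.y * p.E a + p.x * p.D a + p.y * p.E b + 7 * p.x * p.D b)
      + 3 * (p.x * p.E c + p.y * p.D c)
      + 2 * p.r * ((p.x ^ 2 + 7 * p.y ^ 2) * a
        + (7 * p.x ^ 2 + p.y ^ 2) * b - 6 * p.x * p.y * c)) * p.r_mul
  have h : ∀ a : R, a = (p.x ^ 2 + p.y ^ 2) * (p.r * a) := fun a => by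
    linear_combination -a * p.r_mul
  rw [h a, h b, h c, ← ha, ← hb, ← hc, key]
  simp only [map_add, map_sub, Derivation.leibniz, smul_eq_mul, p.comm, mul_zero, add_zero,
    p.D_x, p.D_y, p.E_x, p.E_y, mul_one]
  ring

/-- `(x² + y²)⁴` times the compatibility operator, with right-hand sides divided by
`(x² + y²)²`. -/
def clearedOp (a b c : R) : R :=
  let D := p.D; let E := p.E; let x := p.x; let y := p.y; let ρ := p.x ^ 2 + p.y ^ 2
  ρ ^ 2 * (E (E a) + D (D b) - E (D c))
    - ρ * (15 * y * E a + x * D a + 15 * x * D b + y * E b - 7 * x * E c - 7 * y * D c)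
    + (2 * x ^ 2 + 62 * y ^ 2) * a + (62 * x ^ 2 + 2 * y ^ 2) * b - 60 * x * y * c

/-- The gradient of a separable potential carries the factor r². Once it is pulled out only
polynomial coefficients remain, so that degrees in x can be counted. -/
lemma compatOp_mul_r_sq (a b c : R) :
    p.compatOp (p.r ^ 2 * a) (p.r ^ 2 * b) (p.r ^ 2 * c) = p.r ^ 4 * p.clearedOp a b c := by
  have h1 : p.r ^ 2 * (p.r * (p.x ^ 2 + p.y ^ 2)) ^ 2 = p.r ^ 2 := by rw [p.r_mul]; ring
  have h2 : p.r ^ 3 * (p.r * (p.x ^ 2 + p.y ^ 2)) = p.r ^ 3 := by rw [p.r_mul]; ring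
  simp only [compatOp, clearedOp, map_add, map_neg, Derivation.leibniz, Derivation.leibniz_pow,
    smul_eq_mul, Derivation.map_two_eq_zero, mul_zero, add_zero, p.D_x,
    p.E_x, p.E_y, p.D_r, p.E_r,
    nsmul_eq_mul, Nat.cast_ofNat, pow_one, mul_one, Nat.add_one_sub_one,
    neg_zero]
  linear_combination -(p.E (p.E a) + p.D (p.D b) - p.E (p.D c)) * h1
    + (15 * p.y * p.E a + p.x * p.D a + 15 * p.x * p.D b + p.y * p.E b - 7 * p.x * p.E c
      - 7 * p.y * p.D c + 4 * a + 4 * b) * h2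

/-- The cleared compatibility expression of the separable potential `r (U + T)`; `u` and `v` are
`(x² + y²)² ∂V/∂x` and `(x² + y²)² ∂V/∂y`. -/
def clearedCompat (F₁ F₂ F₃ F₄ u v : R) : R :=
  p.clearedOp (3 * F₁ * u + F₂ * v) (F₃ * u + 3 * F₄ * v) (2 * (F₂ * u + F₃ * v))

/-- Up to the factor r², the gradient of r (U + T) is the sum of a vector in U, U' and one in T, T',
and the compatibility expression is additive in the gradient. -/
lemma linCompat_separable (F₁ F₂ F₃ F₄ U T : R) (hU : p.E U = 0) (hT : p.D T = 0) :
    p.linCompat F₁ F₂ F₃ F₄ (p.r * (U + T)) = p.r ^ 4 *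
      (p.clearedCompat F₁ F₂ F₃ F₄ ((p.x ^ 2 + p.y ^ 2) * p.D U - 2 * p.x * U) (-2 * p.y * U)
        + p.clearedCompat F₁ F₂ F₃ F₄ (-2 * p.x * T)
            ((p.x ^ 2 + p.y ^ 2) * p.E T - 2 * p.y * T)) := by
  have hadd : ∀ u v u' v' : R, p.clearedCompat F₁ F₂ F₃ F₄ u v + p.clearedCompat F₁ F₂ F₃ F₄ u' v'
      = p.clearedCompat F₁ F₂ F₃ F₄ (u + u') (v + v') := by
    intro u v u' v'
    simp only [clearedCompat, clearedOp, mul_add, map_add, Derivation.leibniz, smul_eq_mul,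
      Derivation.map_two_eq_zero, Derivation.map_three_eq_zero, map_zero, mul_zero]
    ring
  have hD : p.D (p.r * (U + T)) = p.r ^ 2 *
      ((p.x ^ 2 + p.y ^ 2) * p.D U - 2 * p.x * U + -2 * p.x * T) := by
    rw [Derivation.leibniz, map_add, hT, p.D_r, smul_eq_mul, smul_eq_mul]
    linear_combination -p.r * p.D U * p.r_mul
  have hE : p.E (p.r * (U + T)) = p.r ^ 2 *
      (-2 * p.y * U + ((p.x ^ 2 + p.y ^ 2) * p.E T - 2 * p.y * T)) := by
    rw [Derivation.leibniz, map_add, hU, p.E_r, smul_eq_mul, smul_eq_mul]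
    linear_combination -p.r * p.E T * p.r_mul
  rw [hadd, linCompat_eq_compatOp, hD, hE, clearedCompat, ← compatOp_mul_r_sq]
  congr 1 <;> ring

end PlaneDiffRing
end

noncomputable section

/-! ### The polynomials `F₁, …, F₄` and linear differential operators with polynomial coefficients -/

section Polynomials

open MvPolynomial

/-- The polynomial `F₁` as a formal polynomial. -/
def mvF₁ (A : ℕ → ℕ → ℕ → ℝ) : MvPolynomial (Fin 2) ℝ :=
  let x := X 0; let y := X 1
  y ^ 3 * C (A 0 0 3) + x * y ^ 2 * C (A 0 1 2) + x ^ 3 * C (A 0 3 0)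
    - C (1 / 2) * y ^ 3 * (x ^ 2 + y ^ 2) * C (A 1 0 2)
    - C (1 / 2) * x * y ^ 2 * (x ^ 2 + y ^ 2) * C (A 1 1 1)
    - C (1 / 2) * y * x ^ 2 * (x ^ 2 + y ^ 2) * C (A 1 2 0)
    + C (1 / 4) * y ^ 3 * (x ^ 2 + y ^ 2) ^ 2 * C (A 2 0 1)
    + C (1 / 4) * x * y ^ 2 * (x ^ 2 + y ^ 2) ^ 2 * C (A 2 1 0)
    - C (1 / 8) * y ^ 3 * (x ^ 2 + y ^ 2) ^ 3 * C (A 3 0 0)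
    + x ^ 2 * y * C (A 0 2 1)

/-- The polynomial `F₂` as a formal polynomial. -/
def mvF₂ (A : ℕ → ℕ → ℕ → ℝ) : MvPolynomial (Fin 2) ℝ :=
  let x := X 0; let y := X 1
  C 3 * x * y ^ 2 * C (A 0 0 3) - y * (y ^ 2 - C 2 * x ^ 2) * C (A 0 1 2)
    - C 3 * x ^ 2 * y * C (A 0 3 0)
    - C (1 / 2) * x * y ^ 2 * (x ^ 2 + y ^ 2) * C (A 1 0 2)
    + C (1 / 2) * y ^ 3 * (x ^ 2 + y ^ 2) * C (A 1 1 1)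
    + C (1 / 2) * x * (x ^ 2 + C 2 * y ^ 2) * (x ^ 2 + y ^ 2) * C (A 1 2 0)
    - C (1 / 4) * x * y ^ 2 * (x ^ 2 + y ^ 2) ^ 2 * C (A 2 0 1)
    - C (1 / 4) * y * (y ^ 2 + C 2 * x ^ 2) * (x ^ 2 + y ^ 2) ^ 2 * C (A 2 1 0)
    + C (3 / 8) * x * y ^ 2 * (x ^ 2 + y ^ 2) ^ 3 * C (A 3 0 0)
    - C (A 0 2 1) * x * (C 2 * y ^ 2 - x ^ 2)

/-- The polynomial `F₃` as a formal polynomial. -/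
def mvF₃ (A : ℕ → ℕ → ℕ → ℝ) : MvPolynomial (Fin 2) ℝ :=
  let x := X 0; let y := X 1
  C 3 * x ^ 2 * y * C (A 0 0 3) - x * (C 2 * y ^ 2 - x ^ 2) * C (A 0 1 2)
    + C 3 * x * y ^ 2 * C (A 0 3 0)
    + C (1 / 2) * y * x ^ 2 * (x ^ 2 + y ^ 2) * C (A 1 0 2)
    + C (1 / 2) * x ^ 3 * (x ^ 2 + y ^ 2) * C (A 1 1 1)
    - C (1 / 2) * y * (y ^ 2 + C 2 * x ^ 2) * (x ^ 2 + y ^ 2) * C (A 1 2 0)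
    - C (1 / 4) * y * x ^ 2 * (x ^ 2 + y ^ 2) ^ 2 * C (A 2 0 1)
    + C (1 / 4) * x * (x ^ 2 + C 2 * y ^ 2) * (x ^ 2 + y ^ 2) ^ 2 * C (A 2 1 0)
    - C (3 / 8) * y * x ^ 2 * (x ^ 2 + y ^ 2) ^ 3 * C (A 3 0 0)
    + y * C (A 0 2 1) * (y ^ 2 - C 2 * x ^ 2)

/-- The polynomial `F₄` as a formal polynomial. -/
def mvF₄ (A : ℕ → ℕ → ℕ → ℝ) : MvPolynomial (Fin 2) ℝ :=
  let x := X 0; let y := X 1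
  x ^ 3 * C (A 0 0 3) - x ^ 2 * y * C (A 0 1 2) - y ^ 3 * C (A 0 3 0)
    + C (1 / 2) * x ^ 3 * (x ^ 2 + y ^ 2) * C (A 1 0 2)
    - C (1 / 2) * y * x ^ 2 * (x ^ 2 + y ^ 2) * C (A 1 1 1)
    + C (1 / 2) * x * y ^ 2 * (x ^ 2 + y ^ 2) * C (A 1 2 0)
    + C (1 / 4) * x ^ 3 * (x ^ 2 + y ^ 2) ^ 2 * C (A 2 0 1)
    - C (1 / 4) * y * x ^ 2 * (x ^ 2 + y ^ 2) ^ 2 * C (A 2 1 0)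
    + C (1 / 8) * x ^ 3 * (x ^ 2 + y ^ 2) ^ 3 * C (A 3 0 0)
    + x * y ^ 2 * C (A 0 2 1)

lemma eval_mvF₁ (A : ℕ → ℕ → ℕ → ℝ) (ξ η : ℝ) : eval ![ξ, η] (mvF₁ A) = polyF1 A ξ η := by
  simp [mvF₁, polyF1]

lemma eval_mvF₂ (A : ℕ → ℕ → ℕ → ℝ) (ξ η : ℝ) : eval ![ξ, η] (mvF₂ A) = polyF2 A ξ η := by
  simp [mvF₂, polyF2]

lemma eval_mvF₃ (A : ℕ → ℕ → ℕ → ℝ) (ξ η : ℝ) : eval ![ξ, η] (mvF₃ A) = polyF3 A ξ η := by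
  simp [mvF₃, polyF3]

lemma eval_mvF₄ (A : ℕ → ℕ → ℕ → ℝ) (ξ η : ℝ) : eval ![ξ, η] (mvF₄ A) = polyF4 A ξ η := by
  simp [mvF₄, polyF4]

/-- The coefficient of A_{jkl} in F₃ is homogeneous of degree 3 + 2j, and for each j these
coefficients are linearly independent. The sample values below determine all ten unknowns. -/
lemma eq_zero_of_polyF3_eq_zero {A : ℕ → ℕ → ℕ → ℝ} (h : ∀ ξ η, polyF3 A ξ η = 0) (j k l : ℕ)
    (hjkl : j + k + l = 3) : A j k l = 0 := by
  have e : ∀ ξ η : ℝ, _ := h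
  simp only [polyF3] at e
  have a1 := e 1 0
  have a2 := e 2 0
  have a3 := e 3 0
  have b1 := e 0 1
  have b2 := e 0 2
  have c1 := e 1 1
  have c2 := e 1 (-1)
  have c3 := e 1 2
  have c4 := e 1 (-2)
  have c5 := e 1 3
  have c6 := e 1 (-3)
  have c7 := e 1 4
  have c8 := e 1 (-4)
  norm_num at a1 a2 a3 b1 b2 c1 c2 c3 c4 c5 c6 c7 c8
  have hj : j ≤ 3 := by omega
  have hk : k ≤ 3 := by omega
  obtain rfl : l = 3 - j - k := by omega
  interval_cases j <;> interval_cases k <;> first | omega | (norm_num; linarith)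

end Polynomials

namespace PlaneDiffRing

variable {R : Type*} [CommRing R] [Algebra ℝ R] (p : PlaneDiffRing R)

open MvPolynomial

/-- Substitution of the coordinates into a polynomial. -/
def polyHom : MvPolynomial (Fin 2) ℝ →ₐ[ℝ] R := aeval ![p.x, p.y]

@[simp] lemma polyHom_X_zero : p.polyHom (X 0) = p.x := by simp [polyHom]
@[simp] lemma polyHom_X_one : p.polyHom (X 1) = p.y := by simp [polyHom]

lemma D_polyHom (f : MvPolynomial (Fin 2) ℝ) : p.D (p.polyHom f) = p.polyHom (pderiv 0 f) := by
  induction f using MvPolynomial.induction_on with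
  | C a => simp [polyHom]
  | add f g hf hg => simp [hf, hg]
  | mul_X f i hf =>
    fin_cases i <;> simp [hf, p.D_x, p.D_y, pderiv_X]

lemma E_polyHom (f : MvPolynomial (Fin 2) ℝ) : p.E (p.polyHom f) = p.polyHom (pderiv 1 f) := by
  induction f using MvPolynomial.induction_on with
  | C a => simp [polyHom]
  | add f g hf hg => simp [hf, hg]
  | mul_X f i hf =>
    fin_cases i <;> simp [hf, p.E_x, p.E_y, pderiv_X]

/-! #### Polynomials of bounded degree in `x` -/

/-- `f` is annihilated by `D^(n+1)`, i.e. it is a polynomial of degree at most `n` in `x`. -/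
def DegLE (n : ℕ) (f : R) : Prop := p.D^[n + 1] f = 0

variable {p} {m n : ℕ} {f g : R}

lemma DegLE.mono (hf : p.DegLE m f) (h : m ≤ n) : p.DegLE n f := by
  obtain ⟨k, rfl⟩ := Nat.exists_eq_add_of_le h
  rw [DegLE, show m + k + 1 = k + (m + 1) by ring, Function.iterate_add_apply, hf, iterate_map_zero]

lemma DegLE.add (hf : p.DegLE m f) (hg : p.DegLE n g) : p.DegLE (max m n) (f + g) := by
  have h1 := hf.mono (le_max_left m n)
  have h2 := hg.mono (le_max_right m n)
  rw [DegLE] at *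
  rw [iterate_map_add, h1, h2, add_zero]

lemma DegLE.sub (hf : p.DegLE m f) (hg : p.DegLE n g) : p.DegLE (max m n) (f - g) := by
  have h1 := hf.mono (le_max_left m n)
  have h2 := hg.mono (le_max_right m n)
  rw [DegLE] at *
  rw [iterate_map_sub, h1, h2, sub_zero]

lemma DegLE.D (hf : p.DegLE n f) : p.DegLE (n - 1) (p.D f) := by
  cases n with
  | zero =>
    have : p.D f = 0 := hf
    rw [this, DegLE, iterate_map_zero]
  | succ n => rwa [DegLE, add_tsub_cancel_right, ← Function.iterate_succ_apply]

lemma DegLE.E (hf : p.DegLE n f) : p.DegLE n (p.E f) := by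
  have : ∀ (k : ℕ) (f : R), p.D^[k] (p.E f) = p.E (p.D^[k] f) := by
    intro k
    induction k with
    | zero => intro f; rfl
    | succ k ih => intro f; rw [Function.iterate_succ_apply, p.comm, ih, Function.iterate_succ_apply]
  rw [DegLE, this, hf, map_zero]

/-- Induction on m + n through D(fg) = f Dg + g Df. Each term has a smaller total bound, except that
a factor of bound 0 does not drop further; there its derivative is zero. -/
lemma DegLE.mul (hf : p.DegLE m f) (hg : p.DegLE n g) : p.DegLE (m + n) (f * g) := by
  induction h : m + n generalizing m n f g with
  | zero =>
    obtain ⟨rfl, rfl⟩ : m = 0 ∧ n = 0 := by omega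
    have h1 : p.D f = 0 := hf
    have h2 : p.D g = 0 := hg
    change p.D (f * g) = 0
    simp [h1, h2]
  | succ s ih =>
    have key : ∀ {m n : ℕ} {f g : R}, p.DegLE m f → p.DegLE n g → m + n = s + 1 →
        p.DegLE s (f * p.D g) := by
      intro m n f g hf hg hmn
      rcases Nat.eq_zero_or_pos n with rfl | hn
      · have h2 : p.D g = 0 := hg
        rw [h2, mul_zero, DegLE, iterate_map_zero]
      · exact ih hf hg.D (by omega)
    have : p.DegLE s (p.D (f * g)) := by
      rw [Derivation.leibniz]
      exact ((key hf hg h).add (key hg hf (by omega))).mono (by simp)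
    rwa [DegLE, Function.iterate_succ_apply]

lemma DegLE.pow (hf : p.DegLE m f) (k : ℕ) : p.DegLE (k * m) (f ^ k) := by
  induction k with
  | zero =>
    rw [pow_zero, zero_mul]
    exact p.D.map_one_eq_zero
  | succ k ih =>
    rw [pow_succ]
    exact (ih.mul hf).mono (by ring_nf; rfl)

lemma degLE_algebraMap (c : ℝ) : p.DegLE 0 (algebraMap ℝ R c) := p.D.map_algebraMap c

lemma degLE_natCast (c : ℕ) : p.DegLE 0 (c : R) := p.D.map_natCast c

lemma degLE_x : p.DegLE 1 p.x := by simp [DegLE, p.D_x]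

lemma degLE_y : p.DegLE 0 p.y := by simp [DegLE, p.D_y]

/-- The bounds 6, 7, 8, 9 for F₁, …, F₄ are attained by the A₃₀₀ terms, multiples of y³ρ³, xy²ρ³,
x²yρ³, x³ρ³. -/
lemma degLE_mvF₁ (A : ℕ → ℕ → ℕ → ℝ) : p.DegLE 6 (p.polyHom (mvF₁ A)) := by
  simp only [mvF₁, map_add, map_sub, map_mul, map_pow, polyHom_X_zero, polyHom_X_one,
    ← MvPolynomial.algebraMap_eq, AlgHom.commutes]
  apply DegLE.mono
  · repeat' first
      | exact degLE_x | exact degLE_y | exact degLE_algebraMap _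
      | apply DegLE.add | apply DegLE.sub | apply DegLE.mul | apply DegLE.pow
  · norm_num

lemma degLE_mvF₂ (A : ℕ → ℕ → ℕ → ℝ) : p.DegLE 7 (p.polyHom (mvF₂ A)) := by
  simp only [mvF₂, map_add, map_sub, map_mul, map_pow, polyHom_X_zero, polyHom_X_one,
    ← MvPolynomial.algebraMap_eq, AlgHom.commutes]
  apply DegLE.mono
  · repeat' first
      | exact degLE_x | exact degLE_y | exact degLE_algebraMap _
      | apply DegLE.add | apply DegLE.sub | apply DegLE.mul | apply DegLE.pow
  · norm_num

lemma degLE_mvF₃ (A : ℕ → ℕ → ℕ → ℝ) : p.DegLE 8 (p.polyHom (mvF₃ A)) := by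
  simp only [mvF₃, map_add, map_sub, map_mul, map_pow, polyHom_X_zero, polyHom_X_one,
    ← MvPolynomial.algebraMap_eq, AlgHom.commutes]
  apply DegLE.mono
  · repeat' first
      | exact degLE_x | exact degLE_y | exact degLE_algebraMap _
      | apply DegLE.add | apply DegLE.sub | apply DegLE.mul | apply DegLE.pow
  · norm_num

lemma degLE_mvF₄ (A : ℕ → ℕ → ℕ → ℝ) : p.DegLE 9 (p.polyHom (mvF₄ A)) := by
  simp only [mvF₄, map_add, map_sub, map_mul, map_pow, polyHom_X_zero, polyHom_X_one,
    ← MvPolynomial.algebraMap_eq, AlgHom.commutes]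
  apply DegLE.mono
  · repeat' first
      | exact degLE_x | exact degLE_y | exact degLE_algebraMap _
      | apply DegLE.add | apply DegLE.sub | apply DegLE.mul | apply DegLE.pow
  · norm_num

/-- The three arguments of `clearedOp` have degrees at most 9, 11, 10 in x. The terms ρ²∂ₓ²b, ρx∂ₓb
and x²b then all have the bound 13, and no other term has a larger one. -/
lemma degLE_clearedCompat {F₁ F₂ F₃ F₄ u v : R} (h₁ : p.DegLE 6 F₁) (h₂ : p.DegLE 7 F₂)
    (h₃ : p.DegLE 8 F₃) (h₄ : p.DegLE 9 F₄) (hu : p.DegLE 1 u) (hv : p.DegLE 2 v) :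
    p.DegLE 13 (p.clearedCompat F₁ F₂ F₃ F₄ u v) := by
  have c2 : p.DegLE 0 (2 : R) := by exact_mod_cast p.degLE_natCast 2
  have c3 : p.DegLE 0 (3 : R) := by exact_mod_cast p.degLE_natCast 3
  have c7 : p.DegLE 0 (7 : R) := by exact_mod_cast p.degLE_natCast 7
  have c15 : p.DegLE 0 (15 : R) := by exact_mod_cast p.degLE_natCast 15
  have c60 : p.DegLE 0 (60 : R) := by exact_mod_cast p.degLE_natCast 60
  have c62 : p.DegLE 0 (62 : R) := by exact_mod_cast p.degLE_natCast 62
  simp only [clearedCompat, clearedOp]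
  apply DegLE.mono
  · repeat' first
      | assumption | exact degLE_x | exact degLE_y
      | apply DegLE.add | apply DegLE.sub | apply DegLE.mul | apply DegLE.pow
      | apply DegLE.D | apply DegLE.E
  · norm_num

/-! #### Differential operators in `x` with polynomial coefficients -/

end PlaneDiffRing

section Operators

open MvPolynomial

/-- Composition of `∂/∂x` with the operator `∑ Qₖ ∂ᵏ`. -/
def opDx : (ℕ →₀ MvPolynomial (Fin 2) ℝ) →ₗ[ℝ] (ℕ →₀ MvPolynomial (Fin 2) ℝ) :=
  Finsupp.mapRange.linearMap (pderiv (R := ℝ) (0 : Fin 2)).toLinearMap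
    + Finsupp.lmapDomain _ ℝ Nat.succ

/-- Composition of `∂/∂y` with the operator `∑ Qₖ ∂ᵏ`, acting on functions of `x`. -/
def opDy : (ℕ →₀ MvPolynomial (Fin 2) ℝ) →ₗ[ℝ] (ℕ →₀ MvPolynomial (Fin 2) ℝ) :=
  Finsupp.mapRange.linearMap (pderiv (R := ℝ) (1 : Fin 2)).toLinearMap

lemma opDx_apply_succ (Q : ℕ →₀ MvPolynomial (Fin 2) ℝ) (k : ℕ) :
    opDx Q (k + 1) = pderiv 0 (Q (k + 1)) + Q k := by
  simp [opDx, Finsupp.mapDomain_apply Nat.succ_injective]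

lemma opDy_apply (Q : ℕ →₀ MvPolynomial (Fin 2) ℝ) (k : ℕ) :
    opDy Q k = pderiv 1 (Q k) := by
  simp [opDy]

/-- Composition with ∂/∂x raises the order by one and keeps the top coefficient; only the lower
coefficients get differentiated terms. -/
lemma opDx_iterate_of_order_le {Q : ℕ →₀ MvPolynomial (Fin 2) ℝ} {m : ℕ}
    (hQ : ∀ k, m < k → Q k = 0) (n : ℕ) :
    (∀ k, m + n < k → (opDx^[n] Q) k = 0) ∧ (opDx^[n] Q) (m + n) = Q m := by
  induction n with
  | zero => exact ⟨hQ, rfl⟩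
  | succ n ih =>
    rw [Function.iterate_succ_apply']
    refine ⟨fun k hk => ?_, ?_⟩
    · obtain ⟨k, rfl⟩ := Nat.exists_eq_succ_of_ne_zero (by omega : k ≠ 0)
      rw [Nat.succ_eq_add_one, opDx_apply_succ, ih.1 _ (by omega), ih.1 _ (by omega)]
      simp
    · rw [← add_assoc, opDx_apply_succ, ih.1 _ (by omega), ih.2]
      simp

/-- The operator in `x` given by the `U`-part of the cleared compatibility expression. -/
def compatSymbol (A : ℕ → ℕ → ℕ → ℝ) : ℕ →₀ MvPolynomial (Fin 2) ℝ :=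
  let x : MvPolynomial (Fin 2) ℝ := X 0
  let y : MvPolynomial (Fin 2) ℝ := X 1
  let ρ := x ^ 2 + y ^ 2
  let u := Finsupp.single 1 ρ + Finsupp.single 0 (-2 * x)
  let v := Finsupp.single 0 (-2 * y)
  let a := (3 * mvF₁ A) • u + mvF₂ A • v
  let b := mvF₃ A • u + (3 * mvF₄ A) • v
  let c := (2 * mvF₂ A) • u + (2 * mvF₃ A) • v
  ρ ^ 2 • (opDy (opDy a) + opDx (opDx b) - opDy (opDx c))
    - ρ • ((15 * y) • opDy a + x • opDx a + (15 * x) • opDx b + y • opDy b - (7 * x) • opDy c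
      - (7 * y) • opDx c)
    + (2 * x ^ 2 + 62 * y ^ 2) • a + (62 * x ^ 2 + 2 * y ^ 2) • b - (60 * x * y) • c

/-- Third order arises only from ρ²∂ₓ²b, where b contains F₃ρU'. -/
lemma compatSymbol_three (A : ℕ → ℕ → ℕ → ℝ) :
    compatSymbol A 3 = (X 0 ^ 2 + X 1 ^ 2) ^ 3 * mvF₃ A := by
  simp [compatSymbol, opDx_apply_succ, opDy_apply]
  ring

lemma compatSymbol_of_gt (A : ℕ → ℕ → ℕ → ℝ) (k : ℕ) (hk : 3 < k) : compatSymbol A k = 0 := by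
  obtain ⟨k, rfl⟩ := Nat.exists_eq_add_of_le' (Nat.succ_le_of_lt hk)
  simp [compatSymbol, opDx_apply_succ, opDy_apply]

end Operators

namespace PlaneDiffRing

variable {R : Type*} [CommRing R] [Algebra ℝ R] (p : PlaneDiffRing R)

open MvPolynomial

/-- The value of the operator `Q` at `U`. -/
def evalOp (U : R) : (ℕ →₀ MvPolynomial (Fin 2) ℝ) →ₗ[ℝ] R :=
  Finsupp.lsum ℝ fun k => (LinearMap.mulRight ℝ (p.D^[k] U)) ∘ₗ p.polyHom.toLinearMap

lemma evalOp_single (U : R) (k : ℕ) (f : MvPolynomial (Fin 2) ℝ) :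
    p.evalOp U (Finsupp.single k f) = p.polyHom f * p.D^[k] U := by
  simp [evalOp]

lemma evalOp_smul (U : R) (f : MvPolynomial (Fin 2) ℝ) (Q : ℕ →₀ MvPolynomial (Fin 2) ℝ) :
    p.evalOp U (f • Q) = p.polyHom f * p.evalOp U Q := by
  induction Q using Finsupp.induction_linear with
  | zero => simp
  | add Q Q' h h' => simp [h, h', mul_add]
  | single k g =>
    rw [Finsupp.smul_single, evalOp_single, evalOp_single, smul_eq_mul, map_mul, mul_assoc]

lemma evalOp_opDx (U : R) (Q : ℕ →₀ MvPolynomial (Fin 2) ℝ) :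
    p.evalOp U (opDx Q) = p.D (p.evalOp U Q) := by
  induction Q using Finsupp.induction_linear with
  | zero => simp
  | add Q Q' h h' => simp [h, h']
  | single k g =>
    simp only [opDx, LinearMap.add_apply, map_add, Finsupp.mapRange.linearMap_apply,
      Finsupp.mapRange_single, Finsupp.lmapDomain_apply, Finsupp.mapDomain_single, evalOp_single,
      Derivation.leibniz, D_polyHom, Function.iterate_succ_apply', smul_eq_mul]
    rw [add_comm, mul_comm (p.D^[k] U)]
    rfl

/-- Since U does not depend on y, ∂/∂y acts on the coefficients alone, as `opDy` does. -/
lemma evalOp_opDy {U : R} (hU : p.E U = 0) (Q : ℕ →₀ MvPolynomial (Fin 2) ℝ) :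
    p.evalOp U (opDy Q) = p.E (p.evalOp U Q) := by
  have hk : ∀ k, p.E (p.D^[k] U) = 0 := by
    intro k
    induction k with
    | zero => exact hU
    | succ k ih => rw [Function.iterate_succ_apply', ← p.comm, ih, map_zero]
  induction Q using Finsupp.induction_linear with
  | zero => simp
  | add Q Q' h h' => simp [h, h']
  | single k g =>
    simp only [opDy, Finsupp.mapRange.linearMap_apply,
      Finsupp.mapRange_single, evalOp_single,
      Derivation.leibniz, E_polyHom, smul_eq_mul, hk, mul_zero, zero_add]
    rw [mul_comm]
    rfl

lemma evalOp_opDx_iterate (U : R) (Q : ℕ →₀ MvPolynomial (Fin 2) ℝ) (n : ℕ) :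
    p.evalOp U (opDx^[n] Q) = p.D^[n] (p.evalOp U Q) := by
  induction n with
  | zero => rfl
  | succ n ih => rw [Function.iterate_succ_apply', Function.iterate_succ_apply', evalOp_opDx, ih]

lemma evalOp_compatSymbol (A : ℕ → ℕ → ℕ → ℝ) {U : R} (hU : p.E U = 0) :
    p.evalOp U (compatSymbol A) = p.clearedCompat (p.polyHom (mvF₁ A)) (p.polyHom (mvF₂ A))
      (p.polyHom (mvF₃ A)) (p.polyHom (mvF₄ A))
      ((p.x ^ 2 + p.y ^ 2) * p.D U - 2 * p.x * U) (-2 * p.y * U) := by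
  have h1 : (p.x ^ 2 + p.y ^ 2) * p.D U - 2 * p.x * U = (p.x ^ 2 + p.y ^ 2) * p.D U + -2 * p.x * U := by
    ring
  have h2 : ∀ a b c d : R, 2 * (a * b + c * d) = 2 * a * b + 2 * c * d := by intros; ring
  simp only [compatSymbol, clearedCompat, clearedOp, map_add (p.evalOp U), map_sub (p.evalOp U),
    evalOp_smul, evalOp_opDy p hU, evalOp_opDx, evalOp_single, map_mul, map_pow, polyHom_X_zero,
    polyHom_X_one, map_neg p.polyHom, map_ofNat p.polyHom, map_add p.polyHom, Function.iterate_one,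
    Function.iterate_zero_apply, h1, h2]

/-- If the linear compatibility condition holds for a separable potential, then its `x`-part
satisfies a linear differential equation. -/
lemma evalOp_eq_zero (A : ℕ → ℕ → ℕ → ℝ) {U T : R} (hU : p.E U = 0) (hT : p.D T = 0)
    (h : p.linCompat (p.polyHom (mvF₁ A)) (p.polyHom (mvF₂ A))
      (p.polyHom (mvF₃ A)) (p.polyHom (mvF₄ A)) (p.r * (U + T)) = 0) :
    p.evalOp U (opDx^[14] (compatSymbol A)) = 0 := by
  rw [linCompat_separable p _ _ _ _ U T hU hT, ← evalOp_compatSymbol p A hU] at h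
  have h1 : ∀ a : R, p.r ^ 4 * a = 0 → a = 0 := fun a ha => by
    have : (p.r * (p.x ^ 2 + p.y ^ 2)) ^ 4 * a = 0 := by
      rw [mul_pow, mul_right_comm, ha, zero_mul]
    simpa [p.r_mul] using this
  have hT' : ∀ {f}, p.DegLE 0 f → p.DegLE 0 (f * T) := fun hf =>
    hf.mul (n := 0) (show p.D T = 0 from hT)
  have hET : p.DegLE 0 (p.E T) := DegLE.E (show p.D T = 0 from hT)
  have c2 : p.DegLE 0 (2 : R) := by exact_mod_cast p.degLE_natCast 2
  -- By (LC) the U-part is minus the T-part, and in the latter T and its derivatives have degree 0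
  -- in x.
  have hdeg : p.DegLE 13 (p.evalOp U (compatSymbol A)) := by
    rw [eq_neg_of_add_eq_zero_left (h1 _ h), ← zero_sub]
    refine DegLE.mono (m := max 0 13) (DegLE.sub (by exact_mod_cast p.degLE_natCast 0)
      (degLE_clearedCompat (degLE_mvF₁ A) (degLE_mvF₂ A) (degLE_mvF₃ A) (degLE_mvF₄ A) ?_ ?_))
      (by norm_num)
    · have := (c2.mul degLE_x).mul (n := 0) (g := -T)
        (by rw [DegLE, zero_add, Function.iterate_one, map_neg, hT, neg_zero])
      simpa using this
    · exact (((degLE_x.pow 2).add (degLE_y.pow 2)).mul hET).sub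
        ((c2.mul degLE_y).mul (n := 0) (show p.D T = 0 from hT)) |>.mono (by norm_num)
  rw [evalOp_opDx_iterate]
  exact hdeg

end PlaneDiffRing
end

noncomputable section

/-! ### The coordinate plane as a differential ring -/

section Plane

open TopologicalSpace

variable {E : Type*} [NormedCommRing E] [NormedAlgebra ℝ E] {I J : Set ℝ}

/-- Evaluation of a smooth function at a point. -/
def smoothAlg.evalAt {S : Opens (ℝ × ℝ)} (s : S) : smoothAlg E S →ₐ[ℝ] E :=
  (Pi.evalAlgHom ℝ (fun _ : S => E) s).comp (smoothAlg E S).val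

lemma smoothAlg.evalAt_apply {S : Opens (ℝ × ℝ)} (s : S) (f : smoothAlg E S) :
    evalAt s f = f.1 s := rfl

lemma Represents.evalAt {S : Opens (ℝ × ℝ)} {F : ℝ → ℝ → E} {f : smoothAlg E S}
    (h : Represents F f) (s : S) : smoothAlg.evalAt s f = F s.1.1 s.1.2 := (h s).symm

/-- The differential ring of smooth functions on `I × J`. -/
def IsParabolicDomain.plane (E : Type*) [NormedCommRing E] [NormedAlgebra ℝ E]
    (h : IsParabolicDomain I J) : PlaneDiffRing (smoothAlg E h.opens) where
  D := dirDeriv E h.opens (1, 0)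
  E := dirDeriv E h.opens (0, 1)
  x := coordX E h.opens
  y := coordY E h.opens
  r := smoothAlg.ofContDiffOn (fun z => algebraMap ℝ E (z.1 ^ 2 + z.2 ^ 2)⁻¹) <|
    (algebraMapCLM ℝ E).contDiff.comp_contDiffOn <|
      ((contDiff_fst.pow 2).add (contDiff_snd.pow 2)).contDiffOn.inv
        fun z hz => h.2.2.2.2 z.1 hz.1 z.2 hz.2
  comm := dirDeriv_comm _ _
  D_x := by simp [dirDeriv_coordX]
  D_y := by simp [dirDeriv_coordY]
  E_x := by simp [dirDeriv_coordX]
  E_y := by simp [dirDeriv_coordY]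
  r_mul := by
    ext s
    change algebraMap ℝ E (s.1.1 ^ 2 + s.1.2 ^ 2)⁻¹ *
      (algebraMap ℝ E s.1.1 ^ 2 + algebraMap ℝ E s.1.2 ^ 2) = 1
    rw [← map_pow, ← map_pow, ← map_add, ← map_mul,
      inv_mul_cancel₀ (h.2.2.2.2 _ s.2.1 _ s.2.2), map_one]

namespace IsParabolicDomain

variable (h : IsParabolicDomain I J) (s : h.opens)

lemma evalAt_x : smoothAlg.evalAt s (h.plane E).x = algebraMap ℝ E s.1.1 := rfl
lemma evalAt_y : smoothAlg.evalAt s (h.plane E).y = algebraMap ℝ E s.1.2 := rfl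
lemma evalAt_r : smoothAlg.evalAt s (h.plane E).r = algebraMap ℝ E (s.1.1 ^ 2 + s.1.2 ^ 2)⁻¹ := rfl

lemma rho_ne_zero : s.1.1 ^ 2 + s.1.2 ^ 2 ≠ 0 := h.2.2.2.2 _ s.2.1 _ s.2.2

variable {h}

lemma represents_D {F : ℝ → ℝ → E} {f : smoothAlg E h.opens} (hF : Represents F f) :
    Represents (pdXi F) ((h.plane E).D f) := hF.pdXi

lemma represents_E {F : ℝ → ℝ → E} {f : smoothAlg E h.opens} (hF : Represents F f) :
    Represents (pdEta F) ((h.plane E).E f) := hF.pdEta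

lemma evalAt_polyHom (f : MvPolynomial (Fin 2) ℝ) :
    smoothAlg.evalAt s ((h.plane ℝ).polyHom f) = MvPolynomial.eval ![s.1.1, s.1.2] f := by
  rw [PlaneDiffRing.polyHom, ← AlgHom.comp_apply, MvPolynomial.comp_aeval,
    MvPolynomial.aeval_eq_eval]
  congr 2
  ext i
  fin_cases i <;> rfl

lemma represents_F₁ (A) : Represents (polyF1 A) ((h.plane ℝ).polyHom (mvF₁ A)) := fun s => by
  rw [← eval_mvF₁, ← evalAt_polyHom]; rfl

lemma represents_F₂ (A) : Represents (polyF2 A) ((h.plane ℝ).polyHom (mvF₂ A)) := fun s => by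
  rw [← eval_mvF₂, ← evalAt_polyHom]; rfl

lemma represents_F₃ (A) : Represents (polyF3 A) ((h.plane ℝ).polyHom (mvF₃ A)) := fun s => by
  rw [← eval_mvF₃, ← evalAt_polyHom]; rfl

lemma represents_F₄ (A) : Represents (polyF4 A) ((h.plane ℝ).polyHom (mvF₄ A)) := fun s => by
  rw [← eval_mvF₄, ← evalAt_polyHom]; rfl

lemma represents_linCompat (A : ℕ → ℕ → ℕ → ℝ) {V : ℝ → ℝ → ℝ} {v : smoothAlg ℝ h.opens}
    (hV : Represents V v) :
    Represents (linCompat A V) ((h.plane ℝ).linCompat ((h.plane ℝ).polyHom (mvF₁ A))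
      ((h.plane ℝ).polyHom (mvF₂ A)) ((h.plane ℝ).polyHom (mvF₃ A))
      ((h.plane ℝ).polyHom (mvF₄ A)) v) := by
  intro s
  have f1 := h.represents_F₁ A
  have f2 := h.represents_F₂ A
  have f3 := h.represents_F₃ A
  have f4 := h.represents_F₄ A
  have dV := represents_D hV
  have eV := represents_E hV
  rw [← smoothAlg.evalAt_apply]
  simp only [linCompat, coeffVEta, coeffVXi, PlaneDiffRing.linCompat, map_add, map_sub, map_mul,
    map_pow, map_ofNat, map_neg, evalAt_x, evalAt_y, evalAt_r, f1.evalAt, f2.evalAt, f3.evalAt,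
    f4.evalAt, (represents_D f1).evalAt, (represents_D f2).evalAt, (represents_D f3).evalAt,
    (represents_D f4).evalAt, (represents_E f1).evalAt, (represents_E f2).evalAt,
    (represents_E f3).evalAt, (represents_E f4).evalAt, (represents_E (represents_E f2)).evalAt,
    (represents_D (represents_E f3)).evalAt, (represents_D (represents_D f4)).evalAt,
    (represents_E (represents_E f1)).evalAt, (represents_D (represents_E f2)).evalAt,
    (represents_D (represents_D f3)).evalAt, dV.evalAt, eV.evalAt, (represents_D dV).evalAt,
    (represents_E dV).evalAt, (represents_E eV).evalAt,
    (represents_D (represents_D dV)).evalAt, (represents_E (represents_D dV)).evalAt,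
    (represents_E (represents_E dV)).evalAt, (represents_E (represents_E eV)).evalAt,
    Algebra.algebraMap_self, RingHom.id_apply, div_eq_mul_inv, ← inv_pow]

lemma linearCompatibility_iff (A : ℕ → ℕ → ℕ → ℝ) {V : ℝ → ℝ → ℝ} {v : smoothAlg ℝ h.opens}
    (hV : Represents V v) :
    LinearCompatibility A I J V ↔ (h.plane ℝ).linCompat ((h.plane ℝ).polyHom (mvF₁ A))
      ((h.plane ℝ).polyHom (mvF₂ A)) ((h.plane ℝ).polyHom (mvF₃ A))
      ((h.plane ℝ).polyHom (mvF₄ A)) v = 0 := by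
  have key := represents_linCompat A hV
  constructor
  · intro H
    ext s
    rw [← key s, H _ s.2.1 _ s.2.2]
    rfl
  · intro H ξ hξ η hη
    have := key ⟨(ξ, η), hξ, hη⟩
    rw [H] at this
    exact this

variable (h)

/-- A smooth function of `ξ` as a smooth function on `I × J`. -/
def ofXi (W : ℝ → ℝ) (hW : ContDiffOn ℝ ∞ W I) : smoothAlg ℝ h.opens :=
  smoothAlg.ofContDiffOn (fun z => W z.1) (hW.comp contDiffOn_fst fun _ hz => hz.1)

/-- A smooth function of `η` as a smooth function on `I × J`. -/
def ofEta (W : ℝ → ℝ) (hW : ContDiffOn ℝ ∞ W J) : smoothAlg ℝ h.opens :=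
  smoothAlg.ofContDiffOn (fun z => W z.2) (hW.comp contDiffOn_snd fun _ hz => hz.2)

variable {h} {W W₁ W₂ : ℝ → ℝ} (hW : ContDiffOn ℝ ∞ W I) (hW₁ : ContDiffOn ℝ ∞ W₁ I)
  (hW₂ : ContDiffOn ℝ ∞ W₂ J)

lemma represents_ofXi_iterate (k : ℕ) :
    Represents (fun ξ _ => iteratedDeriv k W ξ) ((h.plane ℝ).D^[k] (h.ofXi W hW)) := by
  induction k with
  | zero =>
    simp only [iteratedDeriv_zero]
    exact fun s => rfl
  | succ k ih =>
    rw [Function.iterate_succ_apply', iteratedDeriv_succ]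
    exact represents_D ih

lemma E_ofXi : (h.plane ℝ).E (h.ofXi W hW) = 0 :=
  (represents_E (represents_ofXi_iterate hW 0)).ext fun s => by simp [pdEta]

lemma D_ofEta : (h.plane ℝ).D (h.ofEta W₂ hW₂) = 0 :=
  (represents_D (F := fun _ η => W₂ η) fun _ => rfl).ext fun s => by simp [pdXi]

lemma represents_sepPotential : Represents (sepPotential W₁ W₂)
    ((h.plane ℝ).r * (h.ofXi W₁ hW₁ + h.ofEta W₂ hW₂)) := fun s =>
  div_eq_inv_mul (W₁ s.1.1 + W₂ s.1.2) (s.1.1 ^ 2 + s.1.2 ^ 2)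

lemma evalAt_evalOp (Q : ℕ →₀ MvPolynomial (Fin 2) ℝ) :
    smoothAlg.evalAt s ((h.plane ℝ).evalOp (h.ofXi W hW) Q)
      = Q.sum fun k f => MvPolynomial.eval ![s.1.1, s.1.2] f * iteratedDeriv k W s.1.1 := by
  induction Q using Finsupp.induction_linear with
  | zero => simp
  | add Q Q' h h' =>
    rw [map_add, map_add, h, h', Finsupp.sum_add_index'] <;> intros <;> simp [add_mul]
  | single k f =>
    rw [PlaneDiffRing.evalOp_single, map_mul, evalAt_polyHom,
      (represents_ofXi_iterate hW k).evalAt, Finsupp.sum_single_index]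
    simp

end IsParabolicDomain

/-! ### The linear differential equation for `W₁` -/

/-- A real polynomial in two variables as a polynomial in `y` over the polynomials in `x`. -/
def toBivariate : MvPolynomial (Fin 2) ℝ →ₐ[ℝ] ℝ[X][X] :=
  MvPolynomial.aeval ![Polynomial.C Polynomial.X, Polynomial.X]

lemma toBivariate_eval (f : MvPolynomial (Fin 2) ℝ) (ξ η : ℝ) :
    ((toBivariate f).map (Polynomial.evalRingHom ξ)).eval η = MvPolynomial.eval ![ξ, η] f := by
  induction f using MvPolynomial.induction_on with
  | C a => simp [toBivariate, Polynomial.algebraMap_apply]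
  | add f g hf hg => simp [hf, hg]
  | mul_X f i hf => fin_cases i <;> simp [toBivariate] <;> simp [← hf, toBivariate]

/-- The operator `∂¹⁴ ∘ compatSymbol` of order 17, expanded in powers of `y`. -/
def odeCoeff (A : ℕ → ℕ → ℕ → ℝ) (m k : ℕ) : ℝ[X] :=
  (toBivariate ((opDx^[14] (compatSymbol A)) k)).coeff m

/-- The exponent of `y` from which the differential equation is read off. -/
def odeExponent (A : ℕ → ℕ → ℕ → ℝ) : ℕ :=
  (toBivariate ((opDx^[14] (compatSymbol A)) 17)).natDegree

/-- The system of linear differential equations for the first part of the potential. -/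
def odeSystem (A : ℕ → ℕ → ℕ → ℝ) : LinearODESystem :=
  fun _ k => odeCoeff A (odeExponent A) k

/-- The exponent of y is the y-degree of the coefficient of order 17, so the entry at 17 is a
leading coefficient. It vanishes only if ρ³F₃ does. -/
lemma odeSystem_ne_zero {A : ℕ → ℕ → ℕ → ℝ} (hA : ∃ j k l : ℕ, j + k + l = 3 ∧ A j k l ≠ 0) :
    odeSystem A ≠ 0 := by
  intro h0
  obtain ⟨j, k, l, hjkl, hne⟩ := hA
  refine hne (eq_zero_of_polyF3_eq_zero (fun ξ η => ?_) j k l hjkl)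
  have h1 : odeCoeff A (odeExponent A) 17 = 0 := congrFun (congrFun h0 0) 17
  have h2 : toBivariate ((opDx^[14] (compatSymbol A)) 17) = 0 :=
    Polynomial.leadingCoeff_eq_zero.mp h1
  rw [(opDx_iterate_of_order_le (m := 3) (compatSymbol_of_gt A) 14).2, compatSymbol_three] at h2
  have h3 : (MvPolynomial.X 0 ^ 2 + MvPolynomial.X 1 ^ 2 : MvPolynomial (Fin 2) ℝ) ^ 3 * mvF₃ A = 0 := by
    refine MvPolynomial.funext fun v => ?_
    have hv : v = ![v 0, v 1] := by ext i; fin_cases i <;> rfl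
    rw [hv, ← toBivariate_eval, h2]
    simp
  rcases mul_eq_zero.mp h3 with h | h
  · have := congrArg (MvPolynomial.eval ![1, 0]) h
    simp at this
  · rw [← eval_mvF₃, h, map_zero]

/-- At fixed ξ the differentiated condition is a polynomial in η whose coefficients involve the
derivatives of W₁ at ξ. It vanishes on the infinite set J, hence coefficient by coefficient. -/
lemma odeSystem_isSolution (A : ℕ → ℕ → ℕ → ℝ) (h : IsParabolicDomain I J) {W₁ W₂ : ℝ → ℝ}
    (hW₁ : ContDiffOn ℝ ∞ W₁ I) (hW₂ : ContDiffOn ℝ ∞ W₂ J)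
    (hLC : LinearCompatibility A I J (sepPotential W₁ W₂)) :
    (odeSystem A).IsSolution I W₁ := by
  have h0 := (h.plane ℝ).evalOp_eq_zero A (IsParabolicDomain.E_ofXi hW₁)
    (IsParabolicDomain.D_ofEta hW₂) ((IsParabolicDomain.linearCompatibility_iff A
      (IsParabolicDomain.represents_sepPotential hW₁ hW₂)).mp hLC)
  set Q := opDx^[14] (compatSymbol A) with hQ
  intro ξ hξ _
  have h1 : ∀ η ∈ J, ∑ k ∈ Finset.range 18,
      MvPolynomial.eval ![ξ, η] (Q k) * iteratedDeriv k W₁ ξ = 0 := by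
    intro η hη
    have := IsParabolicDomain.evalAt_evalOp (h := h) ⟨(ξ, η), hξ, hη⟩ hW₁ Q
    rw [h0, map_zero, Finsupp.sum_of_support_subset (s := Finset.range 18)] at this
    · exact this.symm
    · intro k hk
      by_contra hk'
      refine Finsupp.mem_support_iff.mp hk
        ((opDx_iterate_of_order_le (m := 3) (compatSymbol_of_gt A) 14).1 k ?_)
      simp at hk'
      omega
    · simp
  have h2 : (∑ k ∈ Finset.range 18, (toBivariate (Q k)).map (Polynomial.evalRingHom ξ)
      * Polynomial.C (iteratedDeriv k W₁ ξ)) = 0 := by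
    obtain ⟨η₀, hη₀⟩ := h.2.2.2.1
    refine Polynomial.eq_zero_of_infinite_isRoot _
      ((infinite_of_mem_nhds η₀ (h.2.2.1.mem_nhds hη₀)).mono fun η hη => ?_)
    change Polynomial.eval _ _ = 0
    rw [Polynomial.eval_finsetSum]
    simpa [toBivariate_eval] using h1 η hη
  have h3 := congrArg (Polynomial.coeff · (odeExponent A)) h2
  simp only [Polynomial.finsetSum_coeff, Polynomial.coeff_mul_C, Polynomial.coeff_map,
    Polynomial.coeff_zero, Finset.sum_range, Polynomial.coe_evalRingHom] at h3
  exact h3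

/-- If the linear compatibility condition holds for all potentials, then `F₃` vanishes. -/
lemma eq_zero_of_linearCompatibility (A : ℕ → ℕ → ℕ → ℝ) (h : IsParabolicDomain I J)
    (H : ∀ W₁ W₂ : ℝ → ℝ, ContDiffOn ℝ ∞ W₁ I → ContDiffOn ℝ ∞ W₂ J →
      LinearCompatibility A I J (sepPotential W₁ W₂)) (j k l : ℕ) (hjkl : j + k + l = 3) :
    A j k l = 0 := by
  by_contra hne
  have hS := odeSystem_ne_zero ⟨j, k, l, hjkl, hne⟩
  refine hS (funext fun m => funext fun k => ?_)
  obtain ⟨ξ₀, hξ₀⟩ := h.2.1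
  refine Polynomial.eq_zero_of_infinite_isRoot _
      ((infinite_of_mem_nhds ξ₀ (h.1.mem_nhds hξ₀)).mono fun ξ hξ => ?_)
  -- The derivatives of (t − ξ)ᵏ at t = ξ vanish except the k-th, which is k!. The equation thus
  -- reduces to its k-th coefficient at ξ, for infinitely many ξ.
  have := odeSystem_isSolution A h (W₁ := fun t => (t - ξ) ^ (k : ℕ)) (W₂ := 0)
    (by fun_prop) contDiffOn_const (H _ _ (by fun_prop) contDiffOn_const) ξ hξ m
  rw [Finset.sum_eq_single k] at this
  · simpa [iteratedDeriv_comp_sub_const _ (fun t => t ^ (k : ℕ)), Nat.descFactorial_self,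
      Nat.factorial_ne_zero] using this
  · intro i _ hik
    simp only [iteratedDeriv_comp_sub_const _ (fun t => t ^ (k : ℕ)), sub_self,
      iteratedDeriv_fun_pow_zero, Fin.val_inj, hik, if_false, Nat.cast_zero, mul_zero]
  · simp

/-! ### The symmetry that exchanges the two coordinates -/

lemma IsParabolicDomain.symm (h : IsParabolicDomain I J) : IsParabolicDomain J I :=
  ⟨h.2.2.1, h.2.2.2.1, h.1, h.2.1, fun η hη ξ hξ => by
    rw [add_comm]; exact h.2.2.2.2 ξ hξ η hη⟩

/-- The leading coefficients after the exchange of the coordinates. -/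
def swapCoeff (A : ℕ → ℕ → ℕ → ℝ) (j k l : ℕ) : ℝ := (-1) ^ (j + k) * A j k l

lemma pdXi_swap (f : ℝ → ℝ → ℝ) : pdXi (fun a b => f b a) = fun a b => pdEta f b a := rfl
lemma pdEta_swap (f : ℝ → ℝ → ℝ) : pdEta (fun a b => f b a) = fun a b => pdXi f b a := rfl

/-- Exchanging ξ and η is the reflection x₁ ↦ −x₁, which reverses p₁ and L₃ and fixes p₂; hence the
sign (−1)^(j+k). The momenta p_ξ and p_η are exchanged, and so F₁ with F₄ and F₂ with F₃. -/
lemma polyF1_swapCoeff (A : ℕ → ℕ → ℕ → ℝ) :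
    polyF1 (swapCoeff A) = fun a b => polyF4 A b a := by
  funext a b; simp only [polyF1, polyF4, swapCoeff]; ring

lemma polyF2_swapCoeff (A : ℕ → ℕ → ℕ → ℝ) :
    polyF2 (swapCoeff A) = fun a b => polyF3 A b a := by
  funext a b; simp only [polyF2, polyF3, swapCoeff]; ring

lemma polyF3_swapCoeff (A : ℕ → ℕ → ℕ → ℝ) :
    polyF3 (swapCoeff A) = fun a b => polyF2 A b a := by
  funext a b; simp only [polyF2, polyF3, swapCoeff]; ring

lemma polyF4_swapCoeff (A : ℕ → ℕ → ℕ → ℝ) :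
    polyF4 (swapCoeff A) = fun a b => polyF1 A b a := by
  funext a b; simp only [polyF1, polyF4, swapCoeff]; ring

lemma LinearCompatibility.swap {A : ℕ → ℕ → ℕ → ℝ} (h : IsParabolicDomain I J) {W₁ W₂ : ℝ → ℝ}
    (hW₁ : ContDiffOn ℝ ∞ W₁ I) (hW₂ : ContDiffOn ℝ ∞ W₂ J)
    (hLC : LinearCompatibility A I J (sepPotential W₁ W₂)) :
    LinearCompatibility (swapCoeff A) J I (sepPotential W₂ W₁) := by
  intro η hη ξ hξ
  have hV : sepPotential W₂ W₁ = fun a b => sepPotential W₁ W₂ b a := by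
    funext a b; simp only [sepPotential]; rw [add_comm, add_comm (a ^ 2)]
  -- The exchange reverses the order of mixed derivatives, while `linCompat` uses a fixed order.
  -- This fact and `k1`, `k2` restore it.
  have key : ∀ {F : ℝ → ℝ → ℝ} {f : smoothAlg ℝ h.opens}, Represents F f →
      pdXi (pdEta F) ξ η = pdEta (pdXi F) ξ η := fun {F f} hF => by
    have h1 := IsParabolicDomain.represents_D (IsParabolicDomain.represents_E hF) ⟨(ξ, η), hξ, hη⟩
    have h2 := IsParabolicDomain.represents_E (IsParabolicDomain.represents_D hF) ⟨(ξ, η), hξ, hη⟩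
    rw [(h.plane ℝ).comm] at h1
    exact h1.trans h2.symm
  have hr := IsParabolicDomain.represents_sepPotential (h := h) hW₁ hW₂
  have k1 : pdXi (pdXi (pdEta (sepPotential W₁ W₂))) ξ η
      = pdEta (pdXi (pdXi (sepPotential W₁ W₂))) ξ η := by
    have h1 := IsParabolicDomain.represents_D (IsParabolicDomain.represents_D
      (IsParabolicDomain.represents_E hr)) ⟨(ξ, η), hξ, hη⟩
    have h2 := IsParabolicDomain.represents_E (IsParabolicDomain.represents_D
      (IsParabolicDomain.represents_D hr)) ⟨(ξ, η), hξ, hη⟩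
    rw [(h.plane ℝ).comm, (h.plane ℝ).comm] at h1
    exact h1.trans h2.symm
  have k2 : pdXi (pdEta (pdEta (sepPotential W₁ W₂))) ξ η
      = pdEta (pdEta (pdXi (sepPotential W₁ W₂))) ξ η := by
    have h1 := IsParabolicDomain.represents_D (IsParabolicDomain.represents_E
      (IsParabolicDomain.represents_E hr)) ⟨(ξ, η), hξ, hη⟩
    have h2 := IsParabolicDomain.represents_E (IsParabolicDomain.represents_E
      (IsParabolicDomain.represents_D hr)) ⟨(ξ, η), hξ, hη⟩
    rw [(h.plane ℝ).comm, (h.plane ℝ).comm] at h1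
    exact h1.trans h2.symm
  rw [← hLC ξ hξ η hη, hV]
  simp only [linCompat, coeffVEta, coeffVXi, polyF1_swapCoeff, polyF2_swapCoeff, polyF3_swapCoeff,
    polyF4_swapCoeff, pdXi_swap, pdEta_swap, k1, k2, key hr,
    key (h.represents_F₂ A), key (h.represents_F₃ A), add_comm (η ^ 2)]
  ring

end Plane
end

noncomputable section

/-! ### The second-order determining equations -/

lemma sum_antidiagonalTuple_three {M : Type*} [AddCommMonoid M] (f : ℕ → ℕ → ℕ → M) :
    ∑ t ∈ Finset.Nat.antidiagonalTuple 3 3, f (t 0) (t 1) (t 2)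
      = f 0 0 3 + f 0 1 2 + f 0 2 1 + f 0 3 0 + f 1 0 2 + f 1 1 1 + f 1 2 0 + f 2 0 1 + f 2 1 0
        + f 3 0 0 := by
  have : Finset.Nat.antidiagonalTuple 3 3 = {![0, 0, 3], ![0, 1, 2], ![0, 2, 1], ![0, 3, 0],
      ![1, 0, 2], ![1, 1, 1], ![1, 2, 0], ![2, 0, 1], ![2, 1, 0], ![3, 0, 0]} := by decide
  rw [this]
  repeat rw [Finset.sum_insert (by decide)]
  rw [Finset.sum_singleton]
  simp [add_assoc]

/-- The determining equations of second order in the momenta for the vector field `(g₁, g₂)`. -/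
def DeterminingEquations (A : ℕ → ℕ → ℕ → ℝ) (V g₁ g₂ : ℝ → ℝ → ℝ) (ξ η : ℝ) : Prop :=
  ξ * pdXi g₁ ξ η + η * pdXi g₂ ξ η
      = (ξ ^ 2 + η ^ 2)⁻¹ * (3 * polyF1 A ξ η * pdXi V ξ η + polyF2 A ξ η * pdEta V ξ η) ∧
  ξ * pdEta g₂ ξ η - η * pdEta g₁ ξ η
      = (ξ ^ 2 + η ^ 2)⁻¹ * (polyF3 A ξ η * pdXi V ξ η + 3 * polyF4 A ξ η * pdEta V ξ η) ∧
  ξ * pdXi g₂ ξ η - η * pdXi g₁ ξ η + ξ * pdEta g₁ ξ η + η * pdEta g₂ ξ η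
      = (ξ ^ 2 + η ^ 2)⁻¹ * (2 * (polyF2 A ξ η * pdXi V ξ η + polyF3 A ξ η * pdEta V ξ η))

section

variable {I J : Set ℝ} {A : ℕ → ℕ → ℕ → ℝ} {V g₁ g₂ : ℝ → ℝ → ℝ}

lemma linearCompatibility_of_determiningEquations (h : IsParabolicDomain I J)
    (hV : SmoothOnRect I J V) (hg₁ : SmoothOnRect I J g₁) (hg₂ : SmoothOnRect I J g₂)
    (H : ∀ ξ ∈ I, ∀ η ∈ J, DeterminingEquations A V g₁ g₂ ξ η) : LinearCompatibility A I J V := by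
  have rV : Represents V _ := Represents.ofContDiffOn (S := h.opens) hV
  have r₁ : Represents g₁ _ := Represents.ofContDiffOn (S := h.opens) hg₁
  have r₂ : Represents g₂ _ := Represents.ofContDiffOn (S := h.opens) hg₂
  rw [IsParabolicDomain.linearCompatibility_iff A rV, PlaneDiffRing.linCompat_eq_compatOp]
  refine (h.plane ℝ).compatOp_eq_zero
    (smoothAlg.ofContDiffOn (S := h.opens) _ hg₁) (smoothAlg.ofContDiffOn (S := h.opens) _ hg₂)
    _ _ _ (Subtype.ext (funext fun s => ?_))
    (Subtype.ext (funext fun s => ?_)) (Subtype.ext (funext fun s => ?_))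
  all_goals
    obtain ⟨h1, h2, h3⟩ := H s.1.1 s.2.1 s.1.2 s.2.2
    rw [← smoothAlg.evalAt_apply, ← smoothAlg.evalAt_apply]
    simp only [map_add, map_sub, map_mul, map_ofNat, IsParabolicDomain.evalAt_x,
      IsParabolicDomain.evalAt_y, IsParabolicDomain.evalAt_r,
      (IsParabolicDomain.represents_D r₁).evalAt, (IsParabolicDomain.represents_D r₂).evalAt,
      (IsParabolicDomain.represents_E r₁).evalAt, (IsParabolicDomain.represents_E r₂).evalAt,
      (IsParabolicDomain.represents_D rV).evalAt, (IsParabolicDomain.represents_E rV).evalAt,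
      (h.represents_F₁ A).evalAt, (h.represents_F₂ A).evalAt, (h.represents_F₃ A).evalAt,
      (h.represents_F₄ A).evalAt, Algebra.algebraMap_self, RingHom.id_apply]
    assumption

/-! ### The determining equations of a classical integral -/

lemma clH_eq (ξ η p q : ℝ) :
    clH V ξ η p q = (p ^ 2 + q ^ 2) * (2 * (ξ ^ 2 + η ^ 2))⁻¹ + V ξ η := by
  simp only [clH, clP1, clP2]
  -- Where the denominator vanishes, division by zero leaves V on both sides. The formula therefore
  -- holds everywhere and can be used under a derivative without restricting to a neighbourhood.
  by_cases h : ξ ^ 2 + η ^ 2 = 0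
  · simp [h]
  · field_simp
    ring

lemma clX_eq {ξ η : ℝ} (h : ξ ^ 2 + η ^ 2 ≠ 0) (p q : ℝ) :
    clX A g₁ g₂ ξ η p q = 2 * (polyF1 A ξ η * ((ξ ^ 2 + η ^ 2) ^ 3)⁻¹ * p ^ 3
        + polyF2 A ξ η * ((ξ ^ 2 + η ^ 2) ^ 3)⁻¹ * p ^ 2 * q
        + polyF3 A ξ η * ((ξ ^ 2 + η ^ 2) ^ 3)⁻¹ * p * q ^ 2
        + polyF4 A ξ η * ((ξ ^ 2 + η ^ 2) ^ 3)⁻¹ * q ^ 3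
        + (ξ * g₁ ξ η + η * g₂ ξ η) * (ξ ^ 2 + η ^ 2)⁻¹ * p
        + (ξ * g₂ ξ η - η * g₁ ξ η) * (ξ ^ 2 + η ^ 2)⁻¹ * q) := by
  simp only [clX]
  rw [sum_antidiagonalTuple_three fun a b c => A a b c * (2 * clL3 ξ η p q ^ a *
    clP1 ξ η p q ^ b * clP2 ξ η p q ^ c)]
  simp only [clP1, clP2, clL3, polyF1, polyF2, polyF3, polyF4]
  field_simp
  ring

/-- The bracket is a polynomial in (p, q) with parts of degree 4, 2 and 0 only. The coefficients of
p², q² and pq give the three equations. -/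
lemma determiningEquations_of_poissonBracket {ξ η : ℝ} (h : ξ ^ 2 + η ^ 2 ≠ 0)
    (hVx : DifferentiableAt ℝ (fun t => V t η) ξ) (hVy : DifferentiableAt ℝ (fun t => V ξ t) η)
    (h₁x : DifferentiableAt ℝ (fun t => g₁ t η) ξ) (h₁y : DifferentiableAt ℝ (fun t => g₁ ξ t) η)
    (h₂x : DifferentiableAt ℝ (fun t => g₂ t η) ξ) (h₂y : DifferentiableAt ℝ (fun t => g₂ ξ t) η)
    (H : ∀ p q : ℝ, poissonBracket (clH V) (clX A g₁ g₂) ξ η p q = 0) :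
    DeterminingEquations A V g₁ g₂ ξ η := by
  have dVx : HasDerivAt (fun t => V t η) (pdXi V ξ η) ξ := hVx.hasDerivAt
  have dVy : HasDerivAt (fun t => V ξ t) (pdEta V ξ η) η := hVy.hasDerivAt
  have d₁x : HasDerivAt (fun t => g₁ t η) (pdXi g₁ ξ η) ξ := h₁x.hasDerivAt
  have d₁y : HasDerivAt (fun t => g₁ ξ t) (pdEta g₁ ξ η) η := h₁y.hasDerivAt
  have d₂x : HasDerivAt (fun t => g₂ t η) (pdXi g₂ ξ η) ξ := h₂x.hasDerivAt
  have d₂y : HasDerivAt (fun t => g₂ ξ t) (pdEta g₂ ξ η) η := h₂y.hasDerivAt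
  have rx : HasDerivAt (fun t : ℝ => (t ^ 2 + η ^ 2)⁻¹) (-(2 * ξ) * (ξ ^ 2 + η ^ 2)⁻¹ ^ 2) ξ := by
    have h1 : HasDerivAt (fun t : ℝ => t ^ 2 + η ^ 2) (2 * ξ) ξ := by
      simpa using ((hasDerivAt_id ξ).pow 2).add_const (η ^ 2)
    exact (h1.fun_inv h).congr_deriv (by rw [div_eq_mul_inv, inv_pow])
  have ry : HasDerivAt (fun t : ℝ => (ξ ^ 2 + t ^ 2)⁻¹) (-(2 * η) * (ξ ^ 2 + η ^ 2)⁻¹ ^ 2) η := by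
    have h1 : HasDerivAt (fun t : ℝ => ξ ^ 2 + t ^ 2) (2 * η) η := by
      simpa using ((hasDerivAt_id η).pow 2).const_add (ξ ^ 2)
    exact (h1.fun_inv h).congr_deriv (by rw [div_eq_mul_inv, inv_pow])
  -- The derivatives of Fᵢ/ρ³ enter only the quartic part, which is eliminated below, so their
  -- existence suffices.
  have cx : ∀ F ∈ [polyF1 A, polyF2 A, polyF3 A, polyF4 A],
      ∃ f, HasDerivAt (fun t => F t η * ((t ^ 2 + η ^ 2) ^ 3)⁻¹) f ξ := by
    intro F hF
    have hd : DifferentiableAt ℝ (fun t => F t η) ξ := by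
      simp only [List.mem_cons, List.not_mem_nil, or_false] at hF
      rcases hF with rfl | rfl | rfl | rfl <;> simp only [polyF1, polyF2, polyF3, polyF4] <;> fun_prop
    exact ⟨_, (hd.mul (DifferentiableAt.fun_inv (h := fun t : ℝ => (t ^ 2 + η ^ 2) ^ 3) (by fun_prop)
      (pow_ne_zero 3 h))).hasDerivAt⟩
  have cy : ∀ F ∈ [polyF1 A, polyF2 A, polyF3 A, polyF4 A],
      ∃ f, HasDerivAt (fun t => F ξ t * ((ξ ^ 2 + t ^ 2) ^ 3)⁻¹) f η := by
    intro F hF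
    have hd : DifferentiableAt ℝ (fun t => F ξ t) η := by
      simp only [List.mem_cons, List.not_mem_nil, or_false] at hF
      rcases hF with rfl | rfl | rfl | rfl <;> simp only [polyF1, polyF2, polyF3, polyF4] <;> fun_prop
    exact ⟨_, (hd.mul (DifferentiableAt.fun_inv (h := fun t : ℝ => (ξ ^ 2 + t ^ 2) ^ 3) (by fun_prop)
      (pow_ne_zero 3 h))).hasDerivAt⟩
  obtain ⟨a₁, ha₁⟩ := cx (polyF1 A) (by simp)
  obtain ⟨a₂, ha₂⟩ := cx (polyF2 A) (by simp)
  obtain ⟨a₃, ha₃⟩ := cx (polyF3 A) (by simp)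
  obtain ⟨a₄, ha₄⟩ := cx (polyF4 A) (by simp)
  obtain ⟨b₁, hb₁⟩ := cy (polyF1 A) (by simp)
  obtain ⟨b₂, hb₂⟩ := cy (polyF2 A) (by simp)
  obtain ⟨b₃, hb₃⟩ := cy (polyF3 A) (by simp)
  obtain ⟨b₄, hb₄⟩ := cy (polyF4 A) (by simp)
  have hx0 : ∀ᶠ t in nhds ξ, t ^ 2 + η ^ 2 ≠ 0 :=
    (by fun_prop : Continuous fun t : ℝ => t ^ 2 + η ^ 2).continuousAt.eventually_ne h
  have hy0 : ∀ᶠ t in nhds η, ξ ^ 2 + t ^ 2 ≠ 0 :=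
    (by fun_prop : Continuous fun t : ℝ => ξ ^ 2 + t ^ 2).continuousAt.eventually_ne h
  have Hx : ∀ p q, deriv (fun t => clH V t η p q) ξ = _ := fun p q => by
    simp only [clH_eq, mul_inv]
    exact (((rx.const_mul (2⁻¹)).const_mul (p ^ 2 + q ^ 2)).add dVx).deriv
  have Hy : ∀ p q, deriv (fun t => clH V ξ t p q) η = _ := fun p q => by
    simp only [clH_eq, mul_inv]
    exact (((ry.const_mul (2⁻¹)).const_mul (p ^ 2 + q ^ 2)).add dVy).deriv
  have Hp : ∀ p q, deriv (fun t => clH V ξ η t q) p = p * (ξ ^ 2 + η ^ 2)⁻¹ := fun p q => by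
    simp only [clH_eq, mul_inv]
    refine (((((hasDerivAt_id p).pow 2).add_const (q ^ 2)).mul_const _).add_const _).deriv.trans ?_
    simp
    ring
  have Hq : ∀ p q, deriv (fun t => clH V ξ η p t) q = q * (ξ ^ 2 + η ^ 2)⁻¹ := fun p q => by
    simp only [clH_eq, mul_inv]
    refine (((((hasDerivAt_id q).pow 2).const_add (p ^ 2)).mul_const _).add_const _).deriv.trans ?_
    simp
    ring
  have Xx : ∀ p q, deriv (fun t => clX A g₁ g₂ t η p q) ξ = _ := fun p q => by
    refine (Filter.EventuallyEq.deriv_eq (hx0.mono fun t ht => clX_eq ht p q)).trans ?_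
    exact (((((((ha₁.mul_const (p ^ 3)).add ((ha₂.mul_const (p ^ 2)).mul_const q)).add
      ((ha₃.mul_const p).mul_const (q ^ 2))).add (ha₄.mul_const (q ^ 3))).add
      (((((hasDerivAt_id ξ).mul d₁x).add (d₂x.const_mul η)).mul rx).mul_const p)).add
      (((((hasDerivAt_id ξ).mul d₂x).sub (d₁x.const_mul η)).mul rx).mul_const q)).const_mul 2).deriv
  have Xy : ∀ p q, deriv (fun t => clX A g₁ g₂ ξ t p q) η = _ := fun p q => by
    refine (Filter.EventuallyEq.deriv_eq (hy0.mono fun t ht => clX_eq ht p q)).trans ?_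
    exact (((((((hb₁.mul_const (p ^ 3)).add ((hb₂.mul_const (p ^ 2)).mul_const q)).add
      ((hb₃.mul_const p).mul_const (q ^ 2))).add (hb₄.mul_const (q ^ 3))).add
      ((((d₁y.const_mul ξ).add ((hasDerivAt_id η).mul d₂y)).mul ry).mul_const p)).add
      ((((d₂y.const_mul ξ).sub ((hasDerivAt_id η).mul d₁y)).mul ry).mul_const q)).const_mul 2).deriv
  have Xp : ∀ p q, deriv (fun t => clX A g₁ g₂ ξ η t q) p = _ := fun p q => by
    simp only [clX_eq h]
    exact ((((((((hasDerivAt_id p).pow 3).const_mul _).add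
      ((((hasDerivAt_id p).pow 2).const_mul _).mul_const q)).add
      (((hasDerivAt_id p).const_mul _).mul_const (q ^ 2))).add_const _).add
      ((hasDerivAt_id p).const_mul _)).add_const _).const_mul 2 |>.deriv
  have Xq : ∀ p q, deriv (fun t => clX A g₁ g₂ ξ η p t) q = _ := fun p q => by
    simp only [clX_eq h]
    exact ((((((hasDerivAt_id q).const_mul _).const_add _).add
      (((hasDerivAt_id q).pow 2).const_mul _)).add
      (((hasDerivAt_id q).pow 3).const_mul _)).add_const _).add
      ((hasDerivAt_id q).const_mul _) |>.const_mul 2 |>.deriv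
  have key : ∀ p q, _ = (0 : ℝ) := H
  simp only [poissonBracket, Hx, Hy, Hp, Hq, Xx, Xy, Xp, Xq] at key
  have hR : (ξ ^ 2 + η ^ 2)⁻¹ * (ξ ^ 2 + η ^ 2) = 1 := inv_mul_cancel₀ h
  have hR0 : (ξ ^ 2 + η ^ 2)⁻¹ ^ 2 ≠ 0 := pow_ne_zero 2 (inv_ne_zero h)
  -- For f(t) = a₄t⁴ + a₂t² + a₀ one has 16 f(1) − f(2) − 15 f(0) = 12 a₂. This is used along (1,0),
  -- (0,1) and (1,1); subtracting the first two from the third leaves the coefficient of pq.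
  have e0 := key 0 0
  have p1 := key 1 0
  have p2 := key 2 0
  have q1 := key 0 1
  have q2 := key 0 2
  have s1 := key 1 1
  have s2 := key 2 2
  simp only [← inv_pow, id, Nat.cast_ofNat, Pi.add_apply, Pi.mul_apply, Pi.sub_apply]
    at e0 p1 p2 q1 q2 s1 s2
  unfold DeterminingEquations
  generalize (ξ ^ 2 + η ^ 2)⁻¹ = R at *
  refine ⟨sub_eq_zero.mp (mul_left_cancel₀ hR0 ?_), sub_eq_zero.mp (mul_left_cancel₀ hR0 ?_),
    sub_eq_zero.mp (mul_left_cancel₀ hR0 ?_)⟩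
  · linear_combination (-1 / 24) * (16 * p1 - p2 - 15 * e0) + g₁ ξ η * R ^ 2 * hR
  · linear_combination (-1 / 24) * (16 * q1 - q2 - 15 * e0) - g₁ ξ η * R ^ 2 * hR
  · linear_combination (-1 / 24) * (16 * s1 - s2 - 15 * e0)
      + (1 / 24) * (16 * p1 - p2 - 15 * e0) + (1 / 24) * (16 * q1 - q2 - 15 * e0)
      + 2 * g₂ ξ η * R ^ 2 * hR

end
end

noncomputable section

/-! ### Commutators of differential operators -/

section Commutators

variable {R : Type*} [CommRing R] [Algebra ℝ R]

/-- A derivation as an element of the ring of operators. -/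
def opOf (a : Derivation ℝ R R) : Module.End ℝ R := a.toLinearMap

lemma opOf_apply (a : Derivation ℝ R R) (f : R) : opOf a f = a f := rfl

/-- Multiplication by `f` as an operator. -/
def mulBy (f : R) : Module.End ℝ R := LinearMap.mulLeft ℝ f

lemma mulBy_apply (f g : R) : mulBy f g = f * g := rfl

/-- The double commutator with multiplication by `h`. -/
def doubleComm (h : R) : Module.End ℝ R →ₗ[ℝ] Module.End ℝ R where
  toFun Y := Y * mulBy h * mulBy h - 2 • (mulBy h * Y * mulBy h) + mulBy h * mulBy h * Y
  map_add' Y Z := by noncomm_ring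
  map_smul' c Y := by
    ext f
    simp [mulBy_apply]
    module

lemma doubleComm_apply (h : R) (Y : Module.End ℝ R) (f : R) :
    doubleComm h Y f = Y (h * (h * f)) - 2 * (h * Y (h * f)) + h * (h * Y f) := by
  simp [doubleComm, mulBy_apply, two_smul, two_mul, mul_assoc]

/-- A double commutator with h turns a second-order operator into multiplication by twice its
principal symbol at dh. The commutator of v with abc has second order, one derivation at a time
falling on v. -/
lemma doubleComm_triple (h v : R) (a b c : Derivation ℝ R R) :
    doubleComm h (mulBy v * (opOf a * opOf b * opOf c) - opOf a * opOf b * opOf c * mulBy v)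
      = mulBy (-2 * (a h * b h * c v + a h * c h * b v + b h * c h * a v)) := by
  ext f
  simp only [doubleComm_apply, LinearMap.sub_apply, Module.End.mul_apply, mulBy_apply, opOf_apply,
    Derivation.leibniz, smul_eq_mul, map_add]
  ring

/-- The inner commutator is multiplication by a function and commutes with h. -/
lemma doubleComm_first_order (h v g : R) (a : Derivation ℝ R R) :
    doubleComm h (mulBy v * (mulBy g * opOf a + opOf a * mulBy g)
      - (mulBy g * opOf a + opOf a * mulBy g) * mulBy v) = 0 := by
  ext f
  simp only [doubleComm_apply, LinearMap.sub_apply, LinearMap.add_apply, Module.End.mul_apply,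
    mulBy_apply, opOf_apply, Derivation.leibniz, smul_eq_mul, LinearMap.zero_apply]
  ring

/-- The principal part is 4 (a g) a b; without ab = ba a further term in the commutator of a² and b
would remain. -/
lemma doubleComm_square (h g : R) (a b : Derivation ℝ R R) (hab : ∀ f, a (b f) = b (a f)) :
    doubleComm h (opOf a * opOf a * (mulBy g * opOf b + opOf b * mulBy g)
      - (mulBy g * opOf b + opOf b * mulBy g) * (opOf a * opOf a))
      = mulBy (8 * (a h * b h * a g)) := by
  ext f
  simp only [doubleComm_apply, LinearMap.sub_apply, LinearMap.add_apply, Module.End.mul_apply,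
    mulBy_apply, opOf_apply, Derivation.leibniz, smul_eq_mul, map_add, hab]
  ring

lemma doubleComm_square_self (h g : R) (a : Derivation ℝ R R) :
    doubleComm h (opOf a * opOf a * (mulBy g * opOf a + opOf a * mulBy g)
      - (mulBy g * opOf a + opOf a * mulBy g) * (opOf a * opOf a))
      = mulBy (8 * (a h * a h * a g)) := by
  ext f
  simp only [doubleComm_apply, LinearMap.sub_apply, LinearMap.add_apply, Module.End.mul_apply,
    mulBy_apply, opOf_apply, Derivation.leibniz, smul_eq_mul, map_add]
  ring

/-- The symmetrised cubic operator with coefficients `A` in three derivations. -/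
def cubicOp (A : ℕ → ℕ → ℕ → ℝ) (l p q : Derivation ℝ R R) : Module.End ℝ R :=
  ∑ t ∈ Finset.Nat.antidiagonalTuple 3 3, A (t 0) (t 1) (t 2) •
    (opOf l ^ t 0 * (opOf p ^ t 1 * opOf q ^ t 2) + opOf p ^ t 1 * opOf q ^ t 2 * opOf l ^ t 0)

/-- The polarisation of the cubic form with coefficients `A`, evaluated at `(h, h, v)`. -/
def cubicPolar (A : ℕ → ℕ → ℕ → ℝ) (l p q l' p' q' : R) : R :=
  algebraMap ℝ R (A 0 0 3) * (3 * q ^ 2 * q')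
    + algebraMap ℝ R (A 0 1 2) * (2 * p * q * q' + q ^ 2 * p')
    + algebraMap ℝ R (A 0 2 1) * (2 * p * q * p' + p ^ 2 * q')
    + algebraMap ℝ R (A 0 3 0) * (3 * p ^ 2 * p')
    + algebraMap ℝ R (A 1 0 2) * (2 * l * q * q' + q ^ 2 * l')
    + algebraMap ℝ R (A 1 1 1) * (l * p * q' + l * q * p' + p * q * l')
    + algebraMap ℝ R (A 1 2 0) * (2 * l * p * p' + p ^ 2 * l')
    + algebraMap ℝ R (A 2 0 1) * (2 * l * q * l' + l ^ 2 * q')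
    + algebraMap ℝ R (A 2 1 0) * (2 * l * p * l' + l ^ 2 * p')
    + algebraMap ℝ R (A 3 0 0) * (3 * l ^ 2 * l')

/-- Everything is linear in the cubic operator. Each monomial occurs in two orderings, both
contributing a factor −2, hence −4. -/
lemma doubleComm_cubicOp (A : ℕ → ℕ → ℕ → ℝ) (h v : R) (l p q : Derivation ℝ R R) :
    doubleComm h (mulBy v * cubicOp A l p q - cubicOp A l p q * mulBy v)
      = mulBy (-4 * cubicPolar A (l h) (p h) (q h) (l v) (p v) (q v)) := by
  have key : ∀ (c : ℝ) (Y : Module.End ℝ R) (z : R),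
      doubleComm h (mulBy v * Y - Y * mulBy v) = mulBy z →
      doubleComm h (mulBy v * (c • Y) - (c • Y) * mulBy v) = mulBy (algebraMap ℝ R c * z) := by
    intro c Y z hY
    have h1 : mulBy v * (c • Y) - (c • Y) * mulBy v = c • (mulBy v * Y - Y * mulBy v) := by
      rw [smul_sub, mul_smul_comm, smul_mul_assoc]
    rw [h1, map_smul, hY]
    ext f
    simp [mulBy_apply, Algebra.smul_def, mul_assoc]
  have hadd : ∀ (Y Z : Module.End ℝ R) (y z : R),
      doubleComm h (mulBy v * Y - Y * mulBy v) = mulBy y →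
      doubleComm h (mulBy v * Z - Z * mulBy v) = mulBy z →
      doubleComm h (mulBy v * (Y + Z) - (Y + Z) * mulBy v) = mulBy (y + z) := by
    intro Y Z y z hY hZ
    rw [mul_add, add_mul, add_sub_add_comm, map_add, hY, hZ]
    ext f
    simp [mulBy_apply, add_mul]
  have two : ∀ a b c a' b' c' : Derivation ℝ R R, _ := fun a b c a' b' c' =>
    hadd _ _ _ _ (doubleComm_triple h v a b c) (doubleComm_triple h v a' b' c')
  rw [cubicOp, sum_antidiagonalTuple_three fun i j k => A i j k •
    (opOf l ^ i * (opOf p ^ j * opOf q ^ k) + opOf p ^ j * opOf q ^ k * opOf l ^ i)]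
  simp only [pow_succ, pow_zero, one_mul, mul_one, ← mul_assoc]
  have := hadd _ _ _ _ (hadd _ _ _ _ (hadd _ _ _ _ (hadd _ _ _ _ (hadd _ _ _ _ (hadd _ _ _ _
    (hadd _ _ _ _ (hadd _ _ _ _ (hadd _ _ _ _
      (key (A 0 0 3) _ _ (two q q q q q q)) (key (A 0 1 2) _ _ (two p q q p q q)))
      (key (A 0 2 1) _ _ (two p p q p p q))) (key (A 0 3 0) _ _ (two p p p p p p)))
      (key (A 1 0 2) _ _ (two l q q q q l))) (key (A 1 1 1) _ _ (two l p q p q l)))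
      (key (A 1 2 0) _ _ (two l p p p p l))) (key (A 2 0 1) _ _ (two l l q q l l)))
      (key (A 2 1 0) _ _ (two l l p p l l))) (key (A 3 0 0) _ _ (two l l l l l l))
  rw [this]
  congr 1
  simp only [cubicPolar]
  ring

/-- The Laplacian commutes with l, p, q, hence with the cubic part. What is left of [H, X] has order
two, and the double commutator reads off its symbol at dh. -/
lemma doubleComm_commutator (A : ℕ → ℕ → ℕ → ℝ) (h v g₁ g₂ : R) (l p q : Derivation ℝ R R)
    (hpq : ∀ f, p (q f) = q (p f)) (hl : Commute (opOf p * opOf p + opOf q * opOf q) (opOf l))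
    (X H : Module.End ℝ R)
    (hH : H = (1 / 2 : ℝ) • (opOf p * opOf p + opOf q * opOf q) + mulBy v)
    (hX : X = cubicOp A l p q + (mulBy g₁ * opOf p + opOf p * mulBy g₁)
      + (mulBy g₂ * opOf q + opOf q * mulBy g₂)) (hHX : H * X = X * H) :
    p h * p h * p g₁ + p h * q h * (p g₂ + q g₁) + q h * q h * q g₂
      = cubicPolar A (l h) (p h) (q h) (l v) (p v) (q v) := by
  have hpq' : Commute (opOf p) (opOf q) := by ext f; exact hpq f
  set K := opOf p * opOf p + opOf q * opOf q with hK
  have hKp : Commute K (opOf p) := by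
    exact ((Commute.refl _).mul_left (Commute.refl _)).add_left (hpq'.symm.mul_left hpq'.symm)
  have hKq : Commute K (opOf q) := by
    exact (hpq'.mul_left hpq').add_left ((Commute.refl _).mul_left (Commute.refl _))
  have hKC : Commute K (cubicOp A l p q) := by
    refine Commute.sum_right _ _ _ fun t _ => Commute.smul_right ?_ _
    have h1 := hl.pow_right (t 0)
    have h2 := (hKp.pow_right (t 1)).mul_right (hKq.pow_right (t 2))
    exact (h1.mul_right h2).add_right (h2.mul_right h1)
  set G₁ := mulBy g₁ * opOf p + opOf p * mulBy g₁ with hG₁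
  set G₂ := mulBy g₂ * opOf q + opOf q * mulBy g₂ with hG₂
  set C := cubicOp A l p q with hC
  have e : (1 / 2 : ℝ) • ((opOf p * opOf p * G₁ - G₁ * (opOf p * opOf p))
        + (opOf q * opOf q * G₁ - G₁ * (opOf q * opOf q))
        + (opOf p * opOf p * G₂ - G₂ * (opOf p * opOf p))
        + (opOf q * opOf q * G₂ - G₂ * (opOf q * opOf q)))
      + (mulBy v * C - C * mulBy v) + (mulBy v * G₁ - G₁ * mulBy v)
      + (mulBy v * G₂ - G₂ * mulBy v) = 0 := by
    have h1 : H * X - X * H = 0 := sub_eq_zero.mpr hHX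
    have h2 : K * C - C * K = 0 := sub_eq_zero.mpr hKC
    rw [hH, hX] at h1
    rw [← h1]
    have h3 : (1 / 2 : ℝ) • (K * C - C * K) = 0 := by rw [h2, smul_zero]
    simp only [hK, mul_add, add_mul, smul_mul_assoc, mul_smul_comm, smul_add, smul_sub] at h3 ⊢
    rw [eq_comm, ← sub_eq_zero, ← h3]
    abel
  have e2 := congrArg (doubleComm h) e
  rw [map_add, map_add, map_add, map_smul, map_add, map_add, map_add, map_zero,
    doubleComm_square_self, doubleComm_square h g₁ q p (fun f => (hpq f).symm),
    doubleComm_square h g₂ p q hpq, doubleComm_square_self, doubleComm_cubicOp,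
    doubleComm_first_order, doubleComm_first_order] at e2
  have e3 := LinearMap.congr_fun e2 1
  simp only [LinearMap.add_apply, LinearMap.smul_apply, mulBy_apply, LinearMap.zero_apply, mul_one,
    add_zero] at e3
  simp only [Algebra.smul_def] at e3
  have h4 : algebraMap ℝ R (1 / 2) * 8 = 4 := by
    rw [← map_ofNat (algebraMap ℝ R) 8, ← map_mul, ← map_ofNat (algebraMap ℝ R) 4]
    norm_num
  have h5 : algebraMap ℝ R (1 / 4) * 4 = 1 := by
    rw [← map_ofNat (algebraMap ℝ R) 4, ← map_mul, ← map_one (algebraMap ℝ R)]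
    norm_num
  linear_combination algebraMap ℝ R (1 / 4) * e3
    + (-(p h * p h * p g₁ + p h * q h * (p g₂ + q g₁) + q h * q h * q g₂)
      * algebraMap ℝ R (1 / 4)) * h4
    - (p h * p h * p g₁ + p h * q h * (p g₂ + q g₁) + q h * q h * q g₂
      - cubicPolar A (l h) (p h) (q h) (l v) (p v) (q v)) * h5

end Commutators
end

noncomputable section

namespace PlaneDiffRing

variable {R : Type*} [CommRing R] [Algebra ℝ R] (p : PlaneDiffRing R) (k : R)

/-- The first Cartesian momentum with constant `k = -iħ`. -/
def momentum₁ : Derivation ℝ R R := (k * p.r) • (p.x • p.D - p.y • p.E)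

/-- The second Cartesian momentum with constant `k = -iħ`. -/
def momentum₂ : Derivation ℝ R R := (k * p.r) • (p.y • p.D + p.x • p.E)

/-- The angular momentum with constant `k = -iħ`. -/
def angularMomentum : Derivation ℝ R R := (algebraMap ℝ R (1 / 2) * k) • (p.x • p.E - p.y • p.D)

lemma momentum₁_apply (f : R) : p.momentum₁ k f = k * p.r * (p.x * p.D f - p.y * p.E f) := rfl

lemma momentum₂_apply (f : R) : p.momentum₂ k f = k * p.r * (p.y * p.D f + p.x * p.E f) := rfl

lemma angularMomentum_apply (f : R) :
    p.angularMomentum k f = algebraMap ℝ R (1 / 2) * k * (p.x * p.E f - p.y * p.D f) := rfl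

variable {k} (hD : p.D k = 0) (hE : p.E k = 0)
include hD hE

lemma momentum_comm (f : R) :
    p.momentum₁ k (p.momentum₂ k f) = p.momentum₂ k (p.momentum₁ k f) := by
  simp only [momentum₁_apply, momentum₂_apply, Derivation.leibniz, map_add, map_sub, smul_eq_mul,
    p.D_x, p.D_y, p.E_x, p.E_y, p.D_r, p.E_r, hD, hE, p.comm]
  linear_combination (-2 * k ^ 2 * p.r ^ 2 * (p.x * p.E f - p.y * p.D f)) * p.r_mul

lemma momentum_sq (f : R) :
    p.momentum₁ k (p.momentum₁ k f) + p.momentum₂ k (p.momentum₂ k f)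
      = k ^ 2 * p.r * (p.D (p.D f) + p.E (p.E f)) := by
  simp only [momentum₁_apply, momentum₂_apply, Derivation.leibniz, map_add, map_sub, smul_eq_mul,
    p.D_x, p.D_y, p.E_x, p.E_y, p.D_r, p.E_r, hD, hE, p.comm]
  linear_combination (k ^ 2 * p.r * (p.D (p.D f) + p.E (p.E f)
    - 2 * p.r * (p.x * p.D f + p.y * p.E f))) * p.r_mul

/-- L₃ generates rotations of the (ξ, η) plane too, and these preserve both ρ and ∂_ξ² + ∂_η². -/
lemma momentum_sq_commute_angularMomentum :
    Commute (opOf (p.momentum₁ k) * opOf (p.momentum₁ k)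
      + opOf (p.momentum₂ k) * opOf (p.momentum₂ k)) (opOf (p.angularMomentum k)) := by
  ext f
  change p.momentum₁ k (p.momentum₁ k (p.angularMomentum k f))
      + p.momentum₂ k (p.momentum₂ k (p.angularMomentum k f))
    = p.angularMomentum k (p.momentum₁ k (p.momentum₁ k f) + p.momentum₂ k (p.momentum₂ k f))
  rw [p.momentum_sq hD hE, p.momentum_sq hD hE]
  simp only [angularMomentum_apply, Derivation.leibniz, map_add, map_sub, smul_eq_mul,
    p.D_x, p.D_y, p.E_x, p.E_y, p.D_r, p.E_r, hD, hE, p.comm, Derivation.map_algebraMap, Derivation.map_one_eq_zero,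
    Derivation.leibniz_pow, map_zero]
  ring

end PlaneDiffRing

/-! ### The determining equations of a quantum integral -/

section Quantum

variable {I J : Set ℝ} {h : IsParabolicDomain I J} {ħ : ℝ}

/-- The constant `-iħ`. -/
def planckConst (h : IsParabolicDomain I J) (ħ : ℝ) : smoothAlg ℂ h.opens :=
  smoothAlg.ofContDiffOn (fun _ => -Complex.I * ħ) contDiffOn_const

lemma evalAt_planckConst (s : h.opens) :
    smoothAlg.evalAt s (planckConst h ħ) = -Complex.I * ħ := rfl

lemma D_planckConst : (h.plane ℂ).D (planckConst h ħ) = 0 :=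
  (IsParabolicDomain.represents_D (F := fun _ _ => -Complex.I * ħ) fun _ => rfl).ext fun s => by
    simp [pdXi]

lemma E_planckConst : (h.plane ℂ).E (planckConst h ħ) = 0 :=
  (IsParabolicDomain.represents_E (F := fun _ _ => -Complex.I * ħ) fun _ => rfl).ext fun s => by
    simp [pdEta]

variable {F G : ℝ → ℝ → ℂ} {f g : smoothAlg ℂ h.opens}

lemma represents_opP1 (hF : Represents F f) :
    Represents (opP1 ħ F) (opOf ((h.plane ℂ).momentum₁ (planckConst h ħ)) f) := by
  intro s
  rw [← smoothAlg.evalAt_apply, opOf_apply, PlaneDiffRing.momentum₁_apply]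
  simp only [map_mul, map_sub, evalAt_planckConst, IsParabolicDomain.evalAt_x,
    IsParabolicDomain.evalAt_y, IsParabolicDomain.evalAt_r,
    (IsParabolicDomain.represents_D hF).evalAt, (IsParabolicDomain.represents_E hF).evalAt,
    opP1, Complex.coe_algebraMap, div_eq_mul_inv]
  push_cast
  ring

lemma represents_opP2 (hF : Represents F f) :
    Represents (opP2 ħ F) (opOf ((h.plane ℂ).momentum₂ (planckConst h ħ)) f) := by
  intro s
  rw [← smoothAlg.evalAt_apply, opOf_apply, PlaneDiffRing.momentum₂_apply]
  simp only [map_mul, map_add, evalAt_planckConst, IsParabolicDomain.evalAt_x,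
    IsParabolicDomain.evalAt_y, IsParabolicDomain.evalAt_r,
    (IsParabolicDomain.represents_D hF).evalAt, (IsParabolicDomain.represents_E hF).evalAt,
    opP2, Complex.coe_algebraMap, div_eq_mul_inv]
  push_cast
  ring

lemma represents_opL3 (hF : Represents F f) :
    Represents (opL3 ħ F) (opOf ((h.plane ℂ).angularMomentum (planckConst h ħ)) f) := by
  intro s
  rw [← smoothAlg.evalAt_apply, opOf_apply, PlaneDiffRing.angularMomentum_apply]
  simp only [map_mul, map_sub, evalAt_planckConst, IsParabolicDomain.evalAt_x,
    IsParabolicDomain.evalAt_y, AlgHom.commutes,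
    (IsParabolicDomain.represents_D hF).evalAt, (IsParabolicDomain.represents_E hF).evalAt,
    opL3, Complex.coe_algebraMap, div_eq_mul_inv]
  push_cast
  ring

lemma Represents.opMul {V : ℝ → ℝ → ℝ} (hV : Represents (fun ξ η => (V ξ η : ℂ)) g)
    (hF : Represents F f) : Represents (opMul V F) (mulBy g f) := by
  exact fun s => congrArg₂ (· * ·) (hV s) (hF s)

lemma Represents.add (hF : Represents F f) (hG : Represents G g) : Represents (F + G) (f + g) :=
  fun s => congrArg₂ (· + ·) (hF s) (hG s)

lemma Represents.smul (c : ℝ) (hF : Represents F f) : Represents ((c : ℂ) • F) (c • f) :=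
  fun s => (congrArg ((c : ℂ) * ·) (hF s)).trans (Complex.real_smul (x := c) (z := f.1 s)).symm

lemma Represents.sum {ι : Type*} (t : Finset ι) {F : ι → ℝ → ℝ → ℂ} {f : ι → smoothAlg ℂ h.opens}
    (hF : ∀ i, Represents (F i) (f i)) : Represents (∑ i ∈ t, F i) (∑ i ∈ t, f i) := by
  classical
  induction t using Finset.induction_on with
  | empty => exact fun s => rfl
  | insert a t ha ih =>
    rw [Finset.sum_insert ha, Finset.sum_insert ha]
    exact (hF a).add ih

lemma represents_iterate {B : (ℝ → ℝ → ℂ) → ℝ → ℝ → ℂ} {b : Module.End ℝ (smoothAlg ℂ h.opens)}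
    (hB : ∀ F f, Represents F f → Represents (B F) (b f)) (n : ℕ) :
    ∀ F f, Represents F f → Represents (B^[n] F) ((b ^ n) f) := by
  induction n with
  | zero => exact fun F f hF => hF
  | succ n ih =>
    intro F f hF
    rw [Function.iterate_succ_apply', pow_succ']
    exact hB _ _ (ih _ _ hF)

/-- The quantum Hamiltonian as an operator on smooth functions. -/
def quantumH (h : IsParabolicDomain I J) (ħ : ℝ) (v : smoothAlg ℂ h.opens) :
    Module.End ℝ (smoothAlg ℂ h.opens) :=
  let p := opOf ((h.plane ℂ).momentum₁ (planckConst h ħ))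
  let q := opOf ((h.plane ℂ).momentum₂ (planckConst h ħ))
  (1 / 2 : ℝ) • (p * p + q * q) + mulBy v

/-- The third-order integral as an operator on smooth functions. -/
def quantumX (h : IsParabolicDomain I J) (ħ : ℝ) (A : ℕ → ℕ → ℕ → ℝ)
    (g₁ g₂ : smoothAlg ℂ h.opens) : Module.End ℝ (smoothAlg ℂ h.opens) :=
  let p := (h.plane ℂ).momentum₁ (planckConst h ħ)
  let q := (h.plane ℂ).momentum₂ (planckConst h ħ)
  cubicOp A ((h.plane ℂ).angularMomentum (planckConst h ħ)) p q
    + (mulBy g₁ * opOf p + opOf p * mulBy g₁) + (mulBy g₂ * opOf q + opOf q * mulBy g₂)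

lemma represents_opH {V : ℝ → ℝ → ℝ} {v : smoothAlg ℂ h.opens}
    (hV : Represents (fun ξ η => (V ξ η : ℂ)) v) (hF : Represents F f) :
    Represents (opH ħ V F) (quantumH h ħ v f) := by
  have h1 := ((represents_opP1 (ħ := ħ) (represents_opP1 (ħ := ħ) hF)).add
    (represents_opP2 (ħ := ħ) (represents_opP2 (ħ := ħ) hF))).smul (1 / 2)
  push_cast at h1
  exact h1.add (hV.opMul hF)

lemma represents_opX (A : ℕ → ℕ → ℕ → ℝ) {G₁ G₂ : ℝ → ℝ → ℝ} {g₁ g₂ : smoothAlg ℂ h.opens}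
    (h₁ : Represents (fun ξ η => (G₁ ξ η : ℂ)) g₁) (h₂ : Represents (fun ξ η => (G₂ ξ η : ℂ)) g₂)
    (hF : Represents F f) : Represents (opX ħ A G₁ G₂ F) (quantumX h ħ A g₁ g₂ f) := by
  have hp := fun n => represents_iterate (h := h) (fun F f => represents_opP1 (ħ := ħ)) n
  have hq := fun n => represents_iterate (h := h) (fun F f => represents_opP2 (ħ := ħ)) n
  have hl := fun n => represents_iterate (h := h) (fun F f => represents_opL3 (ħ := ħ)) n
  have hs := Represents.sum (Finset.Nat.antidiagonalTuple 3 3) fun t : Fin 3 → ℕ =>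
    ((hl (t 0) _ _ (hp (t 1) _ _ (hq (t 2) _ _ hF))).add
      (hp (t 1) _ _ (hq (t 2) _ _ (hl (t 0) _ _ hF)))).smul (A (t 0) (t 1) (t 2))
  have := (hs.add ((h₁.opMul (represents_opP1 (ħ := ħ) hF)).add
    (represents_opP1 (ħ := ħ) (h₁.opMul hF)))).add ((h₂.opMul (represents_opP2 (ħ := ħ) hF)).add
    (represents_opP2 (ħ := ħ) (h₂.opMul hF)))
  simp only [quantumX, cubicOp, LinearMap.add_apply, LinearMap.sum_apply, LinearMap.smul_apply]
  exact this

lemma quantumH_mul_quantumX {A : ℕ → ℕ → ℕ → ℝ} {V G₁ G₂ : ℝ → ℝ → ℝ}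
    {v g₁ g₂ : smoothAlg ℂ h.opens} (hV : Represents (fun ξ η => (V ξ η : ℂ)) v)
    (h₁ : Represents (fun ξ η => (G₁ ξ η : ℂ)) g₁) (h₂ : Represents (fun ξ η => (G₂ ξ η : ℂ)) g₂)
    (H : QuantumIntegral ħ I J V A G₁ G₂) :
    quantumH h ħ v * quantumX h ħ A g₁ g₂ = quantumX h ħ A g₁ g₂ * quantumH h ħ v := by
  refine LinearMap.ext fun f => Subtype.ext (funext fun s => ?_)
  -- The zero extension of f is an admissible test function: membership in `smoothAlg` is exactly
  -- its smoothness on I × J.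
  have hF : Represents (fun ξ η => extendZero f.1 (ξ, η)) f := fun s => extendZero_apply f.1 s
  have h3 := represents_opH (ħ := ħ) hV (represents_opX (ħ := ħ) A h₁ h₂ hF) s
  have h4 := represents_opX (ħ := ħ) A h₁ h₂ (represents_opH (ħ := ħ) hV hF) s
  exact h3.symm.trans ((H (fun ξ η => extendZero f.1 (ξ, η)) f.2 s.1.1 s.2.1 s.1.2 s.2.2).trans h4)

lemma exists_represents_ofReal (h : IsParabolicDomain I J) {V : ℝ → ℝ → ℝ}
    (hV : SmoothOnRect I J V) : ∃ v : smoothAlg ℂ h.opens, Represents (fun ξ η => (V ξ η : ℂ)) v :=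
  ⟨_, Represents.ofContDiffOn (S := h.opens) (F := fun ξ η => (V ξ η : ℂ))
    (Complex.ofRealCLM.contDiff.comp_contDiffOn hV)⟩

lemma evalAt_D_ofReal {V : ℝ → ℝ → ℝ} (hV : SmoothOnRect I J V) {v : smoothAlg ℂ h.opens}
    (hv : Represents (fun ξ η => (V ξ η : ℂ)) v) (s : h.opens) :
    smoothAlg.evalAt s ((h.plane ℂ).D v) = ((pdXi V s.1.1 s.1.2 : ℝ) : ℂ) := by
  have rV : Represents V _ := Represents.ofContDiffOn (S := h.opens) hV
  have h1 := (rV.hasDerivAt_xi s).ofReal_comp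
  have h2 := rV.pdXi s
  rw [h2, ← h1.deriv]
  exact (IsParabolicDomain.represents_D hv s).symm

lemma evalAt_E_ofReal {V : ℝ → ℝ → ℝ} (hV : SmoothOnRect I J V) {v : smoothAlg ℂ h.opens}
    (hv : Represents (fun ξ η => (V ξ η : ℂ)) v) (s : h.opens) :
    smoothAlg.evalAt s ((h.plane ℂ).E v) = ((pdEta V s.1.1 s.1.2 : ℝ) : ℂ) := by
  have rV : Represents V _ := Represents.ofContDiffOn (S := h.opens) hV
  have h1 := (rV.hasDerivAt_eta s).ofReal_comp
  have h2 := rV.pdEta s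
  rw [h2, ← h1.deriv]
  exact (IsParabolicDomain.represents_E hv s).symm

/-- This is the defining relation of F₁, …, F₄ differentiated at the momentum (α, β) in the
direction (vx, vy). -/
lemma cubicPolar_momenta (A : ℕ → ℕ → ℕ → ℝ) {ξ η : ℝ} (hρ : ξ ^ 2 + η ^ 2 ≠ 0) (k : ℂ)
    (α β : ℝ) (vx vy : ℝ) :
    cubicPolar A (((1 / 2 : ℝ) : ℂ) * k * (ξ * β - η * α)) (k * ((ξ ^ 2 + η ^ 2)⁻¹ : ℝ) * (ξ * α - η * β))
      (k * ((ξ ^ 2 + η ^ 2)⁻¹ : ℝ) * (η * α + ξ * β)) (((1 / 2 : ℝ) : ℂ) * k * (ξ * vy - η * vx))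
      (k * ((ξ ^ 2 + η ^ 2)⁻¹ : ℝ) * (ξ * vx - η * vy))
      (k * ((ξ ^ 2 + η ^ 2)⁻¹ : ℝ) * (η * vx + ξ * vy))
    = k ^ 3 * (((ξ ^ 2 + η ^ 2)⁻¹ ^ 3 * (3 * polyF1 A ξ η * α ^ 2 * vx
      + polyF2 A ξ η * (2 * α * β * vx + α ^ 2 * vy) + polyF3 A ξ η * (β ^ 2 * vx + 2 * α * β * vy)
      + 3 * polyF4 A ξ η * β ^ 2 * vy) : ℝ) : ℂ) := by
  have hc : (ξ : ℂ) ^ 2 + (η : ℂ) ^ 2 ≠ 0 := by exact_mod_cast hρ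
  simp only [cubicPolar, polyF1, polyF2, polyF3, polyF4, Complex.coe_algebraMap]
  push_cast
  field_simp
  ring

lemma determiningEquations_of_quantumIntegral (hħ : 0 < ħ) {A : ℕ → ℕ → ℕ → ℝ}
    {V G₁ G₂ : ℝ → ℝ → ℝ} (hV : SmoothOnRect I J V) (hG₁ : SmoothOnRect I J G₁)
    (hG₂ : SmoothOnRect I J G₂) (H : QuantumIntegral ħ I J V A G₁ G₂) (s : h.opens) :
    DeterminingEquations A V G₁ G₂ s.1.1 s.1.2 := by
  obtain ⟨v, hv⟩ := exists_represents_ofReal h hV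
  obtain ⟨g₁, h₁⟩ := exists_represents_ofReal h hG₁
  obtain ⟨g₂, h₂⟩ := exists_represents_ofReal h hG₂
  have hk : (-Complex.I * ħ : ℂ) ≠ 0 := by
    simp [hħ.ne']
  have hρ := IsParabolicDomain.rho_ne_zero (h := h) s
  set ξ := s.1.1 with hξ
  set η := s.1.2 with hη
  -- The test function h = αξ + ηβ has dh = (α, β), so this is an identity of quadratic forms in (α,
  -- β). Its values at (1,0), (0,1), (1,1) give the three equations.
  have key : ∀ α β : ℝ,
      α ^ 2 * (ξ * pdXi G₁ ξ η + η * pdXi G₂ ξ η)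
        + α * β * (ξ * pdXi G₂ ξ η - η * pdXi G₁ ξ η + ξ * pdEta G₁ ξ η + η * pdEta G₂ ξ η)
        + β ^ 2 * (ξ * pdEta G₂ ξ η - η * pdEta G₁ ξ η)
      = (ξ ^ 2 + η ^ 2)⁻¹ * (3 * polyF1 A ξ η * α ^ 2 * pdXi V ξ η
        + polyF2 A ξ η * (2 * α * β * pdXi V ξ η + α ^ 2 * pdEta V ξ η)
        + polyF3 A ξ η * (β ^ 2 * pdXi V ξ η + 2 * α * β * pdEta V ξ η)
        + 3 * polyF4 A ξ η * β ^ 2 * pdEta V ξ η) := by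
    intro α β
    have e := congrArg (smoothAlg.evalAt s) (doubleComm_commutator A
      (algebraMap ℝ _ α * (h.plane ℂ).x + algebraMap ℝ _ β * (h.plane ℂ).y) v g₁ g₂
      ((h.plane ℂ).angularMomentum (planckConst h ħ)) ((h.plane ℂ).momentum₁ (planckConst h ħ))
      ((h.plane ℂ).momentum₂ (planckConst h ħ))
      ((h.plane ℂ).momentum_comm D_planckConst E_planckConst)
      ((h.plane ℂ).momentum_sq_commute_angularMomentum D_planckConst E_planckConst)
      (quantumX h ħ A g₁ g₂) (quantumH h ħ v) rfl rfl (quantumH_mul_quantumX hv h₁ h₂ H))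
    have hD : (h.plane ℂ).D (algebraMap ℝ _ α * (h.plane ℂ).x + algebraMap ℝ _ β * (h.plane ℂ).y)
        = algebraMap ℝ _ α := by
      simp [(h.plane ℂ).D_x, (h.plane ℂ).D_y]
    have hE : (h.plane ℂ).E (algebraMap ℝ _ α * (h.plane ℂ).x + algebraMap ℝ _ β * (h.plane ℂ).y)
        = algebraMap ℝ _ β := by
      simp [(h.plane ℂ).E_x, (h.plane ℂ).E_y]
    have hc : ∀ l p q l' p' q' : smoothAlg ℂ h.opens, smoothAlg.evalAt s (cubicPolar A l p q l' p' q')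
        = cubicPolar A (smoothAlg.evalAt s l) (smoothAlg.evalAt s p) (smoothAlg.evalAt s q)
          (smoothAlg.evalAt s l') (smoothAlg.evalAt s p') (smoothAlg.evalAt s q') := by
      intros
      simp only [cubicPolar, map_add, map_mul, map_pow, map_ofNat, AlgHom.commutes]
    rw [hc] at e
    simp only [PlaneDiffRing.momentum₁_apply, PlaneDiffRing.momentum₂_apply,
      PlaneDiffRing.angularMomentum_apply, hD, hE] at e
    simp only [map_add, map_sub, map_mul, AlgHom.commutes,
      evalAt_planckConst, IsParabolicDomain.evalAt_x, IsParabolicDomain.evalAt_y,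
      IsParabolicDomain.evalAt_r, evalAt_D_ofReal hV hv, evalAt_E_ofReal hV hv,
      evalAt_D_ofReal hG₁ h₁, evalAt_E_ofReal hG₁ h₁, evalAt_D_ofReal hG₂ h₂,
      evalAt_E_ofReal hG₂ h₂, Complex.coe_algebraMap] at e
    simp only [← hξ, ← hη] at e
    rw [cubicPolar_momenta A hρ (-Complex.I * ħ) α β (pdXi V ξ η) (pdEta V ξ η)] at e
    have hc : (ξ : ℂ) ^ 2 + (η : ℂ) ^ 2 ≠ 0 := by exact_mod_cast hρ
    generalize -Complex.I * (ħ : ℂ) = k at e hk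
    have e2 : k ^ 3 * (((ξ ^ 2 + η ^ 2)⁻¹ ^ 2 *
        (α ^ 2 * (ξ * pdXi G₁ ξ η + η * pdXi G₂ ξ η)
        + α * β * (ξ * pdXi G₂ ξ η - η * pdXi G₁ ξ η + ξ * pdEta G₁ ξ η + η * pdEta G₂ ξ η)
        + β ^ 2 * (ξ * pdEta G₂ ξ η - η * pdEta G₁ ξ η)) : ℝ) : ℂ) = _ :=
      Eq.trans (by push_cast; field_simp; ring) e
    have e3 := Complex.ofReal_injective (mul_left_cancel₀ (pow_ne_zero 3 hk) e2)
    refine mul_left_cancel₀ (pow_ne_zero 2 (inv_ne_zero hρ)) (e3.trans ?_)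
    ring
  have k1 := key 1 0
  have k2 := key 0 1
  have k3 := key 1 1
  refine ⟨?_, ?_, ?_⟩
  · linear_combination k1
  · linear_combination k2
  · linear_combination k3 - k1 - k2

end Quantum
end

noncomputable section

/-! ### Analytic continuation of linear differential equations -/

open Filter Topology Set

lemma HasDerivAt.of_ofReal {f : ℝ → ℝ} {c : ℂ} {x : ℝ} (h : HasDerivAt (fun t => (f t : ℂ)) c x) :
    ((_root_.deriv f x : ℝ) : ℂ) = c := by
  have h1 : HasDerivAt f c.re x := by
    simpa using! (Complex.reCLM.hasFDerivAt.comp_hasDerivAt x h)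
  rw [h1.deriv]
  exact h1.ofReal_comp.unique h

lemma AnalyticAt.iteratedDeriv_complex {v : ℂ → ℂ} {z : ℂ} (hv : AnalyticAt ℂ v z) (k : ℕ) :
    AnalyticAt ℂ (iteratedDeriv k v) z := by
  rw [iteratedDeriv_eq_iterate]
  exact hv.iterated_deriv k

lemma iteratedDeriv_ofReal_comp_affine {W : ℝ → ℝ} {v : ℂ → ℂ} {a b : ℂ} {K : Set ℝ} (hK : IsOpen K)
    (hv : ∀ x ∈ K, AnalyticAt ℂ v (a * x + b)) (hW : ∀ x ∈ K, (W x : ℂ) = v (a * x + b)) (k : ℕ) :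
    ∀ x ∈ K, ((iteratedDeriv k W x : ℝ) : ℂ) = a ^ k * iteratedDeriv k v (a * x + b) := by
  induction k with
  | zero => simpa using hW
  | succ k ih =>
    intro x hx
    rw [iteratedDeriv_succ, iteratedDeriv_succ]
    refine HasDerivAt.of_ofReal ?_
    have h1 : HasDerivAt (fun z : ℂ => a * z + b) a (x : ℂ) := by
      simpa using ((hasDerivAt_id (x : ℂ)).const_mul a).add_const b
    have h2 := (((hv x hx).iteratedDeriv_complex k).differentiableAt.hasDerivAt.comp (x : ℂ)
      h1).const_mul (a ^ k)
    have h3 := h2.comp_ofReal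
    refine (h3.congr_of_eventuallyEq ?_).congr_deriv (by ring)
    filter_upwards [hK.mem_nhds hx] with y hy
    exact ih y hy

/-- Identity theorem: the image of K under a nonconstant affine map has an accumulation point in Ω.
-/
lemma eqOn_zero_of_affine {f : ℂ → ℂ} {Ω : Set ℂ} (hf : AnalyticOnNhd ℂ f Ω)
    (hΩ : IsPreconnected Ω) {a b : ℂ} (ha : a ≠ 0) {K : Set ℝ} (hK : IsOpen K) (hne : K.Nonempty)
    (hKΩ : ∀ x ∈ K, a * x + b ∈ Ω) (h0 : ∀ x ∈ K, f (a * x + b) = 0) : ∀ z ∈ Ω, f z = 0 := by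
  obtain ⟨x₀, hx₀⟩ := hne
  refine hf.eqOn_zero_of_preconnected_of_frequently_eq_zero hΩ (hKΩ x₀ hx₀) ?_
  have ht : Tendsto (fun x : ℝ => a * x + b) (𝓝[≠] x₀) (𝓝[≠] (a * x₀ + b)) := by
    refine tendsto_nhdsWithin_of_tendsto_nhds_of_eventually_within _ ?_ ?_
    · exact (Continuous.tendsto (by fun_prop) x₀).mono_left nhdsWithin_le_nhds
    · filter_upwards [self_mem_nhdsWithin] with x hx h
      exact hx (by simpa [ha] using h)
  refine ht.frequently (Eventually.frequently ?_)
  filter_upwards [nhdsWithin_le_nhds (hK.mem_nhds hx₀)] with x hx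
  exact h0 x hx

lemma Polynomial.analyticAt_eval (p : ℂ[X]) (z : ℂ) : AnalyticAt ℂ (fun z => p.eval z) z := by
  simpa using AnalyticAt.aeval_polynomial (analyticAt_id (𝕜 := ℂ) (z := z)) p

/-- A holomorphic continuation of a solution of a nontrivial linear system satisfies a nontrivial
linear differential equation with polynomial coefficients. -/
lemma LinearODESystem.IsSolution.exists_complex {S : LinearODESystem} (hS : S ≠ 0) {I : Set ℝ}
    {W : ℝ → ℝ} (hsol : S.IsSolution I W) {a b : ℂ} (ha : a ≠ 0) :
    ∃ c : Fin 18 → ℂ[X], c ≠ 0 ∧ ∀ (K : Set ℝ) (Ω : Set ℂ) (v : ℂ → ℂ), K ⊆ I → IsOpen K →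
      K.Nonempty → IsPreconnected Ω → AnalyticOnNhd ℂ v Ω →
      (∀ x ∈ K, a * x + b ∈ Ω ∧ (W x : ℂ) = v (a * x + b)) →
      ∀ z ∈ Ω, ∑ k : Fin 18, (c k).eval z * iteratedDeriv (k : ℕ) v z = 0 := by
  obtain ⟨m, hm⟩ := Function.ne_iff.mp hS
  obtain ⟨k, hk⟩ := Function.ne_iff.mp hm
  let T : ℂ[X] := Polynomial.C a⁻¹ * (Polynomial.X - Polynomial.C b)
  have hT : T.natDegree = 1 := by
    rw [Polynomial.natDegree_C_mul (inv_ne_zero ha), Polynomial.natDegree_X_sub_C]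
  -- T inverts x ↦ ax + b, and the powers of a come from the chain rule W⁽ᵏ⁾(x) = aᵏ v⁽ᵏ⁾(ax + b).
  refine ⟨fun k => Polynomial.C (a ^ (k : ℕ)) * ((S m k).map Complex.ofRealHom).comp T, ?_, ?_⟩
  · refine Function.ne_iff.mpr ⟨k, mul_ne_zero (Polynomial.C_ne_zero.mpr (pow_ne_zero _ ha)) fun h0 => hk ?_⟩
    rcases Polynomial.comp_eq_zero_iff.mp h0 with h | h
    · exact (Polynomial.map_eq_zero_iff Complex.ofReal_injective).mp h
    · rw [h.2] at hT
      simp at hT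
  · intro K Ω v hKI hK hne hΩ hv hKW
    refine eqOn_zero_of_affine (fun z hz => ?_) hΩ ha hK hne (fun x hx => (hKW x hx).1) ?_
    · refine Finset.analyticAt_fun_sum _ fun k _ => ?_
      exact (Polynomial.analyticAt_eval _ z).mul ((hv z hz).iteratedDeriv_complex k)
    · intro x hx
      have hTx : T.eval (a * x + b) = x := by
        simp [T, ha]
      have h1 := congrArg (fun t : ℝ => (t : ℂ)) (hsol x (hKI hx) m)
      simp only [Complex.ofReal_sum, Complex.ofReal_mul, Complex.ofReal_zero] at h1
      rw [← h1]
      refine Finset.sum_congr rfl fun k _ => ?_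
      rw [iteratedDeriv_ofReal_comp_affine hK (fun x hx => hv _ (hKW x hx).1)
        (fun x hx => (hKW x hx).2) k x hx]
      rw [Polynomial.eval_mul, Polynomial.eval_C, Polynomial.eval_comp, hTx]
      have : ((S m k).map Complex.ofRealHom).eval (x : ℂ) = ((S m k).eval x : ℝ) :=
        Polynomial.eval_map_apply Complex.ofRealHom x
      rw [this]
      ring

/-! ### Painlevé transcendents -/

lemma IsReducibleOn.polynomial {U : Set ℂ} (p : ℂ[X]) : IsReducibleOn U fun z => p.eval z := by
  induction p using Polynomial.induction_on' with
  | add p q hp hq => simpa using! hp.sum _ _ hq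
  | monomial n c =>
    simp only [Polynomial.eval_monomial]
    refine (IsReducibleOn.const c).prod _ _ ?_
    induction n with
    | zero => simpa using! IsReducibleOn.const 1
    | succ n ih => simpa [pow_succ] using! ih.prod _ _ IsReducibleOn.ident

/-- The coefficient of `X₁ⁱ X₂ʲ` as a polynomial in `X₀`. -/
def MvPolynomial.coeffLastTwo (P : MvPolynomial (Fin 3) ℂ) (i j : ℕ) : ℂ[X] :=
  ∑ d ∈ P.support, if d 1 = i ∧ d 2 = j then Polynomial.monomial (d 0) (P.coeff d) else 0

lemma MvPolynomial.eq_sum_coeffLastTwo {P : MvPolynomial (Fin 3) ℂ} {n : ℕ}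
    (hn : P.totalDegree < n) :
    P = ∑ i : Fin n, ∑ j : Fin n, Polynomial.aeval (MvPolynomial.X (0 : Fin 3))
      (P.coeffLastTwo i j) * MvPolynomial.X 1 ^ (i : ℕ) * MvPolynomial.X 2 ^ (j : ℕ) := by
  have key : ∀ d ∈ P.support, (∑ i : Fin n, ∑ j : Fin n, Polynomial.aeval
      (MvPolynomial.X (0 : Fin 3) : MvPolynomial (Fin 3) ℂ)
      (if d 1 = i ∧ d 2 = j then Polynomial.monomial (d 0) (P.coeff d) else 0)
      * MvPolynomial.X 1 ^ (i : ℕ) * MvPolynomial.X 2 ^ (j : ℕ))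
      = MvPolynomial.monomial d (P.coeff d) := by
    intro d hd
    have hle : ∀ i, d i < n := fun i =>
      ((Finsupp.le_degree i d).trans (MvPolynomial.le_totalDegree hd)).trans_lt hn
    rw [Finset.sum_eq_single ⟨d 1, hle 1⟩, Finset.sum_eq_single ⟨d 2, hle 2⟩]
    · rw [MvPolynomial.monomial_eq, Finsupp.prod_fintype _ _ (by simp), Fin.prod_univ_three]
      simp [Polynomial.aeval_monomial, MvPolynomial.algebraMap_eq, mul_assoc]
    · intro j _ hj
      have : d 2 ≠ j := fun h => hj (Fin.ext h.symm)
      simp [this]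
    · simp
    · intro i _ hi
      have : d 1 ≠ i := fun h => hi (Fin.ext h.symm)
      simp [this]
    · simp
  conv_lhs => rw [P.as_sum, ← Finset.sum_congr rfl key]
  simp only [MvPolynomial.coeffLastTwo, map_sum, Finset.sum_mul]
  rw [Finset.sum_comm]
  refine Finset.sum_congr rfl fun i _ => Finset.sum_comm

lemma MvPolynomial.eval_eq_sum_coeffLastTwo {P : MvPolynomial (Fin 3) ℂ} {n : ℕ}
    (hn : P.totalDegree < n) (x y z : ℂ) :
    MvPolynomial.eval ![x, y, z] P = ∑ i : Fin n, ∑ j : Fin n,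
      (P.coeffLastTwo i j).eval x * y ^ (i : ℕ) * z ^ (j : ℕ) := by
  conv_lhs => rw [MvPolynomial.eq_sum_coeffLastTwo hn]
  have key : ∀ p : ℂ[X], MvPolynomial.eval ![x, y, z]
      (Polynomial.aeval (MvPolynomial.X (0 : Fin 3)) p) = p.eval x := fun p => by
    induction p using Polynomial.induction_on' with
    | add p q hp hq => simp [hp, hq]
    | monomial n c => simp [Polynomial.aeval_monomial, MvPolynomial.algebraMap_eq]
  simp [map_sum, key]

/-- Put v = P/Q along (T z, w, w'). It solves a linear equation, so it is reducible. Then P − vQ = 0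
is an algebraic equation in w, w' with reducible coefficients, and irreducibility of w makes every
coefficient vanish. -/
lemma noPainleveDependence {S : LinearODESystem} (hS : S ≠ 0) {I : Set ℝ}
    {W : ℝ → ℝ} (hsol : S.IsSolution I W) : NoPainleveDependence I W := by
  rintro K hKI hK ⟨x₀, hx₀⟩ U w a b P Q ⟨hU, -, hw, hirr⟩ ha hKW
  obtain ⟨c, hc, hode⟩ := hsol.exists_complex hS (b := b) ha
  have hwU : ∀ z ∈ U, AnalyticAt ℂ w z := fun z hz => hw.1.analyticAt (hU.mem_nhds hz)
  set T : ℂ → ℂ := fun z => a⁻¹ * (z - b) with hT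
  have hTx : ∀ x : ℂ, T (a * x + b) = x := fun x => by simp [T, ha]
  set ev : MvPolynomial (Fin 3) ℂ → ℂ → ℂ :=
    fun P z => MvPolynomial.eval ![T z, w z, deriv w z] P with hev
  have hevA : ∀ P, ∀ z ∈ U, AnalyticAt ℂ (ev P) z := by
    intro P z hz
    have := AnalyticAt.aeval_mvPolynomial (𝕜 := ℂ) (z := z)
      (f := fun z => ![T z, w z, deriv w z]) (fun i => ?_) P
    · simpa [MvPolynomial.aeval_eq_eval] using! this
    · fin_cases i
      · exact analyticAt_const.mul (analyticAt_id.sub analyticAt_const)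
      · exact hwU z hz
      · exact (hwU z hz).deriv
  obtain ⟨h1, h2, -⟩ := hKW x₀ hx₀
  -- On a small disc Q has no zero and v is holomorphic; this disc is the subdomain tested against
  -- irreducibility.
  have hQ0 : ∀ᶠ z in 𝓝 (a * x₀ + b : ℂ), z ∈ U ∧ ev Q z ≠ 0 :=
    (hU.eventually_mem h1).and ((hevA Q _ h1).continuousAt.eventually_ne (by simpa [hev, hTx] using h2))
  obtain ⟨ε, hε, hball⟩ := Metric.eventually_nhds_iff_ball.mp hQ0
  set V := Metric.ball (a * x₀ + b : ℂ) ε with hV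
  set v : ℂ → ℂ := fun z => ev P z / ev Q z with hv
  have hVc : IsConnected V := (convex_ball _ _).isConnected (Metric.nonempty_ball.mpr hε)
  have hVo : IsOpen V := Metric.isOpen_ball
  have hvA : AnalyticOnNhd ℂ v V := fun z hz =>
    (hevA P z (hball z hz).1).div (hevA Q z (hball z hz).1) (hball z hz).2
  have hVinf : V.Infinite := infinite_of_mem_nhds _ (hVo.mem_nhds (Metric.mem_ball_self hε))
  have hlin := hode (K ∩ (fun x : ℝ => a * x + b) ⁻¹' V) V v (inter_subset_left.trans hKI)
    (hK.inter (hVo.preimage (by fun_prop))) ⟨x₀, hx₀, Metric.mem_ball_self hε⟩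
    hVc.isPreconnected hvA fun x hx => ⟨hx.2, by
      rw [(hKW x hx.1).2.2]; simp only [hv, hev, hTx]⟩
  have hvred : IsReducibleOn V v := by
    refine .linearODE 18 (fun k z => (c k).eval z) (fun _ => 0) v
      (fun k => .polynomial _) (.const 0) ?_ (fun z hz => (hvA z hz).differentiableWithinAt) hlin
    by_contra! hcon
    exact hc (funext fun k => Polynomial.eq_zero_of_infinite_isRoot _
      (hVinf.mono fun z hz => hcon k z hz))
  set n := max P.totalDegree Q.totalDegree + 1 with hn
  have hPn : P.totalDegree < n := by omega
  have hQn : Q.totalDegree < n := by omega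
  have hTred : ∀ p : ℂ[X], IsReducibleOn V fun z => p.eval (T z) := fun p => by
    have h3 : (fun z => p.eval (T z)) = fun z =>
        (p.comp (Polynomial.C a⁻¹ * (Polynomial.X - Polynomial.C b))).eval z := by
      funext z
      rw [Polynomial.eval_comp, Polynomial.eval_mul, Polynomial.eval_C, Polynomial.eval_sub,
        Polynomial.eval_X, Polynomial.eval_C]
    rw [h3]
    exact .polynomial _
  have hzero : ∀ i j : Fin n, ∀ z ∈ V,
      (P.coeffLastTwo i j).eval (T z) = v z * (Q.coeffLastTwo i j).eval (T z) := by
    by_contra! hcon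
    obtain ⟨i, j, z, hz, hne⟩ := hcon
    refine hirr V (fun z hz => (hball z hz).1) hVo hVc (.firstOrderODE n
      (fun i j z => (P.coeffLastTwo i j).eval (T z)
        + -1 * (v z * (Q.coeffLastTwo i j).eval (T z))) w (fun i j => ?_)
      ⟨i, j, z, hz, fun h => hne (by linear_combination h)⟩
      (fun z hz => (hwU z (hball z hz).1).differentiableAt.differentiableWithinAt) fun z hz => ?_)
    · exact (hTred _).sum _ _ ((IsReducibleOn.const (-1)).prod _ _ (hvred.prod _ _ (hTred _)))
    · have h3 : ev P z - v z * ev Q z = 0 := by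
        rw [hv]; field_simp [(hball z hz).2]; ring
      simp only [hev, MvPolynomial.eval_eq_sum_coeffLastTwo hPn,
        MvPolynomial.eval_eq_sum_coeffLastTwo hQn, Finset.mul_sum, ← Finset.sum_sub_distrib] at h3
      rw [← h3]
      refine Finset.sum_congr rfl fun i _ => Finset.sum_congr rfl fun j _ => by ring
  have hQne : ∃ i j : Fin n, Q.coeffLastTwo i j ≠ 0 := by
    by_contra! hcon
    refine (hball _ (Metric.mem_ball_self hε)).2 ?_
    simp [hev, MvPolynomial.eval_eq_sum_coeffLastTwo hQn, hcon]
  obtain ⟨i₀, j₀, hne⟩ := hQne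
  refine ⟨P.coeffLastTwo i₀ j₀, Q.coeffLastTwo i₀ j₀, hne, ?_⟩
  have hTinj : Function.Injective T := fun x y hxy => by simpa [T, ha] using hxy
  -- All pairs of coefficients have the same quotient v. Cross-multiplying with one nonzero
  -- coefficient of Q eliminates it.
  have hcoef : ∀ i j : Fin n, Q.coeffLastTwo i₀ j₀ * P.coeffLastTwo i j
      = P.coeffLastTwo i₀ j₀ * Q.coeffLastTwo i j := by
    intro i j
    refine Polynomial.eq_of_infinite_eval_eq _ _
      ((hVinf.image hTinj.injOn).mono ?_)
    rintro _ ⟨z, hz, rfl⟩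
    simp only [mem_ofPred_eq, Polynomial.eval_mul, hzero i j z hz, hzero i₀ j₀ z hz]
    ring
  conv_lhs => rw [MvPolynomial.eq_sum_coeffLastTwo hPn]
  conv_rhs => rw [MvPolynomial.eq_sum_coeffLastTwo hQn]
  simp only [Finset.mul_sum, ← mul_assoc, ← map_mul, hcoef]

end

noncomputable section

/-! ### Elliptic functions -/

open Filter Topology Set

lemma meromorphicOrderAt_iteratedDeriv {u : ℂ → ℂ} {z₀ : ℂ} {m : ℤ} (hm : m < 0)
    (hu : meromorphicOrderAt u z₀ = m) (k : ℕ) :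
    meromorphicOrderAt (iteratedDeriv k u) z₀ = ((m - k : ℤ) : WithTop ℤ) := by
  induction k with
  | zero => simpa using hu
  | succ k ih =>
    rw [iteratedDeriv_succ, meromorphicOrderAt_deriv_eq_sub_one (n := m - k) _ ih]
    · rw [Nat.cast_succ, sub_sub]
    · exact_mod_cast (by omega : m - k ≠ 0)

lemma meromorphicOrderAt_fun_sum_gt {ι : Type*} (s : Finset ι) {f : ι → ℂ → ℂ} {z₀ : ℂ} {M : ℤ}
    (hf : ∀ i ∈ s, MeromorphicAt (f i) z₀)
    (hM : ∀ i ∈ s, (M : WithTop ℤ) < meromorphicOrderAt (f i) z₀) :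
    (M : WithTop ℤ) < meromorphicOrderAt (∑ i ∈ s, f i) z₀ := by
  classical
  induction s using Finset.induction_on with
  | empty =>
    simp
  | insert a s ha ih =>
    rw [Finset.sum_insert ha]
    refine (lt_min (hM a (by simp)) (ih (fun i hi => hf i (by simp [hi]))
      fun i hi => hM i (by simp [hi]))).trans_le (meromorphicOrderAt_add (hf a (by simp)) ?_)
    exact MeromorphicAt.sum fun i hi => hf i (by simp [hi])

/-- A meromorphic solution of a linear differential equation has no pole where the leading
coefficient does not vanish. -/
lemma meromorphicOrderAt_nonneg_of_linearODE {n : ℕ} {c : Fin n → ℂ[X]} {N : Fin n} {z₀ : ℂ}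
    (hN : (c N).eval z₀ ≠ 0) (htop : ∀ k, N < k → c k = 0) {u : ℂ → ℂ} (hu : MeromorphicAt u z₀)
    (hode : ∀ᶠ z in 𝓝[≠] z₀, ∑ k : Fin n, (c k).eval z * iteratedDeriv (k : ℕ) u z = 0) :
    0 ≤ meromorphicOrderAt u z₀ := by
  by_contra! hneg
  obtain ⟨m, hm⟩ := WithTop.ne_top_iff_exists.mp (hneg.trans (WithTop.coe_lt_top (0 : ℤ))).ne
  have hm0 : m < 0 := by rw [← hm] at hneg; exact_mod_cast hneg
  have hord := meromorphicOrderAt_iteratedDeriv hm0 hm.symm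
  set f : Fin n → ℂ → ℂ := fun k => (fun z => (c k).eval z) * iteratedDeriv (k : ℕ) u with hf
  have hmer : ∀ k, MeromorphicAt (f k) z₀ := fun k => by
    refine (Polynomial.analyticAt_eval _ _).meromorphicAt.mul ?_
    rw [iteratedDeriv_eq_iterate]
    exact hu.iterated_deriv
  have hN' : meromorphicOrderAt (f N) z₀ = ((m - N : ℤ) : WithTop ℤ) := by
    rw [hf, meromorphicOrderAt_mul_of_ne_zero (Polynomial.analyticAt_eval _ _) hN, hord]
  -- The N-th term has the strictly worst pole: lower derivatives have milder ones, polynomial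
  -- factors only raise the order, and the terms above N are zero.
  have hrest : ((m - N : ℤ) : WithTop ℤ)
      < meromorphicOrderAt (∑ k ∈ Finset.univ.erase N, f k) z₀ := by
    refine meromorphicOrderAt_fun_sum_gt _ (fun k _ => hmer k) fun k hk => ?_
    rcases lt_or_gt_of_ne (Finset.ne_of_mem_erase hk) with h | h
    · have h1 : meromorphicOrderAt (f k) z₀ = meromorphicOrderAt (fun z => (c k).eval z) z₀
          + ((m - k : ℤ) : WithTop ℤ) := by
        rw [← hord k]
        refine meromorphicOrderAt_mul (Polynomial.analyticAt_eval _ _).meromorphicAt ?_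
        rw [iteratedDeriv_eq_iterate]
        exact hu.iterated_deriv
      have h2 := (Polynomial.analyticAt_eval (c k) z₀).meromorphicOrderAt_nonneg
      rw [h1]
      have h3 : ((m - N : ℤ) : WithTop ℤ) < ((m - k : ℤ) : WithTop ℤ) := by
        have : (k : ℕ) < N := h
        exact_mod_cast (by omega : m - (N : ℕ) < m - (k : ℕ))
      exact h3.trans_le (le_add_of_nonneg_left h2)
    · have : meromorphicOrderAt (f k) z₀ = ⊤ := by
        rw [meromorphicOrderAt_eq_top_iff]
        exact Eventually.of_forall fun z => by simp [hf, htop k h]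
      rw [this]
      exact WithTop.coe_lt_top _
  have hsum : meromorphicOrderAt (f N + ∑ k ∈ Finset.univ.erase N, f k) z₀
      = ((m - N : ℤ) : WithTop ℤ) := by
    rw [meromorphicOrderAt_add_eq_left_of_lt (MeromorphicAt.sum fun k _ => hmer k) (by rwa [hN']),
      hN']
  rw [Finset.add_sum_erase _ _ (Finset.mem_univ N), meromorphicOrderAt_eq_top_iff.mpr] at hsum
  · exact WithTop.coe_ne_top hsum.symm
  · filter_upwards [hode] with z hz
    simpa [hf] using hz

lemma AnalyticAt.matrix_det {n : ℕ} {M : ℂ → Matrix (Fin n) (Fin n) ℂ} {z₀ : ℂ}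
    (h : ∀ i j, AnalyticAt ℂ (fun z => M z i j) z₀) : AnalyticAt ℂ (fun z => (M z).det) z₀ := by
  simp only [Matrix.det_apply']
  exact Finset.analyticAt_fun_sum _ fun σ _ =>
    analyticAt_const.mul (Finset.analyticAt_fun_prod _ fun i _ => h _ _)

/-- Coefficients are recovered from sufficiently many translates without introducing poles. -/
lemma meromorphicOrderAt_nonneg_of_translates {n : ℕ} {e : Fin n → ℂ → ℂ} {z₀ : ℂ}
    (he : ∀ k, MeromorphicAt (e k) z₀) {l : Fin n → ℂ} (hl : Function.Injective l)
    (hg : ∀ i, 0 ≤ meromorphicOrderAt (fun z => ∑ k : Fin n, e k z * (z + l i) ^ (k : ℕ)) z₀)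
    (k : Fin n) : 0 ≤ meromorphicOrderAt (e k) z₀ := by
  have hmer : ∀ i, MeromorphicAt (fun z => ∑ k : Fin n, e k z * (z + l i) ^ (k : ℕ)) z₀ := fun i =>
    MeromorphicAt.fun_sum fun k _ => (he k).mul (by fun_prop)
  choose g hgA hge using fun i => (hmer i).meromorphicOrderAt_nonneg_iff.mp (hg i)
  -- The translates are the image of (eₖ) under a Vandermonde matrix whose determinant never
  -- vanishes. Cramer's rule writes eₖ as a quotient of analytic functions.
  let M : ℂ → Matrix (Fin n) (Fin n) ℂ := fun z => Matrix.vandermonde fun i => z + l i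
  have hM : ∀ i j, AnalyticAt ℂ (fun z => M z i j) z₀ := fun i j => by
    simp only [M, Matrix.vandermonde_apply]
    fun_prop
  have hdet : ∀ z, (M z).det ≠ 0 := fun z =>
    Matrix.det_vandermonde_ne_zero_iff.mpr fun i j hij => hl (add_left_cancel hij)
  refine (he k).meromorphicOrderAt_nonneg_iff.mpr
    ⟨fun z => ((M z).updateCol k fun i => g i z).det / (M z).det, ?_, ?_⟩
  · refine (AnalyticAt.matrix_det fun i j => ?_).div (AnalyticAt.matrix_det hM) (hdet z₀)
    simp only [Matrix.updateCol_apply]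
    split_ifs
    · exact hgA i
    · exact hM i j
  · filter_upwards [eventually_all.mpr hge] with z hz
    have h1 : (M z).mulVec (fun k => e k z) = fun i => g i z := by
      funext i
      rw [← hz i]
      simp [M, Matrix.mulVec, dotProduct, Matrix.vandermonde_apply, mul_comm]
    rw [← h1, ← Matrix.cramer_apply, Matrix.cramer_eq_adjugate_mulVec, Matrix.mulVec_mulVec,
      Matrix.adjugate_mul, Matrix.smul_mulVec, Matrix.one_mulVec, Pi.smul_apply, smul_eq_mul,
      mul_div_cancel_left₀ _ (hdet z)]

/-- An elliptic function without poles is constant. -/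
lemma IsElliptic.exists_eq_const {L : PeriodPair} {f : ℂ → ℂ} (hf : IsElliptic L f)
    (hord : ∀ z, 0 ≤ meromorphicOrderAt f z) : ∃ c, ∀ z, AnalyticAt ℂ f z → f z = c := by
  have hmer : MeromorphicOn f univ := hf.1.meromorphicOn
  -- The normal form discards arbitrary values of f at removable singularities. With no poles F is
  -- entire, and it inherits the periods by continuity.
  set F := toMeromorphicNFOn f univ with hF
  have hFf : ∀ z, F =ᶠ[𝓝[≠] z] f := fun z => hmer.toMeromorphicNFOn_eq_self_on_nhdsNE (mem_univ z)
  have hFA : ∀ z, AnalyticAt ℂ F z := fun z =>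
    (meromorphicNFOn_toMeromorphicNFOn f univ (mem_univ z)).meromorphicOrderAt_nonneg_iff_analyticAt.mp
      ((hord z).trans_eq (meromorphicOrderAt_congr (hFf z)).symm)
  have heq : ∀ {g : ℂ → ℂ} {z : ℂ}, AnalyticAt ℂ g z → F =ᶠ[𝓝[≠] z] g → F z = g z :=
    fun {g z} hg h => ((ContinuousAt.eventuallyEq_nhds_iff_eventuallyEq_nhdsNE
      (hFA z).continuousAt hg.continuousAt).mp h).eq_of_nhds
  have hper : ∀ l ∈ L.lattice, ∀ z, F (z + l) = F z := by
    intro l hl z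
    refine (heq (g := fun z => F (z + l)) ((hFA (z + l)).comp_of_eq (by fun_prop) rfl) ?_).symm
    have ht : Tendsto (fun w => w + l) (𝓝[≠] z) (𝓝[≠] (z + l)) := by
      refine tendsto_nhdsWithin_of_tendsto_nhds_of_eventually_within _
        ((Continuous.tendsto (by fun_prop) z).mono_left nhdsWithin_le_nhds) ?_
      filter_upwards [self_mem_nhdsWithin] with w hw h
      exact hw (add_right_cancel h)
    filter_upwards [hFf z, ht.eventually (hFf (z + l))] with w h1 h2
    rw [h1, h2, hf.2 l hl]
  have hFd : Differentiable ℂ F := fun z => (hFA z).differentiableAt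
  have hbdd : Bornology.IsBounded (range F) := by
    -- All values of F are taken on the compact period parallelogram, so F is bounded and
    -- Liouville's theorem applies.
    have hc : IsCompact ((fun t : ℝ × ℝ => F (t.1 * L.ω₁ + t.2 * L.ω₂)) '' (Icc 0 1 ×ˢ Icc 0 1)) := by
      refine (isCompact_Icc.prod isCompact_Icc).image ?_
      exact hFd.continuous.comp (by fun_prop)
    refine hc.isBounded.subset ?_
    rintro _ ⟨z, rfl⟩
    have hz : z = (L.basis.repr z 0 : ℝ) * L.ω₁ + (L.basis.repr z 1 : ℝ) * L.ω₂ := by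
      have := L.basis.sum_repr z
      rw [Fin.sum_univ_two] at this
      simpa using this.symm
    set s := L.basis.repr z 0
    set t := L.basis.repr z 1
    refine ⟨(Int.fract s, Int.fract t), ⟨⟨Int.fract_nonneg _, (Int.fract_lt_one _).le⟩,
      ⟨Int.fract_nonneg _, (Int.fract_lt_one _).le⟩⟩, ?_⟩
    have hmem : (⌊s⌋ : ℂ) * L.ω₁ + (⌊t⌋ : ℂ) * L.ω₂ ∈ L.lattice :=
      PeriodPair.mem_lattice.mpr ⟨_, _, rfl⟩
    refine (hper _ hmem _).symm.trans (congrArg F ?_)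
    rw [hz]
    have h1 : (s : ℂ) = (Int.fract s : ℝ) + (⌊s⌋ : ℂ) := by
      exact_mod_cast (Int.fract_add_floor s).symm
    have h2 : (t : ℂ) = (Int.fract t : ℝ) + (⌊t⌋ : ℂ) := by
      exact_mod_cast (Int.fract_add_floor t).symm
    rw [h1, h2]
    ring
  obtain ⟨c, hc⟩ := hFd.exists_const_forall_eq_of_bounded hbdd
  exact ⟨c, fun z hz => (heq hz (hFf z)).symm.trans (hc z)⟩

/-- The function f/r with f = ∑ eₖ zᵏ solves the linear equation, so f has no pole off the zeros of
c_N r. Translating by periods fixes the eₖ and changes only the powers of z; with n translates of z₀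
avoiding those zeros, no eₖ has a pole at z₀. -/
lemma noEllipticDependence {S : LinearODESystem} (hS : S ≠ 0) {I : Set ℝ}
    {W : ℝ → ℝ} (hsol : S.IsSolution I W) : NoEllipticDependence I W := by
  intro K hKI hK hne L n e r he hr hKW k
  refine (he k).exists_eq_const fun z₀ => ?_
  obtain ⟨c, hc, hode⟩ := hsol.exists_complex hS (a := 1) (b := 0) one_ne_zero
  set f : ℂ → ℂ := fun z => ∑ k : Fin n, e k z * z ^ (k : ℕ) with hf
  set u : ℂ → ℂ := fun z => f z / r.eval z with hu
  set Ω : Set ℂ := {z | (∀ k, AnalyticAt ℂ (e k) z) ∧ r.eval z ≠ 0} with hΩ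
  have hcount : Ωᶜ.Countable := by
    have h1 : Ωᶜ = (⋃ k, {z | AnalyticAt ℂ (e k) z}ᶜ) ∪ {z | r.IsRoot z} := by
      ext z
      simp only [hΩ, mem_compl_iff, mem_ofPred_eq, mem_union, mem_iUnion, Polynomial.IsRoot,
        not_and_or, not_forall, not_not]
    rw [h1]
    exact (countable_iUnion fun k => (he k).1.countable_compl_analyticAt).union
      (Polynomial.finite_setOfPred_isRoot hr).countable
  -- Meromorphic functions fail to be analytic on a countable set only, and the plane minus a
  -- countable set is connected. The equation thus continues from K past all poles.
  have hΩc : IsPreconnected Ω := by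
    have := (hcount.isPathConnected_compl_of_one_lt_rank
      (by rw [Complex.rank_real_complex]; norm_num)).isConnected.isPreconnected
    rwa [compl_compl] at this
  have hΩo : IsOpen Ω := by
    refine IsOpen.and ?_ ?_
    · rw [ofPred_forall]
      exact isOpen_iInter_of_finite fun k => isOpen_analyticAt ℂ (e k)
    · exact isOpen_ne_fun r.continuous continuous_const
  have hfA : ∀ z ∈ Ω, AnalyticAt ℂ f z := fun z hz =>
    Finset.analyticAt_fun_sum _ fun k _ => (hz.1 k).mul (by fun_prop)
  have huA : AnalyticOnNhd ℂ u Ω := fun z hz =>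
    (hfA z hz).div (Polynomial.analyticAt_eval _ _) hz.2
  have hKΩ : (K ∩ (fun x : ℝ => (x : ℂ)) ⁻¹' Ω).Nonempty := by
    have := ((hcount.preimage Complex.ofReal_injective).dense_compl ℝ).inter_open_nonempty K hK hne
    rwa [preimage_compl, compl_compl] at this
  have hlin := hode _ Ω u (inter_subset_left.trans hKI)
    (hK.inter (hΩo.preimage Complex.continuous_ofReal)) hKΩ hΩc huA fun x hx => by
      rw [one_mul, add_zero]
      refine ⟨hx.2, ?_⟩
      change _ = (∑ k : Fin n, e k x * (x : ℂ) ^ (k : ℕ)) / _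
      rw [← hKW x hx.1, mul_div_cancel_left₀ _ hx.2.2]
  obtain ⟨N, hN, hNmax⟩ : ∃ N, c N ≠ 0 ∧ ∀ k, N < k → c k = 0 := by
    obtain ⟨k, hk⟩ := Function.ne_iff.mp hc
    obtain ⟨N, hN⟩ := (Finset.univ.filter fun k => c k ≠ 0).exists_maximal ⟨k, by simpa using hk⟩
    refine ⟨N, by simpa using hN.1, fun k hk => ?_⟩
    by_contra h
    exact absurd (hN.2 (by simpa using h) hk.le) (not_le_of_gt hk)
  have humer : ∀ z, MeromorphicAt f z := fun z =>
    MeromorphicAt.fun_sum fun k _ => ((he k).1 z).mul (by fun_prop)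
  have hΩev : ∀ z, ∀ᶠ w in 𝓝[≠] z, w ∈ Ω := by
    intro z
    have h1 : ∀ᶠ w in 𝓝[≠] z, ∀ k, AnalyticAt ℂ (e k) w :=
      eventually_all.mpr fun k => ((he k).1 z).eventually_analyticAt
    have h2 : ∀ᶠ w in 𝓝[≠] z, r.eval w ≠ 0 := by
      have := (Polynomial.finite_setOfPred_isRoot hr).subset (sdiff_subset (t := {z}))
      filter_upwards [nhdsWithin_le_nhds (this.isClosed.isOpen_compl.mem_nhds (x := z) (by simp)),
        self_mem_nhdsWithin] with w hw hwz h
      exact hw ⟨h, hwz⟩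
    exact h1.and h2
  have hforder : ∀ z, (c N).eval z ≠ 0 → r.eval z ≠ 0 → 0 ≤ meromorphicOrderAt f z := by
    intro z hz hrz
    have h1 := meromorphicOrderAt_nonneg_of_linearODE (u := u) hz hNmax
      ((humer z).div (Polynomial.analyticAt_eval _ _).meromorphicAt)
      ((hΩev z).mono fun w hw => hlin w hw)
    have h2 : f =ᶠ[𝓝[≠] z] (fun z => r.eval z) * u := by
      filter_upwards [hΩev z] with w hw
      rw [Pi.mul_apply, hu, mul_div_cancel₀ _ hw.2]
    rw [meromorphicOrderAt_congr h2,
      meromorphicOrderAt_mul_of_ne_zero (Polynomial.analyticAt_eval _ _) hrz]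
    exact h1
  have hinj : Function.Injective fun j : ℕ => (j : ℂ) * L.ω₁ := fun i j hij => by
    have hω : L.ω₁ ≠ 0 := by simpa using L.indep.ne_zero 0
    exact_mod_cast mul_right_cancel₀ hω hij
  -- Only finitely many of the points z₀ + jω₁ are zeros of c_N r, so n distinct good translates
  -- exist.
  have hbad : {j : ℕ | ((c N) * r).IsRoot (z₀ + j * L.ω₁)}.Finite :=
    (Polynomial.finite_setOfPred_isRoot (mul_ne_zero hN hr)).preimage
      ((add_right_injective z₀).comp hinj).injOn
  let ι := (hbad.infinite_compl).natEmbedding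
  refine meromorphicOrderAt_nonneg_of_translates (fun k => (he k).1 z₀)
    (l := fun i : Fin n => ((ι i : ℕ) : ℂ) * L.ω₁) (fun i j hij => ?_) (fun i => ?_) k
  · exact Fin.val_injective (ι.injective (Subtype.ext (hinj hij)))
  · have hmem : (((ι i : ℕ) : ℂ) * L.ω₁) ∈ L.lattice :=
      PeriodPair.mem_lattice.mpr ⟨(ι i : ℕ), 0, by simp⟩
    have h1 : (fun z => ∑ k : Fin n, e k z * (z + ((ι i : ℕ) : ℂ) * L.ω₁) ^ (k : ℕ))
        = fun z => f (z + ((ι i : ℕ) : ℂ) * L.ω₁) := by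
      funext z
      simp only [hf, (he _).2 _ hmem]
    rw [h1, meromorphicOrderAt_fun_comp_add_const_eq_meromorphicOrderAt]
    have h2 : ¬ ((c N) * r).IsRoot (z₀ + ((ι i : ℕ) : ℂ) * L.ω₁) := (ι i).2
    rw [Polynomial.IsRoot, Polynomial.eval_mul, mul_eq_zero, not_or] at h2
    exact hforder _ h2.1 h2.2

end

noncomputable section

/-! ### The main theorem -/

section Main

variable {I J : Set ℝ} {A : ℕ → ℕ → ℕ → ℝ} {W₁ W₂ : ℝ → ℝ}

lemma smoothOnRect_sepPotential (h : IsParabolicDomain I J) (hW₁ : ContDiffOn ℝ ∞ W₁ I)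
    (hW₂ : ContDiffOn ℝ ∞ W₂ J) : SmoothOnRect I J (sepPotential W₁ W₂) :=
  ((hW₁.comp contDiffOn_fst fun _ hz => hz.1).add (hW₂.comp contDiffOn_snd fun _ hz => hz.2)).div
    ((contDiff_fst.pow 2).add (contDiff_snd.pow 2)).contDiffOn fun _ hz => h.2.2.2.2 _ hz.1 _ hz.2

lemma linearCompatibility_of_eq_zero (hA : ∀ j k l : ℕ, j + k + l = 3 → A j k l = 0)
    (V : ℝ → ℝ → ℝ) : LinearCompatibility A I J V := by
  have h1 : polyF1 A = fun _ _ => 0 := by funext ξ η; simp [polyF1, hA]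
  have h2 : polyF2 A = fun _ _ => 0 := by funext ξ η; simp [polyF2, hA]
  have h3 : polyF3 A = fun _ _ => 0 := by funext ξ η; simp [polyF3, hA]
  have h4 : polyF4 A = fun _ _ => 0 := by funext ξ η; simp [polyF4, hA]
  have hX : pdXi (fun _ _ => (0 : ℝ)) = fun _ _ => 0 := by funext ξ η; simp [pdXi]
  have hY : pdEta (fun _ _ => (0 : ℝ)) = fun _ _ => 0 := by funext ξ η; simp [pdEta]
  intro ξ _ η _
  simp [linCompat, coeffVEta, coeffVXi, h1, h2, h3, h4, hX, hY]

lemma linearCompatibility_of_integral (h : IsParabolicDomain I J) {V : ℝ → ℝ → ℝ}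
    (hV : SmoothOnRect I J V) (H : AdmitsThirdOrderIntegral I J V A) :
    LinearCompatibility A I J V := by
  obtain ⟨g₁, g₂, hg₁, hg₂, H⟩ := H
  refine linearCompatibility_of_determiningEquations h hV hg₁ hg₂ fun ξ hξ η hη => ?_
  let s : h.opens := ⟨(ξ, η), hξ, hη⟩
  rcases H with H | ⟨ħ, hħ, H⟩
  · have rV : Represents V _ := Represents.ofContDiffOn (S := h.opens) hV
    have r₁ : Represents g₁ _ := Represents.ofContDiffOn (S := h.opens) hg₁
    have r₂ : Represents g₂ _ := Represents.ofContDiffOn (S := h.opens) hg₂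
    exact determiningEquations_of_poissonBracket (h.2.2.2.2 ξ hξ η hη)
      (rV.hasDerivAt_xi s).differentiableAt (rV.hasDerivAt_eta s).differentiableAt
      (r₁.hasDerivAt_xi s).differentiableAt (r₁.hasDerivAt_eta s).differentiableAt
      (r₂.hasDerivAt_xi s).differentiableAt (r₂.hasDerivAt_eta s).differentiableAt (H ξ hξ η hη)
  · exact determiningEquations_of_quantumIntegral hħ hV hg₁ hg₂ H s

end Main

theorem mainTheorem3 :
    (∀ (A : ℕ → ℕ → ℕ → ℝ) (I J : Set ℝ), IsParabolicDomain I J →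
      ((∀ W₁ W₂ : ℝ → ℝ, ContDiffOn ℝ ∞ W₁ I → ContDiffOn ℝ ∞ W₂ J →
          LinearCompatibility A I J (sepPotential W₁ W₂)) ↔
        ∀ j k l : ℕ, j + k + l = 3 → A j k l = 0)) ∧
    (∀ A : ℕ → ℕ → ℕ → ℝ, (∃ j k l : ℕ, j + k + l = 3 ∧ A j k l ≠ 0) →
      ∃ S₁ S₂ : LinearODESystem, S₁ ≠ 0 ∧ S₂ ≠ 0 ∧
        ∀ (I J : Set ℝ) (W₁ W₂ : ℝ → ℝ), IsParabolicDomain I J →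
          ContDiffOn ℝ ∞ W₁ I → ContDiffOn ℝ ∞ W₂ J →
          (AdmitsThirdOrderIntegral I J (sepPotential W₁ W₂) A →
            LinearCompatibility A I J (sepPotential W₁ W₂)) ∧
          (LinearCompatibility A I J (sepPotential W₁ W₂) →
            S₁.IsSolution I W₁ ∧ S₂.IsSolution J W₂ ∧
            NoEllipticDependence I W₁ ∧ NoEllipticDependence J W₂ ∧
            NoPainleveDependence I W₁ ∧ NoPainleveDependence J W₂)) := by
  refine ⟨fun A I J h => ⟨fun H => eq_zero_of_linearCompatibility A h H, fun hA W₁ W₂ _ _ =>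
    linearCompatibility_of_eq_zero hA _⟩, fun A hA => ?_⟩
  have hA' : ∃ j k l : ℕ, j + k + l = 3 ∧ swapCoeff A j k l ≠ 0 := by
    obtain ⟨j, k, l, hjkl, hne⟩ := hA
    exact ⟨j, k, l, hjkl, mul_ne_zero (pow_ne_zero _ (by norm_num)) hne⟩
  refine ⟨odeSystem A, odeSystem (swapCoeff A), odeSystem_ne_zero hA, odeSystem_ne_zero hA',
    fun I J W₁ W₂ h hW₁ hW₂ => ⟨fun H => linearCompatibility_of_integral h
      (smoothOnRect_sepPotential h hW₁ hW₂) H, fun hLC => ?_⟩⟩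
  have s₁ := odeSystem_isSolution A h hW₁ hW₂ hLC
  have s₂ := odeSystem_isSolution (swapCoeff A) h.symm hW₂ hW₁ (hLC.swap h hW₁ hW₂)
  exact ⟨s₁, s₂, noEllipticDependence (odeSystem_ne_zero hA) s₁,
    noEllipticDependence (odeSystem_ne_zero hA') s₂, noPainleveDependence (odeSystem_ne_zero hA) s₁,
    noPainleveDependence (odeSystem_ne_zero hA') s₂⟩

end
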